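/- A finite simple graph $G$ is \emph{distance-hereditary} if, for every induced subgraph $H$ of $G$, any two vertices in the same connected component of $H$ have the same distance in $H$ as in $G$. A \emph{triangle packing} of $G$ is a collection of pairwise vertex-disjoint triangles of $G$; the \emph{triangle packing problem} asks for a triangle packing of maximum cardinality. \textbf{Theorem.} There is a polynomial-time algorithm that solves the triangle packing problem on distance-hereditary graphs. That is, there are a deterministic program $A$ for a random access machine (whose arithmetic operations are addition and truncated subtraction on natural numbers, each at unit cost) and a polynomial $p$ such that, for every $n \ge 0$ and every distance-hereditary graph $G$ with $n$ vertices, given by $n$ and its adjacency matrix, $A$ halts after at most $p(n)$ steps and outputs a list of the triangles of a triangle packing of $G$ of maximum cardinality. -/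

import Mathlib

/-! ## Graphs -/

/-- `G` is distance-hereditary: two vertices in the same connected component of an induced
subgraph have the same distance there as in `G`. -/
def IsDistanceHereditary {V : Type*} (G : SimpleGraph V) : Prop :=
  ∀ (s : Set V) (u v : s), (G.induce s).Reachable u v →
    (G.induce s).dist u v = G.dist (u : V) (v : V)

/-- A triangle packing of `G`: a collection of pairwise vertex-disjoint triangles of `G`. -/
def IsTrianglePacking {V : Type*} (G : SimpleGraph V) (P : Finset (Finset V)) : Prop :=
  (∀ T ∈ P, G.IsNClique 3 T) ∧ ∀ S ∈ P, ∀ T ∈ P, S ≠ T → Disjoint S T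

/-- A triangle packing of maximum cardinality. -/
def IsMaximumTrianglePacking {V : Type*} (G : SimpleGraph V) (P : Finset (Finset V)) : Prop :=
  IsTrianglePacking G P ∧ ∀ Q : Finset (Finset V), IsTrianglePacking G Q → Q.card ≤ P.card

/-! ## A random access machine

Structured programs over natural-number registers `0, 1, 2, …` and natural-number arrays
`0, 1, 2, …` (a program mentions finitely many of each), with indirect addressing and with
addition and truncated subtraction as the only arithmetic.  Every operation, memory access, test
and assignment costs one step.  Since there is no multiplication, the bit length of the stored
numbers grows by at most one per step, so that polynomial time on this machine is polynomial time
on a Turing machine. -/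

namespace RAM

/-- Contents of the registers and of the arrays. -/
structure State where
  reg : ℕ → ℕ
  arr : ℕ → ℕ → ℕ

/-- Expressions: constants, registers, array entries `a[i]`, `+`, and truncated `-`. -/
inductive Expr where
  | const (k : ℕ)
  | var (x : ℕ)
  | get (a : ℕ) (i : Expr)
  | add (e f : Expr)
  | sub (e f : Expr)

/-- The value of an expression. -/
def Expr.eval (σ : State) : Expr → ℕ
  | .const k => k
  | .var x => σ.reg x
  | .get a i => σ.arr a (i.eval σ)
  | .add e f => e.eval σ + f.eval σ
  | .sub e f => e.eval σ - f.eval σ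

/-- The number of steps for evaluating an expression: one for each operation in it. -/
def Expr.cost : Expr → ℕ
  | .const _ => 1
  | .var _ => 1
  | .get _ i => i.cost + 1
  | .add e f => e.cost + f.cost + 1
  | .sub e f => e.cost + f.cost + 1

/-- Programs. -/
inductive Prog where
  | skip
  /-- `x := e` -/
  | assign (x : ℕ) (e : Expr)
  /-- `a[i] := e` -/
  | store (a : ℕ) (i e : Expr)
  | seq (c d : Prog)
  /-- run `c` if `e ≠ 0`, and `d` otherwise -/
  | branch (e : Expr) (c d : Prog)
  /-- repeat `c` while `e ≠ 0` -/
  | loop (e : Expr) (c : Prog)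

/-- The state after `x := v`. -/
def State.setReg (σ : State) (x v : ℕ) : State :=
  ⟨Function.update σ.reg x v, σ.arr⟩

/-- The state after `a[i] := v`. -/
def State.setArr (σ : State) (a i v : ℕ) : State :=
  ⟨σ.reg, Function.update σ.arr a (Function.update (σ.arr a) i v)⟩

/-- `Exec c σ t τ`: the program `c`, started in state `σ`, halts after exactly `t` steps in
state `τ`. -/
inductive Exec : Prog → State → ℕ → State → Prop where
  | skip (σ : State) : Exec .skip σ 1 σ
  | assign (x : ℕ) (e : Expr) (σ : State) :
      Exec (.assign x e) σ (e.cost + 1) (σ.setReg x (e.eval σ))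
  | store (a : ℕ) (i e : Expr) (σ : State) :
      Exec (.store a i e) σ (i.cost + e.cost + 1) (σ.setArr a (i.eval σ) (e.eval σ))
  | seq {c d : Prog} {σ τ υ : State} {s t : ℕ} :
      Exec c σ s τ → Exec d τ t υ → Exec (.seq c d) σ (s + t) υ
  | branch_true {e : Expr} {c d : Prog} {σ τ : State} {t : ℕ} :
      e.eval σ ≠ 0 → Exec c σ t τ → Exec (.branch e c d) σ (e.cost + 1 + t) τ
  | branch_false {e : Expr} {c d : Prog} {σ τ : State} {t : ℕ} :
      e.eval σ = 0 → Exec d σ t τ → Exec (.branch e c d) σ (e.cost + 1 + t) τ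
  | loop_true {e : Expr} {c : Prog} {σ τ υ : State} {s t : ℕ} :
      e.eval σ ≠ 0 → Exec c σ s τ → Exec (.loop e c) τ t υ →
        Exec (.loop e c) σ (e.cost + 1 + s + t) υ
  | loop_false {e : Expr} {c : Prog} {σ : State} :
      e.eval σ = 0 → Exec (.loop e c) σ (e.cost + 1) σ

/-- The machine is deterministic: the running time and the final state are unique. -/
theorem Exec.deterministic {c : Prog} {σ τ τ' : State} {t t' : ℕ}
    (h : Exec c σ t τ) (h' : Exec c σ t' τ') : t = t' ∧ τ = τ' := by
  induction h generalizing t' τ' with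
  | skip σ => cases h'; exact ⟨rfl, rfl⟩
  | assign x e σ => cases h'; exact ⟨rfl, rfl⟩
  | store a i e σ => cases h'; exact ⟨rfl, rfl⟩
  | seq _ _ ih₁ ih₂ =>
    cases h' with
    | seq h₁ h₂ =>
      obtain ⟨rfl, rfl⟩ := ih₁ h₁
      obtain ⟨rfl, rfl⟩ := ih₂ h₂
      exact ⟨rfl, rfl⟩
  | branch_true he _ ih =>
    cases h' with
    | branch_true _ h₁ => obtain ⟨rfl, rfl⟩ := ih h₁; exact ⟨rfl, rfl⟩
    | branch_false he' _ => exact absurd he' he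
  | branch_false he _ ih =>
    cases h' with
    | branch_true he' _ => exact absurd he he'
    | branch_false _ h₁ => obtain ⟨rfl, rfl⟩ := ih h₁; exact ⟨rfl, rfl⟩
  | loop_true he _ _ ih₁ ih₂ =>
    cases h' with
    | loop_true _ h₁ h₂ =>
      obtain ⟨rfl, rfl⟩ := ih₁ h₁
      obtain ⟨rfl, rfl⟩ := ih₂ h₂
      exact ⟨rfl, rfl⟩
    | loop_false he' => exact absurd he' he
  | loop_false he =>
    cases h' with
    | loop_true he' _ _ => exact absurd he he'
    | loop_false _ => exact ⟨rfl, rfl⟩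

end RAM

/-! ## Input and output -/

open Classical in
/-- The initial state on a graph with vertices `0, …, n - 1`: register `0` holds `n`, array `0`
holds the adjacency matrix row by row (entry `n * u + v` is `1` if `u` and `v` are adjacent), and
everything else is `0`. -/
noncomputable def graphInput {n : ℕ} (G : SimpleGraph (Fin n)) : RAM.State where
  reg x := if x = 0 then n else 0
  arr a k := if a = 0 ∧ ∃ u v : Fin n, G.Adj u v ∧ k = n * u + v then 1 else 0

/-- The state `σ` presents the packing `P`: register `1` holds the number of triangles of `P`, and
entries `3 * i`, `3 * i + 1`, `3 * i + 2` of array `1`, for `i` below that number, are the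
vertices of the `i`-th triangle. As the number is the cardinality of `P`, no triangle is listed
twice. -/
def OutputsPacking {n : ℕ} (σ : RAM.State) (P : Finset (Finset (Fin n))) : Prop :=
  σ.reg 1 = P.card ∧
    ∀ T : Finset (Fin n), T ∈ P ↔ ∃ i < σ.reg 1,
      T.image (fun v : Fin n => (v : ℕ)) =
        {σ.arr 1 (3 * i), σ.arr 1 (3 * i + 1), σ.arr 1 (3 * i + 2)}

/-!
A distance-hereditary graph can be contracted to a single vertex by merging pairs of vertices, and
the number of triangles that can be packed can be followed through the contraction.

*Pruning.* Every set of at least two vertices of a distance-hereditary graph contains a pair `u`,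
`v` such that, within the set, `u` and `v` are twins or `v` has no neighbour but `u`
(`IsDistanceHereditary.exists_prunable_mem`). The pair is found at the last distance level from
some vertex: vertices in a component of that level have the same neighbours one level up, hence a
common neighbour, so the component contains no induced path on four vertices and, unless it is a
single vertex, has twins. If the last level has no edges, a vertex in it with as few neighbours as
possible is pendant, or there are twins among its neighbours.

*Contraction.* In the course of merging such pairs, a remaining vertex `u` represents a set `U u`
of vertices, of which those in `S u ⊆ U u` have the same neighbours outside `U u`, and the others
none (`IsDecomposition`). A triangle packing meets `U u` in a partial packing, which consists of
triangles, edges within `S u` and single vertices in `S u`. All that matters for the rest of the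
graph is the numbers of these, and the triples that occur form a table with at most `(n + 1) ^ 3`
entries. The table of a merged vertex is determined by the tables of its two parts
(`Mergeable.achieves_union_iff`): between the parts, all vertices of `S u` and `S v` are adjacent or
none, so that single vertices and edges of the parts can be combined arbitrarily, and only the
numbers of the combinations count. The last table gives the packing number.

*Output.* A maximum packing is found greedily: a triangle is added to the packing if the packing
number of the remaining graph drops by one only. A triangle that is rejected once would be rejected
at any later time (`IsRejected.union`), so it is enough to try every triangle once. The packing
number of a graph without some of its vertices is computed with the contraction of the whole graph,
where these vertices represent the empty set.

*Running time.* The programs are written in a language whose only loops are counting loops with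
`n + k` iterations for a constant `k`. Such a program always terminates, its effect is a function
`RAM.Cmd.run` on states, and its running time is bounded by a polynomial that can be read off from
the program (`RAM.Cmd.exec_compile`). What remains is to determine the effect of the program, by
means of loop invariants.
-/

open SimpleGraph

/-! ### Pruning distance-hereditary graphs -/

namespace SimpleGraph

variable {V : Type*} {G : SimpleGraph V}

theorem Iso.dist_eq {W : Type*} {H : SimpleGraph W} (f : G ≃g H) (u v : V) :
    H.dist (f u) (f v) = G.dist u v := by
  have key : ∀ {V' W' : Type _} {G' : SimpleGraph V'} {H' : SimpleGraph W'} (g : G' →g H')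
      (a b : V'), G'.Reachable a b → H'.dist (g a) (g b) ≤ G'.dist a b := by
    intro V' W' G' H' g a b hr
    obtain ⟨p, hp⟩ := hr.exists_walk_length_eq_dist
    simpa [← hp] using dist_le (p.map g)
  by_cases hr : G.Reachable u v
  · refine le_antisymm (key f.toHom u v hr) ?_
    obtain ⟨p, hp⟩ := (hr.map f.toHom).exists_walk_length_eq_dist
    have h := dist_le (p.map f.symm.toHom)
    rw [Walk.length_map, hp] at h
    simpa using h
  · rw [dist_eq_zero_of_not_reachable hr,
      dist_eq_zero_of_not_reachable (by rwa [Iso.reachable_iff])]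

/-- `G.ReachableIn s x y`: the vertices `x` and `y` lie in `s` and in the same connected component
of the subgraph induced by `s`. -/
def ReachableIn (G : SimpleGraph V) (s : Set V) (x y : V) : Prop :=
  ∃ (hx : x ∈ s) (hy : y ∈ s), (G.induce s).Reachable ⟨x, hx⟩ ⟨y, hy⟩

namespace ReachableIn

variable {s t : Set V} {x y z : V}

theorem refl (hx : x ∈ s) : G.ReachableIn s x x := ⟨hx, hx, .rfl⟩

theorem of_adj (hx : x ∈ s) (hy : y ∈ s) (h : G.Adj x y) : G.ReachableIn s x y :=
  ⟨hx, hy, Adj.reachable (by simpa using h)⟩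

theorem symm : G.ReachableIn s x y → G.ReachableIn s y x
  | ⟨hx, hy, h⟩ => ⟨hy, hx, h.symm⟩

theorem trans : G.ReachableIn s x y → G.ReachableIn s y z → G.ReachableIn s x z
  | ⟨hx, _, h⟩, ⟨_, hz, h'⟩ => ⟨hx, hz, h.trans h'⟩

theorem mono (hst : s ⊆ t) : G.ReachableIn s x y → G.ReachableIn t x y
  | ⟨hx, hy, h⟩ => ⟨hst hx, hst hy, h.map (G.induceHomOfLE hst).toHom⟩

end ReachableIn

end SimpleGraph

namespace IsDistanceHereditary

variable {V : Type*} {G : SimpleGraph V}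

theorem induce (hG : IsDistanceHereditary G) (A : Set V) : IsDistanceHereditary (G.induce A) := by
  intro s u v huv
  let e : s ≃ (Subtype.val '' s : Set V) :=
    Equiv.Set.image Subtype.val s Subtype.val_injective
  let f : (G.induce A).induce s ≃g G.induce (Subtype.val '' s) :=
    { toEquiv := e, map_rel_iff' := by intro a b; rfl }
  have huv' : (G.induce (Subtype.val '' s)).Reachable (f u) (f v) := huv.map f.toHom
  have h1 := hG _ _ _ huv'
  rw [f.dist_eq] at h1
  have hA : (G.induce A).Reachable u.1 v.1 := huv.map (Embedding.induce s).toHom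
  rw [h1, hG A _ _ hA]
  rfl

/-- Two vertices at distance two keep a common neighbour in every induced subgraph that
connects them. -/
theorem exists_common_neighbor (hG : IsDistanceHereditary G) {s : Set V} {x w e : V}
    (hr : G.ReachableIn s x w) (hne : x ≠ w) (hxw : ¬ G.Adj x w)
    (hxe : G.Adj x e) (hwe : G.Adj w e) : ∃ q ∈ s, G.Adj x q ∧ G.Adj w q := by
  obtain ⟨hx, hw, hr⟩ := hr
  obtain ⟨p, hp⟩ := hr.exists_walk_length_eq_dist
  have h2 : G.dist x w ≤ 2 := dist_le (Walk.cons hxe (Walk.cons hwe.symm Walk.nil))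
  rw [hG _ _ _ hr] at hp
  cases p with
  | nil => exact absurd rfl hne
  | cons h p' =>
    cases p' with
    | nil => exact absurd (by simpa using h) hxw
    | @cons _ q _ h' p'' =>
      cases p'' with
      | nil => exact ⟨_, Subtype.property _, by simpa using h, (by simpa using h' : G.Adj _ _).symm⟩
      | cons h'' p''' =>
        simp only [Walk.length_cons] at hp
        change _ = G.dist x w at hp
        omega

/-- There is no induced path on four vertices whose ends have a common neighbour. -/
theorem not_path_four (hG : IsDistanceHereditary G) {a b c d e : V} (hab : G.Adj a b)
    (hbc : G.Adj b c) (hcd : G.Adj c d) (hac : ¬ G.Adj a c) (hbd : ¬ G.Adj b d)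
    (had : ¬ G.Adj a d) (hae : G.Adj a e) (hde : G.Adj d e) : False := by
  have hne : a ≠ d := by rintro rfl; exact hac hcd.symm
  have hr : G.ReachableIn {a, b, c, d} a d :=
    ((ReachableIn.of_adj (by simp) (by simp) hab).trans
      (.of_adj (by simp) (by simp) hbc)).trans (.of_adj (by simp) (by simp) hcd)
  obtain ⟨q, hq, h1, h2⟩ := hG.exists_common_neighbor hr hne had hae hde
  rcases hq with rfl | rfl | rfl | rfl
  · exact G.irrefl h1
  · exact hbd h2.symm
  · exact hac h1
  · exact had h1

end IsDistanceHereditary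

/-! ### Twins in cographs -/

namespace SimpleGraph

variable {V : Type*} {G : SimpleGraph V}

/-- The subgraph of `G` induced by `X` has no induced path on four vertices. The non-adjacencies
force the four vertices to be distinct. -/
def PathFourFree (G : SimpleGraph V) (X : Finset V) : Prop :=
  ∀ a ∈ X, ∀ b ∈ X, ∀ c ∈ X, ∀ d ∈ X, G.Adj a b → G.Adj b c → G.Adj c d →
    ¬ G.Adj a c → ¬ G.Adj b d → ¬ G.Adj a d → False

theorem PathFourFree.mono {X Y : Finset V} (h : G.PathFourFree X) (hY : Y ⊆ X) :
    G.PathFourFree Y :=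
  fun a ha b hb c hc d hd => h a (hY ha) b (hY hb) c (hY hc) d (hY hd)

/-- The complement of a path on four vertices is a path on four vertices. -/
theorem PathFourFree.compl {X : Finset V} (h : G.PathFourFree X) : Gᶜ.PathFourFree X := by
  intro a ha b hb c hc d hd hab hbc hcd hac hbd had
  have n1 : a ≠ c := by rintro rfl; exact had hcd
  have n2 : b ≠ d := by rintro rfl; exact had hab
  have n3 : a ≠ d := by rintro rfl; exact hac hcd.symm
  simp only [compl_adj, not_and, not_not, ne_eq] at *
  exact h c hc a ha d hd b hb (hac n1).symm (had n3) (hbd n2).symm hcd.2 hab.2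
    (fun h => hbc.2 h.symm)

/-- `X` is the union of two nonempty disjoint sets with all edges or no edges between them. -/
def UniformSplit (G : SimpleGraph V) (X : Finset V) : Prop :=
  ∃ Y Z : Finset V, Y.Nonempty ∧ Z.Nonempty ∧ (∀ v, v ∈ X ↔ v ∈ Y ∨ v ∈ Z) ∧
    (∀ y ∈ Y, ∀ z ∈ Z, y ≠ z) ∧
    ((∀ y ∈ Y, ∀ z ∈ Z, G.Adj y z) ∨ ∀ y ∈ Y, ∀ z ∈ Z, ¬ G.Adj y z)

theorem UniformSplit.of_compl {X : Finset V} (h : Gᶜ.UniformSplit X) : G.UniformSplit X := by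
  obtain ⟨Y, Z, hY, hZ, hX, hne, h⟩ := h
  refine ⟨Y, Z, hY, hZ, hX, hne, ?_⟩
  rcases h with h | h
  · exact .inr fun y hy z hz => ((compl_adj ..).1 (h y hy z hz)).2
  · refine .inl fun y hy z hz => ?_
    have := h y hy z hz
    simp only [compl_adj, not_and, not_not] at this
    exact this (hne y hy z hz)

open Classical in
/-- If the new vertex `v` has neighbours on both sides of a partition without edges between the
sides, and non-neighbours as well, then the non-neighbours of `v` can be split off: an edge from
a non-neighbour to a neighbour of `v` would extend over `v`, to a neighbour of `v` on the other
side, to an induced path on four vertices. -/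
theorem uniformSplit_insert {X Y Z : Finset V} {v : V} (hv : v ∉ X)
    (hP : G.PathFourFree (insert v X)) (hY : Y.Nonempty) (hZ : Z.Nonempty)
    (hX : ∀ w, w ∈ X ↔ w ∈ Y ∨ w ∈ Z) (hne : ∀ y ∈ Y, ∀ z ∈ Z, y ≠ z)
    (hno : ∀ y ∈ Y, ∀ z ∈ Z, ¬ G.Adj y z) : G.UniformSplit (insert v X) := by
  have hvY : ∀ y ∈ Y, y ≠ v := fun y hy e => hv (e ▸ (hX y).2 (.inl hy))
  have hvZ : ∀ z ∈ Z, z ≠ v := fun z hz e => hv (e ▸ (hX z).2 (.inr hz))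
  by_cases hA : ∀ w ∈ X, G.Adj v w
  · refine ⟨{v}, X, by simp, hY.mono fun y hy => (hX y).2 (.inl hy), by simp, ?_, .inl ?_⟩
    · simp only [Finset.mem_singleton, forall_eq]
      rintro z hz rfl
      exact hv hz
    · simpa using hA
  by_cases hYN : ∀ y ∈ Y, ¬ G.Adj v y
  · refine ⟨Y, insert v Z, hY, by simp, ?_, ?_, .inr ?_⟩
    · intro w; rw [Finset.mem_insert, hX, Finset.mem_insert]; tauto
    · intro y hy z hz
      rcases Finset.mem_insert.1 hz with rfl | hz
      exacts [hvY y hy, hne y hy z hz]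
    · intro y hy z hz
      rcases Finset.mem_insert.1 hz with rfl | hz
      exacts [fun h => hYN y hy h.symm, hno y hy z hz]
  by_cases hZN : ∀ z ∈ Z, ¬ G.Adj v z
  · refine ⟨insert v Y, Z, by simp, hZ, ?_, ?_, .inr ?_⟩
    · intro w; rw [Finset.mem_insert, hX, Finset.mem_insert]; tauto
    · intro y hy z hz
      rcases Finset.mem_insert.1 hy with rfl | hy
      exacts [(hvZ z hz).symm, hne y hy z hz]
    · intro y hy z hz
      rcases Finset.mem_insert.1 hy with rfl | hy
      exacts [hZN z hz, hno y hy z hz]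
  push Not at hA hYN hZN
  obtain ⟨a, haX, hva⟩ := hA
  obtain ⟨y₀, hy₀, hvy₀⟩ := hYN
  obtain ⟨z₀, hz₀, hvz₀⟩ := hZN
  refine ⟨X.filter (fun w => ¬ G.Adj v w), insert v (X.filter (fun w => G.Adj v w)),
    ⟨a, by simp [haX, hva]⟩, by simp, ?_, ?_, .inr ?_⟩
  · intro w
    simp only [Finset.mem_insert, Finset.mem_filter]
    tauto
  · simp only [Finset.mem_insert, Finset.mem_filter]
    rintro y ⟨hy, hvy⟩ z (rfl | ⟨hz, hvz⟩) rfl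
    exacts [hv hy, hvy hvz]
  · simp only [Finset.mem_insert, Finset.mem_filter]
    rintro y ⟨hy, hvy⟩ z (rfl | ⟨hz, hvz⟩) hyz
    · exact hvy hyz.symm
    have hin : ∀ w, w ∈ X → w ∈ insert v X := fun w hw => Finset.mem_insert_of_mem hw
    rcases (hX z).1 hz with hz' | hz'
    · have hy' : y ∈ Y := ((hX y).1 hy).resolve_right fun h => hno z hz' y h hyz.symm
      exact hP z₀ (hin _ ((hX _).2 (.inr hz₀))) v (by simp) z (hin _ hz) y (hin _ hy)
        hvz₀.symm hvz hyz.symm (fun h => hno z hz' z₀ hz₀ h.symm) hvy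
        (fun h => hno y hy' z₀ hz₀ h.symm)
    · have hy' : y ∈ Z := ((hX y).1 hy).resolve_left fun h => hno y h z hz' hyz
      exact hP y₀ (hin _ ((hX _).2 (.inl hy₀))) v (by simp) z (hin _ hz) y (hin _ hy)
        hvy₀.symm hvz hyz.symm (hno y₀ hy₀ z hz') hvy (hno y₀ hy₀ y hy')

open Classical in
theorem PathFourFree.uniformSplit (X : Finset V) :
    ∀ G : SimpleGraph V, 1 < X.card → G.PathFourFree X → G.UniformSplit X := by
  induction X using Finset.induction_on with
  | empty => simp
  | insert v X hv ih =>
    intro G hc hP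
    rw [Finset.card_insert_of_notMem hv] at hc
    by_cases h1 : X.card = 1
    · obtain ⟨w, rfl⟩ := Finset.card_eq_one.1 h1
      refine ⟨{v}, {w}, by simp, by simp, by simp, ?_, ?_⟩
      · simpa using hv
      · simpa using _root_.em (G.Adj v w)
    obtain ⟨Y, Z, hY, hZ, hX, hne, h | h⟩ := ih G (by omega) (hP.mono (Finset.subset_insert _ _))
    · refine .of_compl (uniformSplit_insert hv hP.compl hY hZ hX hne ?_)
      intro y hy z hz
      simp [h y hy z hz]
    · exact uniformSplit_insert hv hP hY hZ hX hne h

/-- `u` and `v` have the same neighbours in `X`, apart from `u` and `v`. -/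
def TwinsIn (G : SimpleGraph V) (X : Finset V) (u v : V) : Prop :=
  ∀ w ∈ X, w ≠ u → w ≠ v → (G.Adj u w ↔ G.Adj v w)

theorem PathFourFree.exists_twins {X : Finset V} (hc : 1 < X.card) (hP : G.PathFourFree X) :
    ∃ u ∈ X, ∃ v ∈ X, u ≠ v ∧ G.TwinsIn X u v := by
  classical
  induction X using Finset.strongInduction with
  | H X ih =>
    obtain ⟨Y, Z, hY, hZ, hX, hne, huni⟩ := PathFourFree.uniformSplit X G hc hP
    -- twins of one side of a uniform split are twins of the whole
    have side : ∀ Y Z : Finset V, Z.Nonempty → (∀ v, v ∈ X ↔ v ∈ Y ∨ v ∈ Z) →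
        (∀ y ∈ Y, ∀ z ∈ Z, y ≠ z) →
        ((∀ y ∈ Y, ∀ z ∈ Z, G.Adj y z) ∨ ∀ y ∈ Y, ∀ z ∈ Z, ¬ G.Adj y z) → 1 < Y.card →
        ∃ u ∈ X, ∃ v ∈ X, u ≠ v ∧ G.TwinsIn X u v := by
      intro Y Z hZ hX hne huni hYc
      have hYX : Y ⊆ X := fun y hy => (hX y).2 (.inl hy)
      have hss : Y ⊂ X := by
        obtain ⟨z, hz⟩ := hZ
        exact (Finset.ssubset_iff_of_subset hYX).2
          ⟨z, (hX z).2 (.inr hz), fun h => hne z h z hz rfl⟩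
      obtain ⟨u, hu, v, hv, huv, ht⟩ := ih Y hss hYc (hP.mono hYX)
      refine ⟨u, hYX hu, v, hYX hv, huv, fun w hw hwu hwv => ?_⟩
      rcases (hX w).1 hw with hw | hw
      · exact ht w hw hwu hwv
      · rcases huni with h | h
        · exact iff_of_true (h u hu w hw) (h v hv w hw)
        · exact iff_of_false (h u hu w hw) (h v hv w hw)
    by_cases hYc : 1 < Y.card
    · exact side Y Z hZ hX hne huni hYc
    by_cases hZc : 1 < Z.card
    · refine side Z Y hY (fun v => (hX v).trans or_comm) (fun y hy z hz => (hne z hz y hy).symm)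
        ?_ hZc
      exact huni.imp (fun h y hy z hz => (h z hz y hy).symm)
        (fun h y hy z hz e => h z hz y hy e.symm)
    obtain ⟨y, rfl⟩ := Finset.card_eq_one.1 (le_antisymm (not_lt.1 hYc) hY.card_pos)
    obtain ⟨z, rfl⟩ := Finset.card_eq_one.1 (le_antisymm (not_lt.1 hZc) hZ.card_pos)
    simp only [Finset.mem_singleton] at hX hne
    refine ⟨y, (hX y).2 (.inl rfl), z, (hX z).2 (.inr rfl), hne y rfl z rfl, ?_⟩
    intro w hw h1 h2
    rcases (hX w).1 hw with h | h <;> contradiction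

end SimpleGraph

/-! ### Distance levels of a distance-hereditary graph -/

namespace SimpleGraph

variable {V : Type*} {G : SimpleGraph V} {r x y : V} {j k : ℕ}

/-- The vertex `x` is at distance `k` from `r`, in the same connected component. -/
def Level (G : SimpleGraph V) (r : V) (k : ℕ) (x : V) : Prop :=
  G.Reachable r x ∧ G.dist r x = k

theorem Level.unique (h : G.Level r k x) (h' : G.Level r j x) : k = j := h.2.symm.trans h'.2

theorem level_zero_iff : G.Level r 0 x ↔ x = r := by
  refine ⟨fun h => (h.1.dist_eq_zero_iff.1 h.2).symm, ?_⟩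
  rintro rfl
  exact ⟨.rfl, dist_self⟩

theorem Level.adj (h : G.Level r k x) (hxy : G.Adj x y) :
    ∃ j, G.Level r j y ∧ j ≤ k + 1 ∧ k ≤ j + 1 := by
  have hy : G.Reachable r y := h.1.trans hxy.reachable
  refine ⟨_, ⟨hy, rfl⟩, ?_, ?_⟩
  · obtain ⟨p, hp⟩ := h.1.exists_walk_length_eq_dist
    have := dist_le (p.concat hxy)
    rw [Walk.length_concat, hp, h.2] at this
    exact this
  · obtain ⟨p, hp⟩ := hy.exists_walk_length_eq_dist
    have := dist_le (p.concat hxy.symm)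
    rw [Walk.length_concat, hp, h.2] at this
    exact this

theorem Level.exists_pred (h : G.Level r (k + 1) x) : ∃ y, G.Adj y x ∧ G.Level r k y := by
  obtain ⟨p, hp⟩ := h.1.symm.exists_walk_length_eq_dist
  rw [dist_comm, h.2] at hp
  cases p with
  | nil => simp at hp
  | @cons _ y _ hxy q =>
    simp only [Walk.length_cons, Nat.add_right_cancel_iff] at hp
    have hy : G.Reachable r y := q.reachable.symm
    obtain ⟨j, hj, -, h2⟩ := Level.adj (G := G) (r := r) ⟨hy, rfl⟩ hxy.symm
    have h3 : G.dist r y ≤ k := by rw [dist_comm, ← hp]; exact dist_le q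
    have := h.unique hj
    obtain ⟨j', hj', h4, -⟩ := Level.adj (G := G) (r := r) ⟨hy, rfl⟩ hxy.symm
    have := h.unique hj'
    exact ⟨y, hxy.symm, hy, by omega⟩

/-- The vertices `u` and `v` are twins, or `v` has no neighbour other than `u`. -/
def Prunable (G : SimpleGraph V) (u v : V) : Prop :=
  u ≠ v ∧ ((∀ w, w ≠ u → w ≠ v → (G.Adj u w ↔ G.Adj v w)) ∨ ∀ w, w ≠ u → w ≠ v → ¬ G.Adj v w)

end SimpleGraph

namespace IsDistanceHereditary

variable {V : Type*} {G : SimpleGraph V} {r : V} {k : ℕ}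

/-- Vertices in the same component of a subgraph of deeper levels have the same neighbours one
level up: deleting every other vertex of that upper level must not change their distance
from `r`. -/
theorem adj_of_level (hG : IsDistanceHereditary G) {p x y : V} (hp : G.Level r k p)
    (hx : G.Level r (k + 1) x) (hy : G.Level r (k + 1) y) (hpx : G.Adj p x)
    (hxy : G.ReachableIn {v | ¬ G.Level r k v} x y) : G.Adj p y := by
  set s : Set V := {v | G.Level r k v → v = p} with hs
  have down : ∀ j, j ≤ k → ∀ v, G.Level r j v → v ∈ s → G.ReachableIn s r v := by
    intro j
    induction j with
    | zero =>
      intro _ v hv hvs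
      obtain rfl := level_zero_iff.1 hv
      exact .refl hvs
    | succ j ih =>
      intro hj v hv hvs
      obtain ⟨w, hwv, hw⟩ := hv.exists_pred
      have hws : w ∈ s := fun h => absurd (hw.unique h) (by omega)
      exact (ih (by omega) w hw hws).trans (.of_adj hws hvs hwv)
  have hps : p ∈ s := fun _ => rfl
  have hxs : x ∈ s := fun h => absurd (hx.unique h) (by omega)
  obtain ⟨hr', hy', hreach⟩ : G.ReachableIn s r y :=
    ((down k le_rfl p hp hps).trans (.of_adj hps hxs hpx)).trans
      (hxy.mono fun v hv h => absurd h hv)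
  have hlev : (G.induce s).Level ⟨r, hr'⟩ (k + 1) ⟨y, hy'⟩ :=
    ⟨hreach, (hG s _ _ hreach).trans hy.2⟩
  obtain ⟨⟨q, hq⟩, hqy, hql⟩ := hlev.exists_pred
  have : G.Level r k q :=
    ⟨hql.1.map (Embedding.induce s).toHom, (hG s _ _ hql.1).symm.trans hql.2⟩
  obtain rfl := hq this
  simpa using hqy

section Fintype

variable [Fintype V]

/-- If the last level contains an edge, twins can be found among the vertices of a component of
that level. -/
theorem exists_prunable_of_adj (hG : IsDistanceHereditary G)
    (hlast : ∀ j x, G.Level r j x → j ≤ k + 1) {x y : V} (hx : G.Level r (k + 1) x)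
    (hy : G.Level r (k + 1) y) (hxy : G.Adj x y) : ∃ u v, G.Prunable u v := by
  classical
  set L : Set V := {v | G.Level r (k + 1) v} with hL
  set C : Finset V := Finset.univ.filter (fun v => G.ReachableIn L x v) with hC
  have hLk : L ⊆ {v | ¬ G.Level r k v} := fun v hv h => absurd (hv.unique h) (by simp)
  have hlevC : ∀ v ∈ C, G.Level r (k + 1) v := fun v hv => (Finset.mem_filter.1 hv).2.2.1
  have hreach : ∀ u ∈ C, ∀ v ∈ C, G.ReachableIn L u v := fun u hu v hv =>
    (Finset.mem_filter.1 hu).2.symm.trans (Finset.mem_filter.1 hv).2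
  have hclosed : ∀ u ∈ C, ∀ w ∈ L, G.Adj u w → w ∈ C := fun u hu w hw huw =>
    Finset.mem_filter.2 ⟨Finset.mem_univ _,
      (Finset.mem_filter.1 hu).2.trans (.of_adj (hlevC u hu) hw huw)⟩
  have hxC : x ∈ C := Finset.mem_filter.2 ⟨Finset.mem_univ _, .refl hx⟩
  have hyC : y ∈ C := hclosed x hxC y hy hxy
  obtain ⟨p, hpx, hp⟩ := hx.exists_pred
  have hpC : ∀ v ∈ C, G.Adj p v := fun v hv =>
    hG.adj_of_level hp hx (hlevC v hv) hpx ((hreach x hxC v hv).mono hLk)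
  have hP : G.PathFourFree C := fun a ha b _ c _ d hd hab hbc hcd hac hbd had =>
    hG.not_path_four hab hbc hcd hac hbd had (hpC a ha).symm (hpC d hd).symm
  obtain ⟨u, hu, v, hv, huv, ht⟩ := hP.exists_twins
    (Finset.one_lt_card.2 ⟨x, hxC, y, hyC, hxy.ne⟩)
  have half : ∀ u ∈ C, ∀ v ∈ C, G.TwinsIn C u v → ∀ w, w ≠ u → w ≠ v → G.Adj u w → G.Adj v w := by
    intro u hu v hv ht w hwu hwv huw
    obtain ⟨j, hj, -, h2⟩ := (hlevC u hu).adj huw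
    have h1 := hlast j w hj
    by_cases hjk : j = k
    · subst hjk
      exact (hG.adj_of_level hj (hlevC u hu) (hlevC v hv) huw.symm
        ((hreach u hu v hv).mono hLk)).symm
    · obtain rfl : j = k + 1 := by omega
      exact (ht w (hclosed u hu w hj huw) hwu hwv).1 huw
  exact ⟨u, v, huv, .inl fun w hwu hwv => ⟨half u hu v hv ht w hwu hwv,
    half v hv u hu (fun w hw h1 h2 => (ht w hw h2 h1).symm) w hwv hwu⟩⟩

/-- If the last level has no edges, a vertex `x` of it with as few neighbours as possible either
is pendant or has twins among its neighbours. -/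
theorem exists_prunable_of_not_adj (hG : IsDistanceHereditary G)
    (hlast : ∀ j x, G.Level r j x → j ≤ k + 1) (hne : ∃ x, G.Level r (k + 1) x)
    (hind : ∀ x y, G.Level r (k + 1) x → G.Level r (k + 1) y → ¬ G.Adj x y) :
    ∃ u v, G.Prunable u v := by
  classical
  obtain ⟨x, hxL, hmin⟩ := Finset.exists_min_image
    (Finset.univ.filter (fun v => G.Level r (k + 1) v)) (fun v => (G.neighborFinset v).card)
    (by obtain ⟨x, hx⟩ := hne; exact ⟨x, by simpa using hx⟩)
  simp only [Finset.mem_filter, Finset.mem_univ, true_and] at hxL hmin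
  -- the neighbours of the last level are one level up
  have hup : ∀ w z, G.Level r (k + 1) w → G.Adj w z → G.Level r k z := by
    intro w z hw hwz
    obtain ⟨j, hj, -, h2⟩ := hw.adj hwz
    have h1 := hlast j z hj
    by_cases hjk : j = k
    · exact hjk ▸ hj
    · obtain rfl : j = k + 1 := by omega
      exact absurd hwz (hind w z hw hj)
  set M := G.neighborFinset x with hM
  have hMx : ∀ z, z ∈ M ↔ G.Adj x z := fun z => by simp [hM]
  obtain ⟨p, hpx, hp⟩ := hxL.exists_pred
  by_cases hc : M.card ≤ 1
  · refine ⟨p, x, hpx.ne, .inr fun w hw _ hxw => hw ?_⟩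
    exact Finset.card_le_one.1 hc w ((hMx w).2 hxw) p ((hMx p).2 hpx.symm)
  have hMlev : ∀ z ∈ M, G.Level r k z := fun z hz => hup x z hxL ((hMx z).1 hz)
  have hP : G.PathFourFree M := fun a ha b _ c _ d hd hab hbc hcd hac hbd had =>
    hG.not_path_four hab hbc hcd hac hbd had ((hMx a).1 ha).symm ((hMx d).1 hd).symm
  obtain ⟨u, hu, v, hv, huv, ht⟩ := hP.exists_twins (by omega)
  -- the level of `M` is not that of the root
  obtain ⟨m, rfl⟩ : ∃ m, k = m + 1 := by
    cases k with
    | zero =>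
      exact absurd ((level_zero_iff.1 (hMlev u hu)).trans (level_zero_iff.1 (hMlev v hv)).symm) huv
    | succ m => exact ⟨m, rfl⟩
  have hnm : ∀ z j, G.Level r j z → j ≠ m → z ∈ {v | ¬ G.Level r m v} :=
    fun z j hz hj h => hj (hz.unique h)
  have hxnm := hnm x _ hxL (by omega)
  have step : ∀ a b, a ∈ {v | ¬ G.Level r m v} → b ∈ {v | ¬ G.Level r m v} → G.Adj a b →
      G.ReachableIn {v | ¬ G.Level r m v} a b := fun a b ha hb h => .of_adj ha hb h
  have half : ∀ u ∈ M, ∀ v ∈ M, G.TwinsIn M u v → ∀ w, w ≠ u → w ≠ v → G.Adj u w → G.Adj v w := by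
    intro u hu v hv ht w hwu hwv huw
    by_contra hvw
    have hux := ((hMx u).1 hu).symm
    have hvx := ((hMx v).1 hv).symm
    have hul := hMlev u hu
    have hvl := hMlev v hv
    have hunm := hnm u _ hul (by omega)
    have hvnm := hnm v _ hvl (by omega)
    have huvr := (step u x hunm hxnm hux).trans (step x v hxnm hvnm hvx.symm)
    obtain ⟨q, hqu, hq⟩ := hul.exists_pred
    have hqv : G.Adj q v := hG.adj_of_level hq hul hvl hqu huvr
    have hxq : ¬ G.Adj x q := fun h => absurd (hq.unique (hup x q hxL h)) (by omega)
    have hwx : w ≠ x := by rintro rfl; exact hvw hvx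
    obtain ⟨j, hj, h1, h2⟩ := hul.adj huw
    have hjm : j = m ∨ j = m + 1 ∨ j = m + 2 := by omega
    rcases hjm with rfl | rfl | rfl
    · exact hvw (hG.adj_of_level hj hul hvl huw.symm huvr).symm
    · -- `w` is on the level of `M`
      by_cases hxw : G.Adj x w
      · exact hvw ((ht w ((hMx w).2 hxw) hwu hwv).1 huw)
      · have hqw : G.Adj q w := hG.adj_of_level hq hul hj hqu
          (step u w hunm (hnm w _ hj (by omega)) huw)
        exact hG.not_path_four hvx.symm hqv.symm hqw hxq hvw hxw hux.symm huw.symm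
    · -- `w` is on the last level, and has a neighbour `z` outside `M` by the choice of `x`
      have hxw : ¬ G.Adj x w := hind x w hxL hj
      have hMw : ¬ (G.neighborFinset w) ⊆ M := by
        intro hsub
        have := Finset.eq_of_subset_of_card_le hsub (hmin w hj)
        have hv' : v ∈ G.neighborFinset w := by rw [this]; exact hv
        exact hvw ((mem_neighborFinset ..).1 hv').symm
      obtain ⟨z, hz, hzM⟩ := Finset.not_subset.1 hMw
      rw [mem_neighborFinset] at hz
      have hxz : ¬ G.Adj x z := fun h => hzM ((hMx z).2 h)
      have hzl := hup w z hj hz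
      have hwnm := hnm w _ hj (by omega)
      have hqz : G.Adj q z := hG.adj_of_level hq hul hzl hqu
        ((step u w hunm hwnm huw).trans (step w z hwnm (hnm z _ hzl (by omega)) hz))
      have hwq : ¬ G.Adj w q := fun h => absurd (hq.unique (hup w q hj h)) (by omega)
      have hr : G.ReachableIn {x, v, q, z, w} x w :=
        (((ReachableIn.of_adj (by simp) (by simp) hvx.symm).trans
          (.of_adj (by simp) (by simp) hqv.symm)).trans (.of_adj (by simp) (by simp) hqz)).trans
          (.of_adj (by simp) (by simp) hz.symm)
      obtain ⟨t, ht, h3, h4⟩ := hG.exists_common_neighbor hr hwx.symm hxw hux.symm huw.symm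
      rcases ht with rfl | rfl | rfl | rfl | rfl
      exacts [G.irrefl h3, hvw h4.symm, hxq h3, hxz h3, hxw h3]
  exact ⟨u, v, huv, .inl fun w hwu hwv => ⟨half u hu v hv ht w hwu hwv,
    half v hv u hu (fun w hw h1 h2 => (ht w hw h2 h1).symm) w hwv hwu⟩⟩

/-- A distance-hereditary graph with at least two vertices has twins, a pendant vertex, or an
isolated vertex. -/
theorem exists_prunable (hG : IsDistanceHereditary G) (hV : 1 < Fintype.card V) :
    ∃ u v, G.Prunable u v := by
  classical
  obtain ⟨r, r', hrr'⟩ := Fintype.one_lt_card_iff.1 hV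
  obtain ⟨x, hx, hmax⟩ := Finset.exists_max_image
    (Finset.univ.filter (fun v => G.Reachable r v)) (fun v => G.dist r v) ⟨r, by simp⟩
  simp only [Finset.mem_filter, Finset.mem_univ, true_and] at hx hmax
  have hlast : ∀ j y, G.Level r j y → j ≤ G.dist r x := fun j y hy => hy.2 ▸ hmax y hy.1
  by_cases h0 : G.dist r x = 0
  · -- `r` is isolated
    refine ⟨r', r, hrr'.symm, .inr fun w _ _ hrw => ?_⟩
    have h1 := hlast _ w ⟨hrw.reachable, rfl⟩
    rw [dist_eq_one_iff_adj.2 hrw] at h1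
    omega
  obtain ⟨k, hk⟩ := Nat.exists_eq_succ_of_ne_zero h0
  rw [hk] at hlast
  by_cases h : ∃ x y, G.Level r (k + 1) x ∧ G.Level r (k + 1) y ∧ G.Adj x y
  · obtain ⟨x, y, hx, hy, hxy⟩ := h
    exact hG.exists_prunable_of_adj hlast hx hy hxy
  · push Not at h
    exact hG.exists_prunable_of_not_adj hlast ⟨x, hx, hk⟩ h

end Fintype

/-- Every set of at least two vertices of a distance-hereditary graph contains a pair that is
prunable in the subgraph induced by the set. -/
theorem exists_prunable_mem (hG : IsDistanceHereditary G) {A : Finset V} (hA : 1 < A.card) :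
    ∃ u ∈ A, ∃ v ∈ A, u ≠ v ∧ (G.TwinsIn A u v ∨ ∀ w ∈ A, w ≠ u → w ≠ v → ¬ G.Adj v w) := by
  obtain ⟨⟨u, hu⟩, ⟨v, hv⟩, huv, h⟩ := (hG.induce (A : Set V)).exists_prunable (by simpa using hA)
  refine ⟨u, hu, v, hv, by simpa using huv, ?_⟩
  rcases h with h | h
  · exact .inl fun w hw h1 h2 => by simpa using h ⟨w, hw⟩ (by simpa using h1) (by simpa using h2)
  · exact .inr fun w hw h1 h2 => by simpa using h ⟨w, hw⟩ (by simpa using h1) (by simpa using h2)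

end IsDistanceHereditary

/-! ### Partial packings -/

namespace Multiset

variable {α : Type*} (f g : α → ℕ)

theorem countP_eq_sum_fiber (P : Multiset α) (i : ℕ) (h : ∀ t ∈ P, g t ≤ 3) :
    P.countP (fun t => f t = i) =
      P.countP (fun t => f t = i ∧ g t = 0) + P.countP (fun t => f t = i ∧ g t = 1) +
      P.countP (fun t => f t = i ∧ g t = 2) + P.countP (fun t => f t = i ∧ g t = 3) := by
  induction P using Multiset.induction_on with
  | empty => simp
  | cons t P ih =>
    have h1 := ih fun s hs => h s (mem_cons_of_mem hs)
    have h2 := h t (mem_cons_self t P)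
    simp only [countP_cons, h1]
    generalize g t = m at h2
    interval_cases m <;> simp <;> omega

theorem countP_add_eq (P : Multiset α) (h : ∀ t ∈ P, f t + g t ≤ 3) :
    P.countP (fun t => f t + g t = 1) =
      P.countP (fun t => f t = 1 ∧ g t = 0) + P.countP (fun t => f t = 0 ∧ g t = 1) ∧
    P.countP (fun t => f t + g t = 2) =
      P.countP (fun t => f t = 2 ∧ g t = 0) + P.countP (fun t => f t = 0 ∧ g t = 2) +
        P.countP (fun t => f t = 1 ∧ g t = 1) ∧
    P.countP (fun t => f t + g t = 3) =
      P.countP (fun t => f t = 3 ∧ g t = 0) + P.countP (fun t => f t = 0 ∧ g t = 3) +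
        P.countP (fun t => f t = 2 ∧ g t = 1) + P.countP (fun t => f t = 1 ∧ g t = 2) := by
  induction P using Multiset.induction_on with
  | empty => simp
  | cons t P ih =>
    obtain ⟨h1, h2, h3⟩ := ih fun s hs => h s (mem_cons_of_mem hs)
    have h4 := h t (mem_cons_self t P)
    simp only [countP_cons, h1, h2, h3]
    generalize f t = m at h4
    generalize g t = k at h4
    have hm : m ≤ 3 := by omega
    have hk : k ≤ 3 := by omega
    interval_cases m <;> interval_cases k <;> simp at h4 ⊢ <;> omega

end Multiset

section PartialPacking

variable {V : Type*} {G : SimpleGraph V}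

/-- The vertex sets `U₁` and `U₂` are disjoint, and the edges between them are all pairs from
`S₁` and `S₂` if `J` holds, and none otherwise. -/
structure Mergeable (G : SimpleGraph V) (U₁ U₂ S₁ S₂ : Finset V) (J : Prop) : Prop where
  disjoint : Disjoint U₁ U₂
  left : S₁ ⊆ U₁
  right : S₂ ⊆ U₂
  adj_iff : ∀ x ∈ U₁, ∀ y ∈ U₂, (G.Adj x y ↔ J ∧ x ∈ S₁ ∧ y ∈ S₂)

theorem Mergeable.symm {U₁ U₂ S₁ S₂ : Finset V} {J : Prop}
    (h : Mergeable G U₁ U₂ S₁ S₂ J) : Mergeable G U₂ U₁ S₂ S₁ J where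
  disjoint := h.disjoint.symm
  left := h.right
  right := h.left
  adj_iff x hx y hy := by rw [G.adj_comm, h.adj_iff y hy x hx]; tauto

variable [DecidableEq V]

/-- A partial packing of the subgraph induced by `U`: pairwise disjoint cliques with at most three
vertices, called pieces, such that those with fewer than three vertices, which vertices outside `U`
are yet to complete to triangles, lie in `S`, the set of vertices with neighbours outside `U`.
Disjointness says that every vertex is in at most one piece; thus empty pieces may occur, with any
multiplicity. -/
structure IsPartialPacking (G : SimpleGraph V) (U S : Finset V) (P : Multiset (Finset V)) :
    Prop where
  subset : ∀ T ∈ P, T ⊆ U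
  isClique : ∀ T ∈ P, G.IsClique (T : Set V)
  card_le : ∀ T ∈ P, T.card ≤ 3
  small : ∀ T ∈ P, T.card < 3 → T ⊆ S
  disjoint : ∀ v, P.countP (fun T => v ∈ T) ≤ 1

/-- There is a partial packing with `a` single vertices, `b` edges and `c` triangles. -/
def Achieves (G : SimpleGraph V) (U S : Finset V) (a b c : ℕ) : Prop :=
  ∃ P, IsPartialPacking G U S P ∧ P.countP (fun T => T.card = 1) = a ∧
    P.countP (fun T => T.card = 2) = b ∧ P.countP (fun T => T.card = 3) = c

/-- The counts of partial packings on the two sides of a merge, and of the union. Here `x` single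
vertices of either side are joined to edges, `y` edges of the first side are completed by single
vertices of the second, and `z` edges of the second side by single vertices of the first. `J` says
that the two sides are joined, and `T` that both remain visible from outside; otherwise only the
first side does, and no unfinished piece may contain a vertex of the second. -/
def MergeRule (J T : Prop) (a₁ b₁ c₁ a₂ b₂ c₂ x y z a b c : ℕ) : Prop :=
  x + y ≤ a₂ ∧ y ≤ b₁ ∧ x + z ≤ a₁ ∧ z ≤ b₂ ∧ (J ∨ x + y + z = 0) ∧
    (T ∨ x = 0 ∧ y = a₂ ∧ z = b₂) ∧ a = (a₁ - (x + z)) + (a₂ - (x + y)) ∧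
    b = (b₁ - y) + (b₂ - z) + x ∧ c = c₁ + c₂ + y + z

section Merge

variable {U₁ U₂ S₁ S₂ : Finset V} {J : Prop}

theorem Mergeable.card_eq (h : Mergeable G U₁ U₂ S₁ S₂ J) {T : Finset V} (hT : T ⊆ U₁ ∪ U₂) :
    (T ∩ U₁).card + (T ∩ U₂).card = T.card := by
  rw [← Finset.card_union_of_disjoint, ← Finset.inter_union_distrib_left,
    Finset.inter_eq_left.2 hT]
  exact h.disjoint.mono Finset.inter_subset_right Finset.inter_subset_right

/-- The pieces of a partial packing of `U₁ ∪ U₂`, cut to `U₁`. -/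
theorem Mergeable.isPartialPacking_map (h : Mergeable G U₁ U₂ S₁ S₂ J) {S : Finset V}
    (hS : S ∩ U₁ ⊆ S₁) {P : Multiset (Finset V)} (hP : IsPartialPacking G (U₁ ∪ U₂) S P) :
    IsPartialPacking G U₁ S₁ (P.map (· ∩ U₁)) where
  subset := by
    simp only [Multiset.mem_map]
    rintro _ ⟨T, -, rfl⟩
    exact Finset.inter_subset_right
  isClique := by
    simp only [Multiset.mem_map]
    rintro _ ⟨T, hT, rfl⟩
    exact (hP.isClique T hT).subset (by simp)
  card_le := by
    simp only [Multiset.mem_map]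
    rintro _ ⟨T, hT, rfl⟩
    exact (Finset.card_le_card Finset.inter_subset_left).trans (hP.card_le T hT)
  small := by
    simp only [Multiset.mem_map]
    rintro _ ⟨T, hT, rfl⟩ hc x hx
    obtain ⟨hxT, hx₁⟩ := Finset.mem_inter.1 hx
    rcases (T ∩ U₂).eq_empty_or_nonempty with he | ⟨y, hy⟩
    · refine hS (Finset.mem_inter.2 ⟨hP.small T hT ?_ hxT, hx₁⟩)
      rw [← h.card_eq (hP.subset T hT), he]
      simpa using hc
    · obtain ⟨hyT, hy₂⟩ := Finset.mem_inter.1 hy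
      have hne : x ≠ y := fun e => Finset.disjoint_left.1 h.disjoint hx₁ (e ▸ hy₂)
      exact ((h.adj_iff x hx₁ y hy₂).1
        (hP.isClique T hT (by simpa using hxT) (by simpa using hyT) hne)).2.1
  disjoint v := by
    rw [Multiset.countP_map, ← Multiset.countP_eq_card_filter]
    refine le_trans ?_ (hP.disjoint v)
    simp only [Multiset.countP_eq_card_filter]
    exact Multiset.card_le_card
      (Multiset.monotone_filter_right _ fun T hT => (Finset.mem_inter.1 hT).1)

variable (U₁ U₂) in
/-- The number of pieces with `i` vertices in `U₁` and `j` vertices in `U₂`. -/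
def pieceCount (P : Multiset (Finset V)) (i j : ℕ) : ℕ :=
  P.countP (fun T => (T ∩ U₁).card = i ∧ (T ∩ U₂).card = j)

theorem countP_eq_pieceCount (P : Multiset (Finset V)) (i j : ℕ) :
    P.countP (fun T => (T ∩ U₁).card = i ∧ (T ∩ U₂).card = j) = pieceCount U₁ U₂ P i j := rfl

theorem Mergeable.exists_of_achieves (h : Mergeable G U₁ U₂ S₁ S₂ J) {T : Prop} {S : Finset V}
    (hS₁ : T → S = S₁ ∪ S₂) (hS₂ : ¬ T → S = S₁) {a b c : ℕ} (hA : Achieves G (U₁ ∪ U₂) S a b c) :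
    ∃ a₁ b₁ c₁ a₂ b₂ c₂ x y z, Achieves G U₁ S₁ a₁ b₁ c₁ ∧ Achieves G U₂ S₂ a₂ b₂ c₂ ∧
      MergeRule J T a₁ b₁ c₁ a₂ b₂ c₂ x y z a b c := by
  obtain ⟨P, hP, rfl, rfl, rfl⟩ := hA
  have hS : S ⊆ S₁ ∪ S₂ := by
    by_cases hT : T
    · exact (hS₁ hT).subset
    · exact (hS₂ hT).trans_subset Finset.subset_union_left
  have hd := Finset.disjoint_left.1 h.disjoint
  have hP₁ := h.isPartialPacking_map (S := S) (by
    intro v hv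
    obtain ⟨hv, hv'⟩ := Finset.mem_inter.1 hv
    exact (Finset.mem_union.1 (hS hv)).resolve_right fun hv₂ => hd hv' (h.right hv₂)) hP
  have hP₂ := h.symm.isPartialPacking_map (S := S) (by
    intro v hv
    obtain ⟨hv, hv'⟩ := Finset.mem_inter.1 hv
    exact (Finset.mem_union.1 (hS hv)).resolve_left fun hv₁ => hd (h.left hv₁) hv')
    (by rwa [Finset.union_comm] at hP)
  have hcard : ∀ t ∈ P, (t ∩ U₁).card + (t ∩ U₂).card = t.card := fun t ht =>
    h.card_eq (hP.subset t ht)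
  have hcard3 : ∀ t ∈ P, (t ∩ U₁).card + (t ∩ U₂).card ≤ 3 := fun t ht =>
    (hcard t ht).trans_le (hP.card_le t ht)
  refine ⟨_, _, _, _, _, _, pieceCount U₁ U₂ P 1 1, pieceCount U₁ U₂ P 2 1,
    pieceCount U₁ U₂ P 1 2, ⟨_, hP₁, rfl, rfl, rfl⟩, ⟨_, hP₂, rfl, rfl, rfl⟩, ?_⟩
  simp only [Multiset.countP_map, ← Multiset.countP_eq_card_filter]
  -- all counts in terms of `pieceCount`
  have hf : ∀ i, P.countP (fun t => (t ∩ U₁).card = i) = pieceCount U₁ U₂ P i 0 +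
      pieceCount U₁ U₂ P i 1 + pieceCount U₁ U₂ P i 2 + pieceCount U₁ U₂ P i 3 := fun i =>
    Multiset.countP_eq_sum_fiber _ _ P i fun t ht => by have := hcard3 t ht; omega
  have hg : ∀ j, P.countP (fun t => (t ∩ U₂).card = j) = pieceCount U₁ U₂ P 0 j +
      pieceCount U₁ U₂ P 1 j + pieceCount U₁ U₂ P 2 j + pieceCount U₁ U₂ P 3 j := fun j => by
    rw [Multiset.countP_eq_sum_fiber _ (fun t => (t ∩ U₁).card) P j
      fun t ht => by have := hcard3 t ht; omega]
    simp only [pieceCount, and_comm]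
  obtain ⟨h1, h2, h3⟩ := Multiset.countP_add_eq _ _ P hcard3
  have hcongr : ∀ i, P.countP (fun t => t.card = i) =
      P.countP (fun t => (t ∩ U₁).card + (t ∩ U₂).card = i) := fun i =>
    Multiset.countP_congr rfl fun t ht => by rw [hcard t ht]
  rw [hcongr, hcongr, hcongr, h1, h2, h3, hf, hf, hf, hg, hg, hg]
  simp only [countP_eq_pieceCount]
  have hbig : ∀ i j, 3 < i + j → pieceCount U₁ U₂ P i j = 0 := fun i j hij =>
    Multiset.countP_eq_zero.2 fun t ht hij' => by have := hcard3 t ht; omega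
  have hJ : ∀ i j, ¬ J → 0 < i → 0 < j → pieceCount U₁ U₂ P i j = 0 := by
    refine fun i j hJ hi hj => Multiset.countP_eq_zero.2 fun t ht hij => hJ ?_
    obtain ⟨x, hx⟩ := Finset.card_pos.1 (hij.1 ▸ hi)
    obtain ⟨y, hy⟩ := Finset.card_pos.1 (hij.2 ▸ hj)
    obtain ⟨hxT, hx₁⟩ := Finset.mem_inter.1 hx
    obtain ⟨hyT, hy₂⟩ := Finset.mem_inter.1 hy
    exact ((h.adj_iff x hx₁ y hy₂).1 (hP.isClique t ht (by simpa using hxT) (by simpa using hyT)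
      fun e => hd hx₁ (e ▸ hy₂))).1
  have hT : ∀ i j, ¬ T → i + j < 3 → 0 < j → pieceCount U₁ U₂ P i j = 0 := by
    refine fun i j hT hij hj => Multiset.countP_eq_zero.2 fun t ht hij' => ?_
    obtain ⟨y, hy⟩ := Finset.card_pos.1 (hij'.2 ▸ hj)
    obtain ⟨hyT, hy₂⟩ := Finset.mem_inter.1 hy
    have hyS := hP.small t ht (by rw [← hcard t ht]; omega) hyT
    rw [hS₂ hT] at hyS
    exact hd (h.left hyS) hy₂
  have e13 := hbig 1 3 (by simp)
  have e22 := hbig 2 2 (by simp)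
  have e23 := hbig 2 3 (by simp)
  have e31 := hbig 3 1 (by simp)
  have e32 := hbig 3 2 (by simp)
  have e33 := hbig 3 3 (by simp)
  refine ⟨by omega, by omega, by omega, by omega, ?_, ?_, by omega, by omega, by omega⟩
  · by_cases hJ' : J
    · exact .inl hJ'
    · have := hJ 1 1 hJ'; have := hJ 2 1 hJ'; have := hJ 1 2 hJ'
      exact .inr (by omega)
  · by_cases hT' : T
    · exact .inl hT'
    · have := hT 0 1 hT'; have := hT 0 2 hT'; have := hT 1 1 hT'
      exact .inr ⟨by omega, by omega, by omega⟩

/-- Pieces on `U₁ ∪ U₂` that may all be combined further across the two sides. -/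
structure IsMixedPacking (G : SimpleGraph V) (U₁ U₂ S₁ S₂ : Finset V) (P : Multiset (Finset V)) :
    Prop where
  subset : ∀ T ∈ P, T ⊆ U₁ ∪ U₂
  isClique : ∀ T ∈ P, G.IsClique (T : Set V)
  card_le : ∀ T ∈ P, T.card ≤ 3
  small_left : ∀ T ∈ P, (T ∩ U₁).card < 3 → T ∩ U₁ ⊆ S₁
  small_right : ∀ T ∈ P, (T ∩ U₂).card < 3 → T ∩ U₂ ⊆ S₂
  disjoint : ∀ v, P.countP (fun T => v ∈ T) ≤ 1

theorem IsMixedPacking.combine (h : Mergeable G U₁ U₂ S₁ S₂ J) (hJ : J)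
    {P : Multiset (Finset V)} (hP : IsMixedPacking G U₁ U₂ S₁ S₂ P) {i j : ℕ} (hi : 0 < i)
    (hj : 0 < j) (hij : i + j ≤ 3) (hPi : 0 < pieceCount U₁ U₂ P i 0)
    (hPj : 0 < pieceCount U₁ U₂ P 0 j) :
    ∃ P', IsMixedPacking G U₁ U₂ S₁ S₂ P' ∧ ∀ k l, pieceCount U₁ U₂ P' k l +
      ((if i = k ∧ 0 = l then 1 else 0) + if 0 = k ∧ j = l then 1 else 0) =
      pieceCount U₁ U₂ P k l + if i = k ∧ j = l then 1 else 0 := by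
  obtain ⟨s, hs, hs1, hs2⟩ := Multiset.countP_pos.1 hPi
  obtain ⟨t, ht, ht1, ht2⟩ := Multiset.countP_pos.1 hPj
  obtain ⟨P, rfl⟩ := Multiset.exists_cons_of_mem hs
  have hst : t ≠ s := by rintro rfl; omega
  obtain ⟨P, rfl⟩ := Multiset.exists_cons_of_mem ((Multiset.mem_cons.1 ht).resolve_left hst)
  have hs0 : s ∩ U₂ = ∅ := Finset.card_eq_zero.1 hs2
  have ht0 : t ∩ U₁ = ∅ := Finset.card_eq_zero.1 ht1
  have e1 : (s ∪ t) ∩ U₁ = s ∩ U₁ := by rw [Finset.union_inter_distrib_right, ht0]; simp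
  have e2 : (s ∪ t) ∩ U₂ = t ∩ U₂ := by rw [Finset.union_inter_distrib_right, hs0]; simp
  have hsU := hP.subset s hs
  have htU := hP.subset t ht
  have hstU : s ∪ t ⊆ U₁ ∪ U₂ := Finset.union_subset hsU htU
  have hmem : ∀ T ∈ (s ∪ t) ::ₘ P, T = s ∪ t ∨ T ∈ s ::ₘ t ::ₘ P := by
    intro T hT
    rcases Multiset.mem_cons.1 hT with rfl | hT
    · exact .inl rfl
    · exact .inr (Multiset.mem_cons_of_mem (Multiset.mem_cons_of_mem hT))
  have hsmem : ∀ x ∈ s, x ∈ U₁ ∧ x ∈ S₁ := by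
    intro x hx
    have hx₁ : x ∈ U₁ := (Finset.mem_union.1 (hsU hx)).resolve_right fun hx₂ => by
      simpa [hs0] using Finset.mem_inter.2 ⟨hx, hx₂⟩
    exact ⟨hx₁, hP.small_left s hs (by omega) (Finset.mem_inter.2 ⟨hx, hx₁⟩)⟩
  have htmem : ∀ x ∈ t, x ∈ U₂ ∧ x ∈ S₂ := by
    intro x hx
    have hx₂ : x ∈ U₂ := (Finset.mem_union.1 (htU hx)).resolve_left fun hx₁ => by
      simpa [ht0] using Finset.mem_inter.2 ⟨hx, hx₁⟩
    exact ⟨hx₂, hP.small_right t ht (by omega) (Finset.mem_inter.2 ⟨hx, hx₂⟩)⟩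
  refine ⟨(s ∪ t) ::ₘ P, ⟨?_, ?_, ?_, ?_, ?_, ?_⟩, ?_⟩
  · intro T hT
    rcases hmem T hT with rfl | hT
    exacts [hstU, hP.subset T hT]
  · intro T hT
    rcases hmem T hT with rfl | hT
    · have hadj : ∀ x ∈ s, ∀ y ∈ t, G.Adj x y := fun x hx y hy =>
        (h.adj_iff x (hsmem x hx).1 y (htmem y hy).1).2 ⟨hJ, (hsmem x hx).2, (htmem y hy).2⟩
      intro x hx y hy hxy
      simp only [Finset.coe_union, Set.mem_union, Finset.mem_coe] at hx hy
      rcases hx with hx | hx <;> rcases hy with hy | hy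
      · exact hP.isClique s hs (by simpa using hx) (by simpa using hy) hxy
      · exact hadj x hx y hy
      · exact (hadj y hy x hx).symm
      · exact hP.isClique t ht (by simpa using hx) (by simpa using hy) hxy
    · exact hP.isClique T hT
  · intro T hT
    rcases hmem T hT with rfl | hT
    · rw [← h.card_eq hstU, e1, e2]; omega
    · exact hP.card_le T hT
  · intro T hT
    rcases hmem T hT with rfl | hT
    · rw [e1]; exact hP.small_left s hs
    · exact hP.small_left T hT
  · intro T hT
    rcases hmem T hT with rfl | hT
    · rw [e2]; exact hP.small_right t ht
    · exact hP.small_right T hT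
  · intro v
    have := hP.disjoint v
    simp only [Multiset.countP_cons, Finset.mem_union] at this ⊢
    split_ifs at this ⊢ <;> first | omega | tauto
  · intro k l
    simp only [pieceCount, Multiset.countP_cons, e1, e2, hs1, hs2, ht1, ht2]
    omega

/-- `combine`, applied `m` times. -/
theorem IsMixedPacking.combine_many (h : Mergeable G U₁ U₂ S₁ S₂ J) {P : Multiset (Finset V)}
    (hP : IsMixedPacking G U₁ U₂ S₁ S₂ P) {i j : ℕ} (hi : 0 < i) (hj : 0 < j) (hij : i + j ≤ 3)
    (m : ℕ) (hJ : J ∨ m = 0) (hPi : m ≤ pieceCount U₁ U₂ P i 0)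
    (hPj : m ≤ pieceCount U₁ U₂ P 0 j) :
    ∃ P', IsMixedPacking G U₁ U₂ S₁ S₂ P' ∧ ∀ k l, pieceCount U₁ U₂ P' k l +
      ((if i = k ∧ 0 = l then m else 0) + if 0 = k ∧ j = l then m else 0) =
      pieceCount U₁ U₂ P k l + if i = k ∧ j = l then m else 0 := by
  induction m with
  | zero => exact ⟨P, hP, by simp⟩
  | succ m ih =>
    have hJ' : J := hJ.resolve_right (by simp)
    obtain ⟨P', hP', hc⟩ := ih (.inl hJ') (by omega) (by omega)
    have c1 := hc i 0
    have c2 := hc 0 j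
    simp only [true_and, and_true, hi.ne', hj.ne', hi.ne, hj.ne, and_self, if_true, if_false]
      at c1 c2
    obtain ⟨P'', hP'', hc'⟩ := hP'.combine h hJ' hi hj hij (by omega) (by omega)
    refine ⟨P'', hP'', fun k l => ?_⟩
    have := hc k l
    have := hc' k l
    split_ifs at * <;> omega

theorem IsPartialPacking.pieceCount_left (h : Disjoint U₁ U₂) {P : Multiset (Finset V)}
    (hP : IsPartialPacking G U₁ S₁ P) (i j : ℕ) :
    pieceCount U₁ U₂ P i j = if j = 0 then P.countP (fun T => T.card = i) else 0 := by
  have h1 : ∀ t ∈ P, t ∩ U₁ = t := fun t ht => Finset.inter_eq_left.2 (hP.subset t ht)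
  have h2 : ∀ t ∈ P, t ∩ U₂ = ∅ := fun t ht =>
    Finset.disjoint_iff_inter_eq_empty.1 (h.mono_left (hP.subset t ht))
  split_ifs with hj
  · exact Multiset.countP_congr rfl fun t ht => by simp [h1 t ht, h2 t ht, hj]
  · exact Multiset.countP_eq_zero.2 fun t ht => by simp [h2 t ht, Ne.symm hj]

theorem pieceCount_swap (P : Multiset (Finset V)) (i j : ℕ) :
    pieceCount U₁ U₂ P i j = pieceCount U₂ U₁ P j i := by
  simp only [pieceCount, and_comm]

theorem Mergeable.isMixedPacking_add (h : Mergeable G U₁ U₂ S₁ S₂ J)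
    {P₁ P₂ : Multiset (Finset V)} (hP₁ : IsPartialPacking G U₁ S₁ P₁)
    (hP₂ : IsPartialPacking G U₂ S₂ P₂) : IsMixedPacking G U₁ U₂ S₁ S₂ (P₁ + P₂) where
  subset T hT := by
    rcases Multiset.mem_add.1 hT with hT | hT
    · exact (hP₁.subset T hT).trans Finset.subset_union_left
    · exact (hP₂.subset T hT).trans Finset.subset_union_right
  isClique T hT := (Multiset.mem_add.1 hT).elim (hP₁.isClique T) (hP₂.isClique T)
  card_le T hT := (Multiset.mem_add.1 hT).elim (hP₁.card_le T) (hP₂.card_le T)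
  small_left T hT := by
    rcases Multiset.mem_add.1 hT with hT | hT
    · rw [Finset.inter_eq_left.2 (hP₁.subset T hT)]
      exact hP₁.small T hT
    · rw [Finset.disjoint_iff_inter_eq_empty.1 (h.disjoint.symm.mono_left (hP₂.subset T hT))]
      simp
  small_right T hT := by
    rcases Multiset.mem_add.1 hT with hT | hT
    · rw [Finset.disjoint_iff_inter_eq_empty.1 (h.disjoint.mono_left (hP₁.subset T hT))]
      simp
    · rw [Finset.inter_eq_left.2 (hP₂.subset T hT)]
      exact hP₂.small T hT
  disjoint v := by
    rw [Multiset.countP_add]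
    by_cases hv : v ∈ U₁
    · rw [Multiset.countP_eq_zero.2 fun T hT hvT =>
        Finset.disjoint_left.1 h.disjoint hv (hP₂.subset T hT hvT)]
      simpa using hP₁.disjoint v
    · rw [Multiset.countP_eq_zero.2 fun T hT hvT => hv (hP₁.subset T hT hvT)]
      simpa using hP₂.disjoint v

theorem Mergeable.achieves_of_rule (h : Mergeable G U₁ U₂ S₁ S₂ J) {T : Prop} {S : Finset V}
    (hS₁ : T → S = S₁ ∪ S₂) (hS₂ : ¬ T → S = S₁) {a₁ b₁ c₁ a₂ b₂ c₂ x y z a b c : ℕ}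
    (hA₁ : Achieves G U₁ S₁ a₁ b₁ c₁) (hA₂ : Achieves G U₂ S₂ a₂ b₂ c₂)
    (hR : MergeRule J T a₁ b₁ c₁ a₂ b₂ c₂ x y z a b c) : Achieves G (U₁ ∪ U₂) S a b c := by
  obtain ⟨P₁, hP₁, rfl, rfl, rfl⟩ := hA₁
  obtain ⟨P₂, hP₂, rfl, rfl, rfl⟩ := hA₂
  obtain ⟨r1, r2, r3, r4, rJ, rT, rfl, rfl, rfl⟩ := hR
  have hJ : ∀ m, m ≤ x + y + z → J ∨ m = 0 := fun m hm => rJ.imp_right fun h => by omega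
  have n0 : ∀ i j, pieceCount U₁ U₂ (P₁ + P₂) i j =
      (if j = 0 then P₁.countP (fun T => T.card = i) else 0) +
      if i = 0 then P₂.countP (fun T => T.card = j) else 0 := by
    intro i j
    rw [← hP₁.pieceCount_left h.disjoint, ← hP₂.pieceCount_left h.disjoint.symm,
      ← pieceCount_swap (U₁ := U₁) (U₂ := U₂) P₂ i j]
    simp only [pieceCount, Multiset.countP_add]
  have q10 := n0 1 0
  have q20 := n0 2 0
  have q30 := n0 3 0
  have q01 := n0 0 1
  have q02 := n0 0 2
  have q03 := n0 0 3
  have q11 := n0 1 1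
  have q21 := n0 2 1
  have q12 := n0 1 2
  simp at q10 q20 q30 q01 q02 q03 q11 q21 q12
  obtain ⟨Q₁, hQ₁, n1⟩ := (h.isMixedPacking_add hP₁ hP₂).combine_many h one_pos one_pos
    (by simp) x (hJ _ (by omega)) (by omega) (by omega)
  have q10' := n1 1 0
  have q20' := n1 2 0
  have q30' := n1 3 0
  have q01' := n1 0 1
  have q02' := n1 0 2
  have q03' := n1 0 3
  have q11' := n1 1 1
  have q21' := n1 2 1
  have q12' := n1 1 2
  simp at q10' q20' q30' q01' q02' q03' q11' q21' q12'
  obtain ⟨Q₂, hQ₂, n2⟩ := hQ₁.combine_many h two_pos one_pos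
    (by simp) y (hJ _ (by omega)) (by omega) (by omega)
  have p10 := n2 1 0
  have p20 := n2 2 0
  have p30 := n2 3 0
  have p01 := n2 0 1
  have p02 := n2 0 2
  have p03 := n2 0 3
  have p11 := n2 1 1
  have p21 := n2 2 1
  have p12 := n2 1 2
  simp at p10 p20 p30 p01 p02 p03 p11 p21 p12
  obtain ⟨Q, hQ, n3⟩ := hQ₂.combine_many h one_pos two_pos
    (by simp) z (hJ _ (by omega)) (by omega) (by omega)
  have p10' := n3 1 0
  have p20' := n3 2 0
  have p30' := n3 3 0
  have p01' := n3 0 1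
  have p02' := n3 0 2
  have p03' := n3 0 3
  have p11' := n3 1 1
  have p21' := n3 2 1
  have p12' := n3 1 2
  simp at p10' p20' p30' p01' p02' p03' p11' p21' p12'
  have hcard : ∀ t ∈ Q, (t ∩ U₁).card + (t ∩ U₂).card = t.card := fun t ht =>
    h.card_eq (hQ.subset t ht)
  have hcard3 : ∀ t ∈ Q, (t ∩ U₁).card + (t ∩ U₂).card ≤ 3 := fun t ht =>
    (hcard t ht).trans_le (hQ.card_le t ht)
  obtain ⟨h1, h2, h3⟩ := Multiset.countP_add_eq _ _ Q hcard3
  have hcongr : ∀ i, Q.countP (fun t => t.card = i) =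
      Q.countP (fun t => (t ∩ U₁).card + (t ∩ U₂).card = i) := fun i =>
    Multiset.countP_congr rfl fun t ht => by rw [hcard t ht]
  simp only [countP_eq_pieceCount] at h1 h2 h3
  refine ⟨Q, ⟨hQ.subset, hQ.isClique, hQ.card_le, ?_, hQ.disjoint⟩, ?_, ?_, ?_⟩
  · intro t ht htc v hv
    have := hcard t ht
    rcases Finset.mem_union.1 (hQ.subset t ht hv) with hvU | hvU
    · have := hQ.small_left t ht (by omega) (Finset.mem_inter.2 ⟨hv, hvU⟩)
      by_cases hT : T
      · rw [hS₁ hT]; exact Finset.mem_union_left _ this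
      · rwa [hS₂ hT]
    · by_cases hT : T
      · rw [hS₁ hT]
        exact Finset.mem_union_right _ (hQ.small_right t ht (by omega)
          (Finset.mem_inter.2 ⟨hv, hvU⟩))
      · -- an unfinished piece cannot meet `U₂`
        obtain ⟨s1, s2, s3⟩ := rT.resolve_left hT
        have hpos : 0 < (t ∩ U₂).card := Finset.card_pos.2 ⟨v, Finset.mem_inter.2 ⟨hv, hvU⟩⟩
        have z01 : pieceCount U₁ U₂ Q 0 1 = 0 := by omega
        have z02 : pieceCount U₁ U₂ Q 0 2 = 0 := by omega
        have z11 : pieceCount U₁ U₂ Q 1 1 = 0 := by omega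
        have w01 := Multiset.countP_eq_zero.1 z01 t ht
        have w02 := Multiset.countP_eq_zero.1 z02 t ht
        have w11 := Multiset.countP_eq_zero.1 z11 t ht
        omega
  · rw [hcongr, h1]; omega
  · rw [hcongr, h2]; omega
  · rw [hcongr, h3]; omega

/-- The counts of partial packings of a union are determined by the counts on the two sides. -/
theorem Mergeable.achieves_union_iff (h : Mergeable G U₁ U₂ S₁ S₂ J) {T : Prop} {S : Finset V}
    (hS₁ : T → S = S₁ ∪ S₂) (hS₂ : ¬ T → S = S₁) {a b c : ℕ} :
    Achieves G (U₁ ∪ U₂) S a b c ↔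
      ∃ a₁ b₁ c₁ a₂ b₂ c₂ x y z, Achieves G U₁ S₁ a₁ b₁ c₁ ∧ Achieves G U₂ S₂ a₂ b₂ c₂ ∧
        MergeRule J T a₁ b₁ c₁ a₂ b₂ c₂ x y z a b c :=
  ⟨h.exists_of_achieves hS₁ hS₂, fun ⟨_, _, _, _, _, _, _, _, _, h₁, h₂, hR⟩ =>
    h.achieves_of_rule hS₁ hS₂ h₁ h₂ hR⟩

end Merge

end PartialPacking

/-! ### Decompositions and the packing number -/

section Decomposition

variable {V : Type*} {G : SimpleGraph V}

/-- A stage of the contraction of the subgraph of `G` on the complement of `D`: every vertex `u` of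
the set `A` represents a set `U u` of vertices, of which those in `S u` have neighbours outside
`U u`, and the edges between the represented sets follow the edges of `G` between the
representatives. Vertices in `D` may be representatives, but are not represented. -/
structure IsDecomposition (G : SimpleGraph V) (D A : Finset V) (U S : V → Finset V) : Prop where
  sub : ∀ u ∈ A, S u ⊆ U u
  disjoint : ∀ u ∈ A, ∀ v ∈ A, u ≠ v → Disjoint (U u) (U v)
  notMem : ∀ u ∈ A, ∀ x ∈ U u, x ∉ D
  cover : ∀ x, x ∉ D → ∃ u ∈ A, x ∈ U u
  adj_iff : ∀ u ∈ A, ∀ v ∈ A, u ≠ v → ∀ x ∈ U u, ∀ y ∈ U v,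
    (G.Adj x y ↔ G.Adj u v ∧ x ∈ S u ∧ y ∈ S v)

theorem IsDecomposition.mergeable {D A : Finset V} {U S : V → Finset V}
    (h : IsDecomposition G D A U S) {u v : V} (hu : u ∈ A) (hv : v ∈ A) (huv : u ≠ v) :
    Mergeable G (U u) (U v) (S u) (S v) (G.Adj u v) where
  disjoint := h.disjoint u hu v hv huv
  left := h.sub u hu
  right := h.sub v hv
  adj_iff := h.adj_iff u hu v hv huv

/-- There is a packing of `c` triangles that avoid `D`. -/
def HasPacking (G : SimpleGraph V) (D : Finset V) (c : ℕ) : Prop :=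
  ∃ P : Finset (Finset V), IsTrianglePacking G P ∧ (∀ T ∈ P, Disjoint T D) ∧ P.card = c

theorem hasPacking_zero (D : Finset V) : HasPacking G D 0 :=
  ⟨∅, ⟨by simp, by simp⟩, by simp, rfl⟩

open Classical in
/-- The largest size of a triangle packing that avoids `D`. -/
noncomputable def packingNumber [Fintype V] (G : SimpleGraph V) (D : Finset V) : ℕ :=
  Nat.findGreatest (HasPacking G D) (Fintype.card V)

theorem hasPacking_packingNumber [Fintype V] (D : Finset V) : HasPacking G D (packingNumber G D) := by
  classical
  exact Nat.findGreatest_spec (P := HasPacking G D) (Nat.zero_le _) (hasPacking_zero D)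

variable [DecidableEq V]

theorem isDecomposition_univ [Fintype V] (D : Finset V) :
    IsDecomposition G D Finset.univ (fun v => {v} \ D) (fun v => {v} \ D) where
  sub _ _ := subset_rfl
  disjoint u _ v _ huv := by
    refine Finset.disjoint_left.2 fun x hx hx' => huv ?_
    simp only [Finset.mem_sdiff, Finset.mem_singleton] at hx hx'
    exact hx.1.symm.trans hx'.1
  notMem u _ x hx := (Finset.mem_sdiff.1 hx).2
  cover x hx := ⟨x, by simp [hx]⟩
  adj_iff u _ v _ _ x hx y hy := by
    have hx' := hx
    have hy' := hy
    simp only [Finset.mem_sdiff, Finset.mem_singleton] at hx' hy'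
    obtain rfl := hx'.1
    obtain rfl := hy'.1
    exact ⟨fun h => ⟨h, hx, hy⟩, fun h => h.1⟩

/-- Merging `v` into `u`: if `u` and `v` are twins, `u` speaks for the visible vertices of both,
and if `v` has no other neighbour, only for its own. -/
theorem IsDecomposition.merge {D A : Finset V} {U S : V → Finset V}
    (h : IsDecomposition G D A U S) {u v : V} (hu : u ∈ A) (hv : v ∈ A) (huv : u ≠ v) {T : Prop}
    (hT : T → G.TwinsIn A u v) (hT' : ¬ T → ∀ w ∈ A, w ≠ u → w ≠ v → ¬ G.Adj v w)
    {R : Finset V} (hR : T → R = S u ∪ S v) (hR' : ¬ T → R = S u) :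
    IsDecomposition G D (A.erase v) (Function.update U u (U u ∪ U v)) (Function.update S u R) := by
  have key : ∀ w ∈ A, w ≠ u → w ≠ v → ∀ x ∈ U u ∪ U v, ∀ y ∈ U w,
      (G.Adj x y ↔ G.Adj u w ∧ x ∈ R ∧ y ∈ S w) := by
    intro w hw hwu hwv x hx y hy
    have hd := Finset.disjoint_left.1 (h.disjoint u hu v hv huv)
    rcases Finset.mem_union.1 hx with hx | hx
    · rw [h.adj_iff u hu w hw hwu.symm x hx y hy]
      have : x ∉ S v := fun hx' => hd hx (h.sub v hv hx')
      by_cases ht : T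
      · simp [hR ht, this]
      · rw [hR' ht]
    · rw [h.adj_iff v hv w hw hwv.symm x hx y hy]
      have : x ∉ S u := fun hx' => hd (h.sub u hu hx') hx
      by_cases ht : T
      · simp [hR ht, this, hT ht w hw hwu hwv]
      · simp [hR' ht, this, hT' ht w hw hwu hwv]
  have hsub : R ⊆ U u ∪ U v := by
    by_cases ht : T
    · rw [hR ht]; exact Finset.union_subset_union (h.sub u hu) (h.sub v hv)
    · rw [hR' ht]; exact (h.sub u hu).trans Finset.subset_union_left
  constructor
  · intro w hw
    obtain ⟨-, hw⟩ := Finset.mem_erase.1 hw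
    by_cases hwu : w = u
    · subst hwu; simpa using hsub
    · simpa [hwu] using h.sub w hw
  · intro w hw w' hw' hne
    obtain ⟨hwv, hw⟩ := Finset.mem_erase.1 hw
    obtain ⟨hwv', hw'⟩ := Finset.mem_erase.1 hw'
    by_cases hwu : w = u
    · subst hwu
      simp only [Function.update_self, Function.update_of_ne hne.symm, Finset.disjoint_union_left]
      exact ⟨h.disjoint _ hw _ hw' hne, h.disjoint _ hv _ hw' hwv'.symm⟩
    · by_cases hwu' : w' = u
      · subst hwu'
        simp only [Function.update_self, Function.update_of_ne hne, Finset.disjoint_union_right]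
        exact ⟨h.disjoint _ hw _ hw' hne, h.disjoint _ hw _ hv hwv⟩
      · simpa [hwu, hwu'] using h.disjoint w hw w' hw' hne
  · intro w hw x
    obtain ⟨-, hw⟩ := Finset.mem_erase.1 hw
    by_cases hwu : w = u
    · subst hwu
      simp only [Function.update_self, Finset.mem_union]
      rintro (hx | hx)
      exacts [h.notMem _ hw x hx, h.notMem _ hv x hx]
    · simpa [hwu] using h.notMem w hw x
  · intro x hx
    obtain ⟨w, hw, hxw⟩ := h.cover x hx
    by_cases hwu : w = u
    · subst hwu
      exact ⟨w, Finset.mem_erase.2 ⟨huv, hw⟩, by simp [hxw]⟩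
    · by_cases hwv : w = v
      · subst hwv
        exact ⟨u, Finset.mem_erase.2 ⟨huv, hu⟩, by simp [hxw]⟩
      · exact ⟨w, Finset.mem_erase.2 ⟨hwv, hw⟩, by simpa [hwu] using hxw⟩
  · intro w hw w' hw' hne x hx y hy
    obtain ⟨hwv, hw⟩ := Finset.mem_erase.1 hw
    obtain ⟨hwv', hw'⟩ := Finset.mem_erase.1 hw'
    by_cases hwu : w = u
    · subst hwu
      simp only [Function.update_self, Function.update_of_ne hne.symm] at hx hy ⊢
      exact key w' hw' hne.symm hwv' x hx y hy
    · by_cases hwu' : w' = u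
      · subst hwu'
        simp only [Function.update_self, Function.update_of_ne hne] at hx hy ⊢
        rw [G.adj_comm, key w hw hne hwv y hy x hx, G.adj_comm]
        tauto
      · simp only [Function.update_of_ne hwu, Function.update_of_ne hwu'] at hx hy ⊢
        exact h.adj_iff w hw w' hw' hne x hx y hy

theorem Achieves.le_card [Fintype V] {U S : Finset V} {a b c : ℕ} (h : Achieves G U S a b c) :
    a ≤ Fintype.card V ∧ b ≤ Fintype.card V ∧ c ≤ Fintype.card V := by
  obtain ⟨P, hP, rfl, rfl, rfl⟩ := h
  have h1 : P.countP (fun T => T.Nonempty) ≤ ∑ v : V, P.countP (fun T => v ∈ T) := by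
    clear hP
    induction P using Multiset.induction_on with
    | empty => simp
    | cons T P ih =>
      simp only [Multiset.countP_cons, Finset.sum_add_distrib]
      refine add_le_add ih ?_
      rw [← Finset.card_filter]
      split_ifs with hT
      · simpa [Nat.succ_le_iff, Finset.card_pos] using hT
      · simp
  have h2 : ∑ v : V, P.countP (fun T => v ∈ T) ≤ Fintype.card V :=
    (Finset.sum_le_sum fun v _ => hP.disjoint v).trans (by simp)
  have h3 : ∀ i, 0 < i → P.countP (fun T => T.card = i) ≤ Fintype.card V := by
    intro i hi
    refine le_trans ?_ (h1.trans h2)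
    simp only [Multiset.countP_eq_card_filter]
    refine Multiset.card_le_card (Multiset.monotone_filter_right _ fun T (hT : T.card = i) => ?_)
    exact Finset.card_pos.1 (hT ▸ hi)
  exact ⟨h3 1 (by simp), h3 2 (by simp), h3 3 (by simp)⟩

/-- The partial packings of a single vertex, or of none if the vertex is excluded. -/
theorem achieves_singleton_iff (v : V) (D : Finset V) (a b c : ℕ) :
    Achieves G ({v} \ D) ({v} \ D) a b c ↔ b = 0 ∧ c = 0 ∧ (a = 0 ∨ a = 1 ∧ v ∉ D) := by
  constructor
  · rintro ⟨P, hP, rfl, rfl, rfl⟩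
    have hsub : ∀ T ∈ P, T ⊆ {v} := fun T hT => (hP.subset T hT).trans Finset.sdiff_subset
    have hc : ∀ T ∈ P, T.card ≤ 1 := fun T hT => by simpa using Finset.card_le_card (hsub T hT)
    have hmem : ∀ T ∈ P, T.card = 1 → v ∈ T := by
      intro T hT h1
      obtain ⟨w, rfl⟩ := Finset.card_eq_one.1 h1
      simpa [eq_comm] using hsub _ hT
    refine ⟨Multiset.countP_eq_zero.2 fun T hT h => ?_, Multiset.countP_eq_zero.2 fun T hT h => ?_,
      ?_⟩
    · have := hc T hT; omega
    · have := hc T hT; omega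
    · rcases Nat.eq_zero_or_pos (P.countP (fun T => T.card = 1)) with h0 | h0
      · exact .inl h0
      · refine .inr ⟨?_, ?_⟩
        · refine le_antisymm (le_trans ?_ (hP.disjoint v)) h0
          rw [Multiset.countP_eq_card_filter, Multiset.countP_eq_card_filter]
          refine Multiset.card_le_card (Multiset.le_filter.2 ⟨Multiset.filter_le _ _, ?_⟩)
          intro T hT
          obtain ⟨hT, h1⟩ := Multiset.mem_filter.1 hT
          exact hmem T hT h1
        · obtain ⟨T, hT, h1⟩ := Multiset.countP_pos.1 h0
          have := hP.subset T hT (hmem T hT h1)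
          simp only [Finset.mem_sdiff] at this
          exact this.2
  · rintro ⟨rfl, rfl, rfl | ⟨rfl, hv⟩⟩
    · exact ⟨0, ⟨by simp, by simp, by simp, by simp, by simp⟩, by simp⟩
    · refine ⟨{{v}}, ⟨?_, ?_, ?_, ?_, ?_⟩, ?_⟩
      · simpa using hv
      · simp
      · simp
      · simpa using hv
      · intro w
        rw [← Multiset.cons_zero, Multiset.countP_cons]
        split_ifs <;> simp
      · rw [← Multiset.cons_zero]
        simp only [Multiset.countP_cons, Multiset.countP_zero, Finset.card_singleton]
        simp

theorem IsDecomposition.achieves_iff_hasPacking {D : Finset V} {u : V} {U S : V → Finset V}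
    (h : IsDecomposition G D {u} U S) (c : ℕ) :
    Achieves G (U u) (S u) 0 0 c ↔ HasPacking G D c := by
  have hU : ∀ x, x ∈ U u ↔ x ∉ D := fun x =>
    ⟨h.notMem u (by simp) x, fun hx => by simpa using h.cover x hx⟩
  constructor
  · rintro ⟨P, hP, -, -, rfl⟩
    have hle : ∀ T ∈ P, T.card = 3 → P.count T ≤ 1 := by
      intro T hT hc
      obtain ⟨v, hv⟩ : T.Nonempty := Finset.card_pos.1 (by omega)
      refine le_trans ?_ (hP.disjoint v)
      rw [Multiset.count, Multiset.countP_eq_card_filter, Multiset.countP_eq_card_filter]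
      exact Multiset.card_le_card (Multiset.monotone_filter_right _ fun T' (e : T = T') => e ▸ hv)
    have hnd : (P.filter (fun T => T.card = 3)).Nodup := by
      refine Multiset.nodup_iff_count_le_one.2 fun T => ?_
      by_cases hT : T ∈ P.filter (fun T => T.card = 3)
      · obtain ⟨hT, hc⟩ := Multiset.mem_filter.1 hT
        exact (Multiset.count_le_of_le _ (Multiset.filter_le _ _)).trans (hle T hT hc)
      · simp [Multiset.count_eq_zero_of_notMem hT]
    refine ⟨⟨_, hnd⟩, ⟨?_, ?_⟩, ?_, ?_⟩
    · intro T hT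
      obtain ⟨hT, hc⟩ := Multiset.mem_filter.1 (Finset.mem_mk.1 hT)
      exact ⟨hP.isClique T hT, hc⟩
    · intro T hT T' hT' hne
      obtain ⟨hT, -⟩ := Multiset.mem_filter.1 (Finset.mem_mk.1 hT)
      obtain ⟨hT', -⟩ := Multiset.mem_filter.1 (Finset.mem_mk.1 hT')
      refine Finset.disjoint_left.2 fun v hv hv' => ?_
      have := hP.disjoint v
      obtain ⟨Q, rfl⟩ := Multiset.exists_cons_of_mem hT
      obtain ⟨Q, rfl⟩ := Multiset.exists_cons_of_mem
        ((Multiset.mem_cons.1 hT').resolve_left hne.symm)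
      simp [hv, hv'] at this
    · intro T hT
      obtain ⟨hT, -⟩ := Multiset.mem_filter.1 (Finset.mem_mk.1 hT)
      exact Finset.disjoint_left.2 fun v hv => (hU v).1 (hP.subset T hT hv)
    · rw [Multiset.countP_eq_card_filter]; rfl
  · rintro ⟨P, ⟨hP, hdis⟩, hD, rfl⟩
    have hP' : ∀ T ∈ P.val, G.IsNClique 3 T := hP
    refine ⟨P.val, ⟨?_, ?_, ?_, ?_, ?_⟩, ?_, ?_, ?_⟩
    · exact fun T hT v hv => (hU v).2 (Finset.disjoint_left.1 (hD T hT) hv)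
    · exact fun T hT => (hP' T hT).isClique
    · exact fun T hT => (hP' T hT).card_eq.le
    · exact fun T hT hc => absurd (hP' T hT).card_eq hc.ne
    · intro v
      rw [Multiset.countP_eq_card_filter]
      refine Finset.card_le_one (s := P.filter (fun T => v ∈ T)).2 fun T hT T' hT' => ?_
      obtain ⟨hT, hv⟩ := Finset.mem_filter.1 hT
      obtain ⟨hT', hv'⟩ := Finset.mem_filter.1 hT'
      by_contra hne
      exact Finset.disjoint_left.1 (hdis T hT T' hT' hne) hv hv'
    · exact Multiset.countP_eq_zero.2 fun T hT h => by have := (hP' T hT).card_eq; omega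
    · exact Multiset.countP_eq_zero.2 fun T hT h => by have := (hP' T hT).card_eq; omega
    · exact Multiset.countP_eq_card.2 fun T hT => (hP' T hT).card_eq

theorem HasPacking.of_union {D T : Finset V} {c : ℕ} (hT : G.IsNClique 3 T) (hTD : Disjoint T D)
    (h : HasPacking G (D ∪ T) c) : HasPacking G D (c + 1) := by
  obtain ⟨P, ⟨hP, hdis⟩, hD, rfl⟩ := h
  have hPT : ∀ S ∈ P, Disjoint S T := fun S hS =>
    (hD S hS).mono_right Finset.subset_union_right
  have hTP : T ∉ P := fun hmem => by
    have := hT.card_eq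
    rw [disjoint_self.1 (hPT T hmem)] at this
    simp at this
  refine ⟨insert T P, ⟨?_, ?_⟩, ?_, Finset.card_insert_of_notMem hTP⟩
  · simpa [hT] using hP
  · intro S hS S' hS' hne
    rcases Finset.mem_insert.1 hS with rfl | h1 <;> rcases Finset.mem_insert.1 hS' with rfl | h2
    · exact absurd rfl hne
    · exact (hPT S' h2).symm
    · exact hPT S h1
    · exact hdis S h1 S' h2 hne
  · intro S hS
    rcases Finset.mem_insert.1 hS with rfl | hS
    · exact hTD
    · exact (hD S hS).mono_right Finset.subset_union_left

section PackingNumber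

variable [Fintype V]

theorem HasPacking.le_card {D : Finset V} {c : ℕ} (h : HasPacking G D c) : c ≤ Fintype.card V := by
  obtain ⟨P, ⟨hP, hdis⟩, -, rfl⟩ := h
  have h1 : (P.biUnion id).card = ∑ T ∈ P, T.card :=
    Finset.card_biUnion fun S hS T hT hne => hdis S hS T hT hne
  have h2 : P.card * 1 ≤ ∑ T ∈ P, T.card :=
    Finset.card_nsmul_le_sum P _ 1 fun T hT => by rw [(hP T hT).card_eq]; simp
  have h3 := Finset.card_le_univ (P.biUnion id)
  omega

theorem HasPacking.le_packingNumber {D : Finset V} {c : ℕ} (h : HasPacking G D c) :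
    c ≤ packingNumber G D := by
  classical
  exact Nat.le_findGreatest h.le_card h

theorem packingNumber_union_lt {D T : Finset V} (hT : G.IsNClique 3 T) (hTD : Disjoint T D) :
    packingNumber G (D ∪ T) + 1 ≤ packingNumber G D :=
  ((hasPacking_packingNumber _).of_union hT hTD).le_packingNumber

/-- The triangle `T` cannot be added to a packing that covers `D` without loss. -/
def IsRejected (G : SimpleGraph V) (D T : Finset V) : Prop :=
  ¬ Disjoint T D ∨ packingNumber G (D ∪ T) + 1 < packingNumber G D

/-- A rejected triangle stays rejected when another triangle is added without loss. -/
theorem IsRejected.union {D T T' : Finset V} (h : IsRejected G D T)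
    (hT' : G.IsNClique 3 T') (hTD' : Disjoint T' D)
    (hnu : packingNumber G D ≤ packingNumber G (D ∪ T') + 1) : IsRejected G (D ∪ T') T := by
  rcases h with h | h
  · exact .inl fun hd => h (hd.mono_right Finset.subset_union_left)
  by_cases hd : Disjoint T (D ∪ T')
  · refine .inr ?_
    have hTT' : Disjoint T' (D ∪ T) :=
      Finset.disjoint_union_right.2 ⟨hTD', (Finset.disjoint_union_right.1 hd).2.symm⟩
    have := packingNumber_union_lt hT' hTT'
    rw [Finset.union_right_comm] at this
    omega
  · exact .inl hd

theorem isRejected_of_mem {D T : Finset V} (hT : G.IsNClique 3 T) : IsRejected G (D ∪ T) T := by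
  refine .inl fun h => ?_
  have := disjoint_self.1 (h.mono_right Finset.subset_union_right)
  have h3 := hT.card_eq
  simp [this] at h3

/-- If every triangle is rejected, no triangle is left. -/
theorem packingNumber_eq_zero {D : Finset V} (h : ∀ T, G.IsNClique 3 T → IsRejected G D T) :
    packingNumber G D = 0 := by
  by_contra h0
  obtain ⟨P, ⟨hP, hdis⟩, hD, hc⟩ := hasPacking_packingNumber (G := G) D
  obtain ⟨T, hT⟩ : P.Nonempty := Finset.card_pos.1 (by omega)
  rcases h T (hP T hT) with h | h
  · exact h (hD T hT)
  · have : HasPacking G (D ∪ T) (P.erase T).card := by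
      refine ⟨P.erase T, ⟨fun S hS => hP S (Finset.mem_of_mem_erase hS), fun S hS S' hS' =>
        hdis S (Finset.mem_of_mem_erase hS) S' (Finset.mem_of_mem_erase hS')⟩, fun S hS => ?_, rfl⟩
      obtain ⟨hne, hS⟩ := Finset.mem_erase.1 hS
      exact Finset.disjoint_union_right.2 ⟨hD S hS, hdis S hS T hT hne⟩
    have := this.le_packingNumber
    rw [Finset.card_erase_of_mem hT] at this
    omega

end PackingNumber

end Decomposition

/-! ### Programs with bounded loops -/

namespace RAM

@[simp] theorem State.setReg_reg (σ : State) (x v y : ℕ) :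
    (σ.setReg x v).reg y = if y = x then v else σ.reg y := by
  simp [State.setReg, Function.update_apply]

@[simp] theorem State.setReg_arr (σ : State) (x v : ℕ) : (σ.setReg x v).arr = σ.arr := rfl

@[simp] theorem State.setArr_reg (σ : State) (a i v : ℕ) : (σ.setArr a i v).reg = σ.reg := rfl

@[simp] theorem State.setArr_arr (σ : State) (a i v b j : ℕ) :
    (σ.setArr a i v).arr b j = if b = a ∧ j = i then v else σ.arr b j := by
  simp only [State.setArr, Function.update_apply]
  split_ifs <;> simp_all

theorem State.setArr_arr_of_ne (σ : State) {a b : ℕ} (i v : ℕ) (h : b ≠ a) :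
    (σ.setArr a i v).arr b = σ.arr b := by
  simp [State.setArr, h]

/-- Programs whose only loops are counting loops: `loop k x c` runs `c` for the values
`0, …, n + k - 1` of register `x`, where `n` is the content of register `0`. -/
inductive Cmd where
  | skip
  | assign (x : ℕ) (e : Expr)
  | store (a : ℕ) (i e : Expr)
  | seq (c d : Cmd)
  | branch (e : Expr) (c d : Cmd)
  | loop (k x : ℕ) (c : Cmd)

namespace Cmd

/-- Sequential composition. -/
infixr:60 " ;; " => Cmd.seq

/-- The state after `m` iterations of a counting loop over register `x` with body `f`. -/
def iter (f : State → State) (x : ℕ) : ℕ → State → State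
  | 0, σ => σ.setReg x 0
  | m + 1, σ => (f (iter f x m σ)).setReg x (m + 1)

/-- The final state. -/
def run : Cmd → State → State
  | .skip, σ => σ
  | .assign x e, σ => σ.setReg x (e.eval σ)
  | .store a i e, σ => σ.setArr a (i.eval σ) (e.eval σ)
  | .seq c d, σ => d.run (c.run σ)
  | .branch e c d, σ => if e.eval σ ≠ 0 then c.run σ else d.run σ
  | .loop k x c, σ => iter c.run x (σ.reg 0 + k) σ

/-- The program for the machine. -/
def compile : Cmd → Prog
  | .skip => .skip
  | .assign x e => .assign x e
  | .store a i e => .store a i e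
  | .seq c d => .seq c.compile d.compile
  | .branch e c d => .branch e c.compile d.compile
  | .loop k x c => .seq (.assign x (.const 0))
      (.loop (.sub (.add (.var 0) (.const k)) (.var x))
        (.seq c.compile (.assign x (.add (.var x) (.const 1)))))

/-- Does the program assign to register `x`? -/
def writesReg (y : ℕ) : Cmd → Bool
  | .skip => false
  | .assign x _ => y == x
  | .store _ _ _ => false
  | .seq c d => c.writesReg y || d.writesReg y
  | .branch _ c d => c.writesReg y || d.writesReg y
  | .loop _ x c => y == x || c.writesReg y

/-- Does the program store into array `b`? -/
def writesArr (b : ℕ) : Cmd → Bool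
  | .skip => false
  | .assign _ _ => false
  | .store a _ _ => b == a
  | .seq c d => c.writesArr b || d.writesArr b
  | .branch _ c d => c.writesArr b || d.writesArr b
  | .loop _ _ c => c.writesArr b

/-- No loop body changes the loop register or register `0`. -/
def wf : Cmd → Bool
  | .skip => true
  | .assign _ _ => true
  | .store _ _ _ => true
  | .seq c d => c.wf && d.wf
  | .branch _ c d => c.wf && d.wf
  | .loop _ x c => c.wf && !(x == 0) && !c.writesReg 0 && !c.writesReg x

/-- A bound on the running time, as a polynomial in the initial content of register `0`. The test
and the increment of a counting loop take ten steps in every iteration; the initial assignment and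
the last test take eight. -/
noncomputable def cost : Cmd → Polynomial ℕ
  | .skip => 1
  | .assign _ e => .C (e.cost + 1)
  | .store _ i e => .C (i.cost + e.cost + 1)
  | .seq c d => c.cost + d.cost
  | .branch e c d => .C (e.cost + 1) + c.cost + d.cost
  | .loop k _ c => (.X + .C k) * (c.cost + .C 10) + .C 8

/-- Outside the registers and arrays that `c` writes to, the state is as in `σ`. -/
def Frame (c : Cmd) (σ τ : State) : Prop :=
  (∀ x, c.writesReg x = false → τ.reg x = σ.reg x) ∧
    ∀ a, c.writesArr a = false → τ.arr a = σ.arr a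

theorem frame_run (c : Cmd) (σ : State) : Frame c σ (c.run σ) := by
  induction c generalizing σ with
  | skip => exact ⟨fun _ _ => rfl, fun _ _ => rfl⟩
  | assign x e =>
    refine ⟨fun y hy => ?_, fun _ _ => rfl⟩
    simp only [writesReg, beq_eq_false_iff_ne] at hy
    simp [run, hy]
  | store a i e =>
    refine ⟨fun _ _ => rfl, fun b hb => ?_⟩
    simp only [writesArr, beq_eq_false_iff_ne] at hb
    exact State.setArr_arr_of_ne _ _ _ hb
  | seq c d ihc ihd =>
    refine ⟨fun y hy => ?_, fun b hb => ?_⟩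
    · simp only [writesReg, Bool.or_eq_false_iff] at hy
      exact ((ihd _).1 y hy.2).trans ((ihc σ).1 y hy.1)
    · simp only [writesArr, Bool.or_eq_false_iff] at hb
      exact ((ihd _).2 b hb.2).trans ((ihc σ).2 b hb.1)
  | branch e c d ihc ihd =>
    refine ⟨fun y hy => ?_, fun b hb => ?_⟩
    · simp only [writesReg, Bool.or_eq_false_iff] at hy
      simp only [run]
      split_ifs
      exacts [(ihc σ).1 y hy.1, (ihd σ).1 y hy.2]
    · simp only [writesArr, Bool.or_eq_false_iff] at hb
      simp only [run]
      split_ifs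
      exacts [(ihc σ).2 b hb.1, (ihd σ).2 b hb.2]
  | loop k x c ih =>
    refine ⟨fun y hy => ?_, fun b hb => ?_⟩
    · simp only [writesReg, Bool.or_eq_false_iff, beq_eq_false_iff_ne] at hy
      simp only [run]
      generalize σ.reg 0 + k = m
      induction m with
      | zero => simp [iter, hy.1]
      | succ m ihm => simp [iter, hy.1, (ih _).1 y hy.2, ihm]
    · simp only [writesArr] at hb
      simp only [run]
      generalize σ.reg 0 + k = m
      induction m with
      | zero => simp [iter]
      | succ m ihm => simp [iter, (ih _).2 b hb, ihm]

theorem run_reg {c : Cmd} {x : ℕ} (h : c.writesReg x = false) (σ : State) :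
    (c.run σ).reg x = σ.reg x := (c.frame_run σ).1 x h

theorem run_arr {c : Cmd} {a : ℕ} (h : c.writesArr a = false) (σ : State) :
    (c.run σ).arr a = σ.arr a := (c.frame_run σ).2 a h

theorem iter_reg_self (f : State → State) (x m : ℕ) (σ : State) : (iter f x m σ).reg x = m := by
  cases m <;> simp [iter]

theorem iter_reg_of_ne {c : Cmd} {x y : ℕ} (hyx : y ≠ x) (hc : c.writesReg y = false) (m : ℕ)
    (σ : State) : (iter c.run x m σ).reg y = σ.reg y := by
  induction m with
  | zero => simp [iter, hyx]
  | succ m ih => simp [iter, hyx, run_reg hc, ih]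

/-- The machine executes the compiled program within the bound `cost`. -/
theorem exec_compile (c : Cmd) (h : c.wf = true) (h0 : c.writesReg 0 = false) (σ : State) :
    ∃ t ≤ c.cost.eval (σ.reg 0), Exec c.compile σ t (c.run σ) := by
  induction c generalizing σ with
  | skip => exact ⟨1, by simp [cost], .skip σ⟩
  | assign x e => exact ⟨_, by simp [cost], .assign x e σ⟩
  | store a i e => exact ⟨_, by simp [cost], .store a i e σ⟩
  | seq c d ihc ihd =>
    simp only [writesReg, Bool.or_eq_false_iff] at h0
    simp only [wf, Bool.and_eq_true] at h
    obtain ⟨s, hs, hs'⟩ := ihc h.1 h0.1 σ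
    obtain ⟨t, ht, ht'⟩ := ihd h.2 h0.2 (c.run σ)
    rw [run_reg h0.1] at ht
    exact ⟨s + t, by simpa [cost] using add_le_add hs ht, .seq hs' ht'⟩
  | branch e c d ihc ihd =>
    simp only [writesReg, Bool.or_eq_false_iff] at h0
    simp only [wf, Bool.and_eq_true] at h
    by_cases he : e.eval σ ≠ 0
    · obtain ⟨s, hs, hs'⟩ := ihc h.1 h0.1 σ
      refine ⟨e.cost + 1 + s, ?_, ?_⟩
      · simp only [cost, Polynomial.eval_add, Polynomial.eval_C]
        omega
      · simp only [run, if_pos he]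
        exact .branch_true he hs'
    · obtain ⟨s, hs, hs'⟩ := ihd h.2 h0.2 σ
      refine ⟨e.cost + 1 + s, ?_, ?_⟩
      · simp only [cost, Polynomial.eval_add, Polynomial.eval_C]
        omega
      · simp only [run, if_neg he]
        exact .branch_false (not_not.1 he) hs'
  | loop k x c ih =>
    simp only [writesReg, Bool.or_eq_false_iff, beq_eq_false_iff_ne] at h0
    simp only [wf, Bool.and_eq_true, Bool.not_eq_true', beq_eq_false_iff_ne] at h
    obtain ⟨⟨⟨hwf, hx0⟩, -⟩, hx⟩ := h
    set N := σ.reg 0 + k with hN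
    set B := c.cost.eval (σ.reg 0) with hB
    have hr0 : ∀ m, (iter c.run x m σ).reg 0 = σ.reg 0 := fun m => iter_reg_of_ne h0.1 h0.2 m σ
    -- the loop, entered after `N - d` iterations
    have main : ∀ d, d ≤ N → ∃ t ≤ d * (B + 10) + 6,
        Exec (.loop (.sub (.add (.var 0) (.const k)) (.var x))
          (.seq c.compile (.assign x (.add (.var x) (.const 1)))))
          (iter c.run x (N - d) σ) t (iter c.run x N σ) := by
      intro d
      induction d with
      | zero =>
        intro _
        exact ⟨6, by simp, .loop_false (by simp [Expr.eval, hr0, iter_reg_self, ← hN])⟩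
      | succ d ihd =>
        intro hd
        obtain ⟨t, ht, ht'⟩ := ihd (by omega)
        obtain ⟨s, hs, hs'⟩ := ih hwf h0.2 (iter c.run x (N - (d + 1)) σ)
        rw [hr0, ← hB] at hs
        have hstep : iter c.run x (N - d) σ = (c.run (iter c.run x (N - (d + 1)) σ)).setReg x
            ((Expr.add (.var x) (.const 1)).eval (c.run (iter c.run x (N - (d + 1)) σ))) := by
          rw [show N - d = N - (d + 1) + 1 by omega]
          simp [iter, Expr.eval, run_reg hx, iter_reg_self]
        rw [hstep] at ht'
        refine ⟨_, ?_, .loop_true ?_ (.seq hs' (.assign _ _ _)) ht'⟩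
        · simp only [Expr.cost]
          rw [Nat.succ_mul]
          omega
        · simp only [Expr.eval, hr0, iter_reg_self, ← hN]
          omega
    obtain ⟨t, ht, ht'⟩ := main N le_rfl
    rw [Nat.sub_self] at ht'
    refine ⟨_, ?_, .seq (.assign x (.const 0) σ) ht'⟩
    simp only [cost, Expr.cost, Polynomial.eval_add, Polynomial.eval_mul, Polynomial.eval_X,
      Polynomial.eval_C, ← hN, ← hB]
    omega

/-! ### Reasoning about loops -/

/-- A counting loop advances a quantity, measured by `I`, by the same amount in every
iteration. -/
theorem run_loop_count {c : Cmd} {k x d n : ℕ} (hx : x ≠ 0) (h0 : c.writesReg 0 = false)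
    {I : ℕ → State → Prop} (hset : ∀ m σ v, I m σ → I m (σ.setReg x v))
    (hc : ∀ m σ, σ.reg 0 = n → I m σ → I (m + d) (c.run σ)) {m : ℕ} {σ : State}
    (hn : σ.reg 0 = n) (hI : I m σ) : I (m + (n + k) * d) ((Cmd.loop k x c).run σ) := by
  simp only [run, hn]
  generalize n + k = N
  induction N with
  | zero =>
    rw [Nat.zero_mul, add_zero]
    exact hset _ _ _ hI
  | succ N ih =>
    have := hc _ _ ((iter_reg_of_ne (x := x) hx.symm h0 N σ).trans hn) ih
    rw [Nat.succ_mul, ← add_assoc]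
    exact hset _ _ _ this

/-- Nested counting loops, given by offsets and registers, the outermost first. -/
def nest : List (ℕ × ℕ) → Cmd → Cmd
  | [], c => c
  | q :: l, c => .loop q.1 q.2 (nest l c)

theorem writesReg_nest {l : List (ℕ × ℕ)} {c : Cmd} {x : ℕ} :
    (nest l c).writesReg x = false ↔ (∀ q ∈ l, x ≠ q.2) ∧ c.writesReg x = false := by
  induction l with
  | nil => simp [nest]
  | cons q l ih => simp [nest, writesReg, ih, and_assoc]

theorem writesArr_nest {l : List (ℕ × ℕ)} {c : Cmd} {a : ℕ} :
    (nest l c).writesArr a = c.writesArr a := by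
  induction l with
  | nil => rfl
  | cons q l ih => simpa [nest, writesArr] using ih

/-- The loop registers are distinct and the body changes neither them nor register `0`. -/
def NestOK (l : List (ℕ × ℕ)) (c : Cmd) : Prop :=
  (0 :: l.map Prod.snd).Nodup ∧ ∀ x ∈ 0 :: l.map Prod.snd, c.writesReg x = false

instance (l : List (ℕ × ℕ)) (c : Cmd) : Decidable (NestOK l c) :=
  inferInstanceAs (Decidable (_ ∧ _))

theorem NestOK.tail {q : ℕ × ℕ} {l : List (ℕ × ℕ)} {c : Cmd} (h : NestOK (q :: l) c) :
    NestOK l c := by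
  obtain ⟨h1, h2⟩ := h
  simp only [List.map_cons, List.nodup_cons, List.mem_cons, not_or] at h1 h2
  refine ⟨by simp only [List.nodup_cons]; tauto, fun x hx => h2 x ?_⟩
  simp only [List.mem_cons] at hx
  tauto

theorem NestOK.head {q : ℕ × ℕ} {l : List (ℕ × ℕ)} {c : Cmd} (h : NestOK (q :: l) c) :
    q.2 ≠ 0 ∧ (nest l c).writesReg 0 = false ∧ (nest l c).writesReg q.2 = false ∧
      c.writesReg q.2 = false ∧ ∀ q' ∈ l, q.2 ≠ q'.2 := by
  obtain ⟨h1, h2⟩ := h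
  simp only [List.map_cons, List.nodup_cons, List.mem_cons, not_or, List.mem_map, not_exists,
    not_and] at h1 h2
  have h3 : ∀ q' ∈ l, q.2 ≠ q'.2 := fun q' hq' e => h1.2.1 q' hq' e.symm
  refine ⟨Ne.symm h1.1.1, writesReg_nest.2 ⟨fun q' hq' e => h1.1.2 q' hq' e.symm, h2 0 (.inl rfl)⟩,
    writesReg_nest.2 ⟨h3, h2 _ (.inr (.inl rfl))⟩, h2 _ (.inr (.inl rfl)), h3⟩

theorem run_nest_inv_aux {c : Cmd} {n : ℕ} (l : List (ℕ × ℕ)) (hl : NestOK l c)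
    {I : State → Prop} (hset : ∀ σ, I σ → ∀ q ∈ l, ∀ v, I (σ.setReg q.2 v))
    (hc : ∀ σ, σ.reg 0 = n → (∀ q ∈ l, σ.reg q.2 < n + q.1) → I σ → I (c.run σ))
    {σ : State} (hn : σ.reg 0 = n) (hI : I σ) : I ((nest l c).run σ) := by
  induction l generalizing I σ with
  | nil => exact hc σ hn (by simp) hI
  | cons q l ih =>
    obtain ⟨hq0, hw0, -, hcq, hql⟩ := hl.head
    simp only [nest, run, hn]
    suffices h : ∀ m ≤ n + q.1, I (iter (nest l c).run q.2 m σ) from h _ le_rfl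
    intro m
    induction m with
    | zero => exact fun _ => hset σ hI q (by simp) 0
    | succ m ihm =>
      intro hm
      refine hset _ (?_ : I _) q (by simp) _
      refine (ih hl.tail (I := fun τ => I τ ∧ τ.reg q.2 = m) ?_ ?_ ?_
        ⟨ihm (by omega), iter_reg_self ..⟩).1
      · intro τ hτ q' hq' v
        exact ⟨hset τ hτ.1 q' (by simp [hq']) v, by simp [hql q' hq', hτ.2]⟩
      · intro τ h0 hlt hτ
        refine ⟨hc τ h0 ?_ hτ.1, by rw [run_reg hcq, hτ.2]⟩
        simp only [List.mem_cons, forall_eq_or_imp]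
        exact ⟨by omega, hlt⟩
      · rw [iter_reg_of_ne hq0.symm hw0, hn]

theorem run_nest_visit_aux {c : Cmd} {n : ℕ} (l : List (ℕ × ℕ)) (hl : NestOK l c)
    {I Q : State → Prop} (hset : ∀ σ, I σ → ∀ q ∈ l, ∀ v, I (σ.setReg q.2 v))
    (hc : ∀ σ, σ.reg 0 = n → (∀ q ∈ l, σ.reg q.2 < n + q.1) → I σ → I (c.run σ))
    (hsetQ : ∀ σ, Q σ → ∀ q ∈ l, ∀ v, Q (σ.setReg q.2 v))
    (hQ : ∀ σ, σ.reg 0 = n → (∀ q ∈ l, σ.reg q.2 < n + q.1) → I σ → Q σ → Q (c.run σ))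
    {vals : ℕ → ℕ} (hvals : ∀ q ∈ l, vals q.2 < n + q.1)
    (hvisit : ∀ σ, σ.reg 0 = n → (∀ q ∈ l, σ.reg q.2 = vals q.2) → I σ → Q (c.run σ))
    {σ : State} (hn : σ.reg 0 = n) (hI : I σ) : Q ((nest l c).run σ) := by
  induction l generalizing I σ with
  | nil => exact hvisit σ hn (by simp) hI
  | cons q l ih =>
    obtain ⟨hq0, hw0, -, hcq, hql⟩ := hl.head
    simp only [nest, run, hn]
    have hstep : ∀ m, I (iter (nest l c).run q.2 m σ) →
        (fun τ => I τ ∧ τ.reg q.2 = m) (iter (nest l c).run q.2 m σ) :=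
      fun m h => ⟨h, iter_reg_self ..⟩
    have hr0 : ∀ m, (iter (nest l c).run q.2 m σ).reg 0 = n := fun m =>
      (iter_reg_of_ne hq0.symm hw0 m σ).trans hn
    have hset' : ∀ m τ, (I τ ∧ τ.reg q.2 = m) → ∀ q' ∈ l, ∀ v,
        I (τ.setReg q'.2 v) ∧ (τ.setReg q'.2 v).reg q.2 = m := fun m τ hτ q' hq' v =>
      ⟨hset τ hτ.1 q' (by simp [hq']) v, by simp [hql q' hq', hτ.2]⟩
    have hc' : ∀ m, m < n + q.1 → ∀ τ, τ.reg 0 = n → (∀ q' ∈ l, τ.reg q'.2 < n + q'.1) →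
        (I τ ∧ τ.reg q.2 = m) → I (c.run τ) ∧ (c.run τ).reg q.2 = m := fun m hm τ h0 hlt hτ =>
      ⟨hc τ h0 (by simp only [List.mem_cons, forall_eq_or_imp]; exact ⟨by omega, hlt⟩) hτ.1,
        by rw [run_reg hcq, hτ.2]⟩
    have hinv : ∀ m ≤ n + q.1, I (iter (nest l c).run q.2 m σ) := by
      intro m
      induction m with
      | zero => exact fun _ => hset σ hI q (by simp) 0
      | succ m ihm =>
        intro hm
        exact hset _ (run_nest_inv_aux l hl.tail (hset' m) (hc' m (by omega)) (hr0 m)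
          (hstep m (ihm (by omega)))).1 q (by simp) _
    suffices h : ∀ m ≤ n + q.1, vals q.2 < m → Q (iter (nest l c).run q.2 m σ) from
      h _ le_rfl (hvals q (by simp))
    intro m
    induction m with
    | zero => exact fun _ h => absurd h (by simp)
    | succ m ihm =>
      intro hm hlt
      refine hsetQ _ (?_ : Q _) q (by simp) _
      by_cases hm' : vals q.2 = m
      · refine ih hl.tail (hset' m) (hc' m (by omega)) (fun τ hτ q' hq' => hsetQ τ hτ q'
          (by simp [hq'])) ?_ (fun q' hq' => hvals q' (by simp [hq'])) ?_ (hr0 m)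
          (hstep m (hinv m (by omega)))
        · intro τ h0 hlt' hτ hQτ
          refine hQ τ h0 ?_ hτ.1 hQτ
          simp only [List.mem_cons, forall_eq_or_imp]
          exact ⟨by omega, hlt'⟩
        · intro τ h0 hlt' hτ
          refine hvisit τ h0 ?_ hτ.1
          simp only [List.mem_cons, forall_eq_or_imp]
          exact ⟨by rw [hτ.2, hm'], hlt'⟩
      · refine (run_nest_inv_aux l hl.tail (I := fun τ => (I τ ∧ τ.reg q.2 = m) ∧ Q τ) ?_ ?_ (hr0 m)
          ⟨hstep m (hinv m (by omega)), ihm (by omega) (by omega)⟩).2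
        · exact fun τ hτ q' hq' v => ⟨hset' m τ hτ.1 q' hq' v, hsetQ τ hτ.2 q' (by simp [hq']) v⟩
        · intro τ h0 hlt' hτ
          refine ⟨hc' m (by omega) τ h0 hlt' hτ.1, hQ τ h0 ?_ hτ.1.1 hτ.2⟩
          simp only [List.mem_cons, forall_eq_or_imp]
          exact ⟨by omega, hlt'⟩

theorem Frame.setReg {c : Cmd} {σ τ : State} (h : Frame c σ τ) {x : ℕ}
    (hx : c.writesReg x = true) (v : ℕ) : Frame c σ (τ.setReg x v) := by
  refine ⟨fun y hy => ?_, h.2⟩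
  have : y ≠ x := by rintro rfl; simp [hx] at hy
  simp [this, h.1 y hy]

theorem frame_nest_setReg {l : List (ℕ × ℕ)} {c : Cmd} {σ τ : State} (h : Frame (nest l c) σ τ)
    {q : ℕ × ℕ} (hq : q ∈ l) (v : ℕ) : Frame (nest l c) σ (τ.setReg q.2 v) := by
  refine h.setReg ?_ v
  by_contra hw
  exact (writesReg_nest.1 (by simpa using hw)).1 q hq rfl

theorem frame_nest_run {l : List (ℕ × ℕ)} {c : Cmd} {σ τ : State} (h : Frame (nest l c) σ τ) :
    Frame (nest l c) σ (c.run τ) :=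
  ⟨fun x hx => (run_reg (writesReg_nest.1 hx).2 τ).trans (h.1 x hx),
    fun a ha => (run_arr (writesArr_nest (l := l) ▸ ha) τ).trans (h.2 a ha)⟩

/-- An invariant of the body of nested loops holds at the end. -/
theorem run_nest_inv {c : Cmd} {l : List (ℕ × ℕ)} (hl : NestOK l c) {I : State → Prop} {σ : State}
    (hset : ∀ τ, I τ → ∀ q ∈ l, ∀ v, I (τ.setReg q.2 v))
    (hc : ∀ τ, Frame (nest l c) σ τ → (∀ q ∈ l, τ.reg q.2 < σ.reg 0 + q.1) → I τ → I (c.run τ))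
    (hI : I σ) : I ((nest l c).run σ) :=
  (run_nest_inv_aux (I := fun τ => Frame (nest l c) σ τ ∧ I τ) l hl
    (fun τ hτ q hq v => ⟨frame_nest_setReg hτ.1 hq v, hset τ hτ.2 q hq v⟩)
    (fun τ _ hlt hτ => ⟨frame_nest_run hτ.1, hc τ hτ.1 hlt hτ.2⟩) rfl
    ⟨⟨fun _ _ => rfl, fun _ _ => rfl⟩, hI⟩).2

/-- What the body of nested loops establishes for some values of the loop registers, and never
destroys, holds at the end. -/
theorem run_nest_visit {c : Cmd} {l : List (ℕ × ℕ)} (hl : NestOK l c) {I Q : State → Prop}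
    {σ : State} (hset : ∀ τ, I τ → ∀ q ∈ l, ∀ v, I (τ.setReg q.2 v))
    (hc : ∀ τ, Frame (nest l c) σ τ → (∀ q ∈ l, τ.reg q.2 < σ.reg 0 + q.1) → I τ → I (c.run τ))
    (hsetQ : ∀ τ, Q τ → ∀ q ∈ l, ∀ v, Q (τ.setReg q.2 v))
    (hQ : ∀ τ, Frame (nest l c) σ τ → (∀ q ∈ l, τ.reg q.2 < σ.reg 0 + q.1) → I τ → Q τ →
      Q (c.run τ))
    {vals : ℕ → ℕ} (hvals : ∀ q ∈ l, vals q.2 < σ.reg 0 + q.1)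
    (hvisit : ∀ τ, Frame (nest l c) σ τ → (∀ q ∈ l, τ.reg q.2 = vals q.2) → I τ → Q (c.run τ))
    (hI : I σ) : Q ((nest l c).run σ) :=
  run_nest_visit_aux (I := fun τ => Frame (nest l c) σ τ ∧ I τ) l hl
    (fun τ hτ q hq v => ⟨frame_nest_setReg hτ.1 hq v, hset τ hτ.2 q hq v⟩)
    (fun τ _ hlt hτ => ⟨frame_nest_run hτ.1, hc τ hτ.1 hlt hτ.2⟩) hsetQ
    (fun τ _ hlt hτ => hQ τ hτ.1 hlt hτ.2) hvals (fun τ _ hv hτ => hvisit τ hτ.1 hv hτ.2) rfl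
    ⟨⟨fun _ _ => rfl, fun _ _ => rfl⟩, hI⟩

end Cmd

/-! ### Boolean expressions -/

namespace Expr

/-- An expression counts as true if its value is not zero. -/
def Holds (e : Expr) (σ : State) : Prop := e.eval σ ≠ 0

/-- Negation. -/
def neg (e : Expr) : Expr := .sub (.const 1) e

/-- Disjunction. -/
def or (e f : Expr) : Expr := .add e f

/-- Conjunction. -/
def and (e f : Expr) : Expr := neg (or (neg e) (neg f))

/-- `e ≤ f` -/
def le (e f : Expr) : Expr := neg (.sub e f)

/-- `e = f` -/
def eq (e f : Expr) : Expr := and (le e f) (le f e)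

variable {e f : Expr} {σ : State}

@[simp] theorem holds_neg : (neg e).Holds σ ↔ ¬ e.Holds σ := by
  simp only [Holds, neg, eval]; omega

@[simp] theorem holds_or : (or e f).Holds σ ↔ e.Holds σ ∨ f.Holds σ := by
  simp only [Holds, or, eval]; omega

@[simp] theorem holds_and : (and e f).Holds σ ↔ e.Holds σ ∧ f.Holds σ := by
  simp only [and, holds_neg, holds_or]; tauto

@[simp] theorem holds_le : (le e f).Holds σ ↔ e.eval σ ≤ f.eval σ := by
  simp only [le, holds_neg]; simp only [Holds, eval]; omega

@[simp] theorem holds_eq : (eq e f).Holds σ ↔ e.eval σ = f.eval σ := by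
  simp only [eq, holds_and, holds_le]; omega

@[simp] theorem holds_var (x : ℕ) : (var x).Holds σ ↔ σ.reg x ≠ 0 := .rfl

@[simp] theorem holds_get (a : ℕ) : (get a e).Holds σ ↔ σ.arr a (e.eval σ) ≠ 0 := .rfl

end Expr

namespace Cmd

variable {e : Expr} {c d : Cmd} {σ : State}

instance : Decidable (e.Holds σ) := inferInstanceAs (Decidable (e.eval σ ≠ 0))

@[simp] theorem run_skip : skip.run σ = σ := rfl

@[simp] theorem run_assign (x : ℕ) : (assign x e).run σ = σ.setReg x (e.eval σ) := rfl

@[simp] theorem run_store (a : ℕ) {i : Expr} :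
    (store a i e).run σ = σ.setArr a (i.eval σ) (e.eval σ) := rfl

@[simp] theorem run_seq : (seq c d).run σ = d.run (c.run σ) := rfl

@[simp] theorem run_branch : (branch e c d).run σ = if e.Holds σ then c.run σ else d.run σ := rfl

/-- Nested loops that store into array `a` values that do not depend on that array: an entry that
is written has any property shared by all values written to it. -/
theorem run_nest_store {l : List (ℕ × ℕ)} {a : ℕ} {i : Expr} (hl : NestOK l (store a i e))
    {p : ℕ → Prop} {j : ℕ} {vals : ℕ → ℕ} (hvals : ∀ q ∈ l, vals q.2 < σ.reg 0 + q.1)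
    (hp : ∀ τ, Frame (nest l (store a i e)) σ τ → (∀ q ∈ l, τ.reg q.2 < σ.reg 0 + q.1) →
      i.eval τ = j → p (e.eval τ))
    (hj : ∀ τ, Frame (nest l (store a i e)) σ τ → (∀ q ∈ l, τ.reg q.2 = vals q.2) →
      i.eval τ = j) : p (((nest l (store a i e)).run σ).arr a j) := by
  refine run_nest_visit (Q := fun τ => p (τ.arr a j)) (I := fun _ => True) (vals := vals) hl
    (fun _ _ _ _ _ => trivial) (fun _ _ _ _ => trivial) (fun τ h q _ v => h) ?_ hvals ?_ trivial
  · intro τ hF hlt _ h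
    simp only [run_store, State.setArr_arr, true_and]
    split_ifs with h'
    · exact hp τ hF hlt h'.symm
    · exact h
  · intro τ hF hv _
    simp only [run_store, State.setArr_arr, true_and, hj τ hF hv, if_true]
    exact hp τ hF (fun q hq => hv q hq ▸ hvals q hq) (hj τ hF hv)

theorem run_nest_store_of_ne {l : List (ℕ × ℕ)} {a : ℕ} {i : Expr} (hl : NestOK l (store a i e))
    {j : ℕ} (hj : ∀ τ, Frame (nest l (store a i e)) σ τ →
      (∀ q ∈ l, τ.reg q.2 < σ.reg 0 + q.1) → i.eval τ ≠ j) :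
    ((nest l (store a i e)).run σ).arr a j = σ.arr a j := by
  refine run_nest_inv (I := fun τ => τ.arr a j = σ.arr a j) hl (fun τ h q _ v => h) ?_ rfl
  intro τ hF hlt h
  simp [(hj τ hF hlt).symm, h]

end Cmd

end RAM

/-! ### The contraction step as a program -/

namespace TrianglePacking

open RAM RAM.Cmd

/-!
The machine has no names for registers and arrays, which are used as follows.

* Register `0` holds the number `n` of vertices, `1` the number of triangles in the output, `2`, `3`,
  `4` the triangle that is tried, and `5` the number of the phase of the contraction.
* Registers `6` and `7` hold the vertices to be merged, the second into the first, and `8` a vertex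
  to compare them by.
* Registers `9`, `10`, `11` hold the numbers of single vertices, edges and triangles of a partial
  packing of the first side of a merge, `12`, `13`, `14` the same for the second side, and `15`,
  `16`, `17` the numbers of combinations called `x`, `y`, `z` in `MergeRule`.
* Registers `18` and `19` are the flags for twins and for pendant or isolated vertices, `20` holds
  the computed packing number, `21` the one before the current triangle, and `22`, `23` serve to
  tabulate multiples.
* Array `0` is the adjacency matrix, `1` the output, `2` the table of multiples of `n + 1`, `3` marks
  the deleted vertices, `4` marks the vertices not yet merged into others, `5` is the table of
  achieved counts, and `6` a row of it under construction.
-/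

/-- The position of an entry with three indices up to `n`. -/
def idx₃ (n a b c : ℕ) : ℕ := (a * (n + 1) + b) * (n + 1) + c

/-- The position of an entry with four indices, the last three up to `n`. -/
def idx₄ (n u a b c : ℕ) : ℕ := ((u * (n + 1) + a) * (n + 1) + b) * (n + 1) + c

theorem mul_add_lt {x a M N : ℕ} (hx : x < M) (ha : a < N) : x * N + a < M * N :=
  calc x * N + a < x * N + N := by omega
    _ = (x + 1) * N := (Nat.succ_mul x N).symm
    _ ≤ M * N := Nat.mul_le_mul_right N hx

theorem mul_add_inj {x a y b N : ℕ} (ha : a < N) (hb : b < N) (h : x * N + a = y * N + b) :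
    x = y ∧ a = b := by
  have hN : 0 < N := by omega
  have h1 : (a + N * x) / N = (b + N * y) / N := by
    rw [add_comm, mul_comm N, h, add_comm, mul_comm N]
  rw [Nat.add_mul_div_left _ _ hN, Nat.add_mul_div_left _ _ hN, Nat.div_eq_of_lt ha,
    Nat.div_eq_of_lt hb, zero_add, zero_add] at h1
  subst h1
  exact ⟨rfl, by omega⟩

theorem idx₃_inj {n a b c a' b' c' : ℕ} (hb : b ≤ n) (hc : c ≤ n) (hb' : b' ≤ n) (hc' : c' ≤ n)
    (h : idx₃ n a b c = idx₃ n a' b' c') : a = a' ∧ b = b' ∧ c = c' := by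
  obtain ⟨h, h3⟩ := mul_add_inj (Nat.lt_succ_of_le hc) (Nat.lt_succ_of_le hc') h
  obtain ⟨h, h2⟩ := mul_add_inj (Nat.lt_succ_of_le hb) (Nat.lt_succ_of_le hb') h
  exact ⟨h, h2, h3⟩

theorem idx₄_inj {n u a b c u' a' b' c' : ℕ} (ha : a ≤ n) (hb : b ≤ n) (hc : c ≤ n)
    (ha' : a' ≤ n) (hb' : b' ≤ n) (hc' : c' ≤ n) (h : idx₄ n u a b c = idx₄ n u' a' b' c') :
    u = u' ∧ a = a' ∧ b = b' ∧ c = c' := by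
  obtain ⟨h, h3⟩ := mul_add_inj (Nat.lt_succ_of_le hc) (Nat.lt_succ_of_le hc') h
  obtain ⟨h, h2⟩ := mul_add_inj (Nat.lt_succ_of_le hb) (Nat.lt_succ_of_le hb') h
  obtain ⟨h, h1⟩ := mul_add_inj (Nat.lt_succ_of_le ha) (Nat.lt_succ_of_le ha') h
  exact ⟨h, h1, h2, h3⟩

/-- The state holds the graph `G` in register `0` and array `0`, as in the input, the multiples of
`n + 1` in array `2`, and the indicator of the deleted vertices `D` in array `3`. -/
structure Base {n : ℕ} (G : SimpleGraph (Fin n)) (D : Finset (Fin n)) (σ : State) : Prop where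
  order : σ.reg 0 = n
  adj : ∀ u v : Fin n, σ.arr 0 (n * u + v) ≠ 0 ↔ G.Adj u v
  mul : ∀ i < (n + 1) * ((n + 1) * (n + 1)), σ.arr 2 i = i * (n + 1)
  del : ∀ v : Fin n, σ.arr 3 v ≠ 0 ↔ v ∈ D

variable {n : ℕ} {G : SimpleGraph (Fin n)} {D A : Finset (Fin n)} {σ τ : State}

theorem Base.congr (h : Base G D σ) (h0 : τ.reg 0 = σ.reg 0) (a0 : τ.arr 0 = σ.arr 0)
    (a2 : τ.arr 2 = σ.arr 2) (a3 : τ.arr 3 = σ.arr 3) : Base G D τ where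
  order := h0.trans h.order
  adj := by rw [a0]; exact h.adj
  mul := by rw [a2]; exact h.mul
  del := by rw [a3]; exact h.del

theorem Base.frame {c : Cmd} (h : Base G D σ) (hF : Frame c σ τ)
    (hc : (!c.writesReg 0 && !c.writesArr 0 && !c.writesArr 2 && !c.writesArr 3) = true) :
    Base G D τ := by
  simp only [Bool.and_eq_true, Bool.not_eq_true'] at hc
  exact h.congr (hF.1 0 hc.1.1.1) (hF.2 0 hc.1.1.2) (hF.2 2 hc.1.2) (hF.2 3 hc.2)

theorem Base.run {c : Cmd} (h : Base G D σ)
    (hc : (!c.writesReg 0 && !c.writesArr 0 && !c.writesArr 2 && !c.writesArr 3) = true) :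
    Base G D (c.run σ) := h.frame (frame_run c σ) hc

/-- The adjacency of the vertices in registers `x` and `y`: entry `n * u + v` is found from the
multiple `u * (n + 1)` in the table. -/
def adjE (x y : ℕ) : Expr := .get 0 (.add (.sub (.get 2 (.var x)) (.var x)) (.var y))

theorem Base.holds_adjE (h : Base G D σ) {x y : ℕ} {u v : Fin n} (hx : σ.reg x = u)
    (hy : σ.reg y = v) : (adjE x y).Holds σ ↔ G.Adj u v := by
  have hu : (u : ℕ) < (n + 1) * ((n + 1) * (n + 1)) :=
    calc (u : ℕ) < n + 1 := by omega
      _ ≤ (n + 1) * ((n + 1) * (n + 1)) := Nat.le_mul_of_pos_right _ (by positivity)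
  rw [← h.adj u v, adjE, Expr.holds_get]
  simp only [Expr.eval, hx, hy, h.mul _ hu, Nat.mul_succ, Nat.add_sub_cancel, mul_comm]

/-- The position of an entry of array `6`. -/
def cell₃ (a b c : Expr) : Expr := .add (.get 2 (.add (.get 2 a) b)) c

/-- The position of an entry of array `5`, the table of achieved counts. -/
def cell₄ (u a b c : Expr) : Expr := .add (.get 2 (.add (.get 2 (.add (.get 2 u) a)) b)) c

theorem Base.eval_cell₃ (h : Base G D σ) {a b c : Expr} (ha : a.eval σ ≤ n) (hb : b.eval σ ≤ n) :
    (cell₃ a b c).eval σ = idx₃ n (a.eval σ) (b.eval σ) (c.eval σ) := by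
  have h1 : a.eval σ < (n + 1) * ((n + 1) * (n + 1)) :=
    (Nat.lt_succ_of_le ha).trans_le (Nat.le_mul_of_pos_right _ (by positivity))
  have h2 : a.eval σ * (n + 1) + b.eval σ < (n + 1) * ((n + 1) * (n + 1)) :=
    (mul_add_lt (Nat.lt_succ_of_le ha) (Nat.lt_succ_of_le hb)).trans_le
      (Nat.le_mul_of_pos_left _ (by positivity))
  simp only [cell₃, Expr.eval, h.mul _ h1, h.mul _ h2, idx₃]

theorem Base.eval_cell₄ (h : Base G D σ) {u a b c : Expr} (hu : u.eval σ ≤ n)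
    (ha : a.eval σ ≤ n) (hb : b.eval σ ≤ n) :
    (cell₄ u a b c).eval σ = idx₄ n (u.eval σ) (a.eval σ) (b.eval σ) (c.eval σ) := by
  have h0 : u.eval σ < (n + 1) * ((n + 1) * (n + 1)) :=
    (Nat.lt_succ_of_le hu).trans_le (Nat.le_mul_of_pos_right _ (by positivity))
  have h1' := mul_add_lt (Nat.lt_succ_of_le hu) (Nat.lt_succ_of_le ha)
  have h1 : u.eval σ * (n + 1) + a.eval σ < (n + 1) * ((n + 1) * (n + 1)) :=
    h1'.trans_le (Nat.le_mul_of_pos_left _ (by positivity))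
  have h2 : (u.eval σ * (n + 1) + a.eval σ) * (n + 1) + b.eval σ <
      (n + 1) * ((n + 1) * (n + 1)) := by
    rw [← mul_assoc]
    exact mul_add_lt h1' (Nat.lt_succ_of_le hb)
  simp only [cell₄, Expr.eval, h.mul _ h0, h.mul _ h1, h.mul _ h2, idx₄]

/-- Compares the adjacencies of the vertices in registers `6` and `7` to the vertex in register `8`,
if this is in the set with indicator array `4`: clears flag `18`, which says that the two are twins
in the set, if they differ, and flag `19`, which says that the second has no neighbour in the set
but the first, if the second is adjacent. -/
def flagsBody : Cmd :=
  .branch (.and (.get 4 (.var 8)) (.and (.neg (.eq (.var 8) (.var 6)))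
      (.neg (.eq (.var 8) (.var 7)))))
    (.branch (.or (.and (adjE 6 8) (adjE 7 8)) (.neg (.or (adjE 6 8) (adjE 7 8))))
        .skip (.assign 18 (.const 0)) ;;
      .branch (adjE 7 8) (.assign 19 (.const 0)) .skip)
    .skip

/-- Raises both flags, and runs `flagsBody` for all vertices. -/
def flagsCmd : Cmd :=
  .assign 18 (.const 1) ;; .assign 19 (.const 1) ;; nest [(0, 8)] flagsBody

theorem run_flagsBody (hB : Base G D τ) (hA : ∀ v : Fin n, τ.arr 4 v ≠ 0 ↔ v ∈ A)
    {u v w : Fin n} (hu : τ.reg 6 = u) (hv : τ.reg 7 = v) (hw : τ.reg 8 = w) :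
    (((flagsBody.run τ).reg 18 = 0 ↔
      τ.reg 18 = 0 ∨ w ∈ A ∧ w ≠ u ∧ w ≠ v ∧ ¬ (G.Adj u w ↔ G.Adj v w))) ∧
    (((flagsBody.run τ).reg 19 = 0 ↔
      τ.reg 19 = 0 ∨ w ∈ A ∧ w ≠ u ∧ w ≠ v ∧ G.Adj v w)) := by
  have h1 := hB.holds_adjE hu hw
  have h2 := hB.holds_adjE hv hw
  have h2' : ∀ k, (adjE 7 8).Holds (τ.setReg 18 k) ↔ G.Adj v w := fun k =>
    (hB.congr (τ := τ.setReg 18 k) (by simp) rfl rfl rfl).holds_adjE (by simp [hv]) (by simp [hw])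
  have h3 := hA w
  simp only [flagsBody, run_branch, run_seq, run_skip, run_assign, Expr.holds_and, Expr.holds_or,
    Expr.holds_neg, Expr.holds_eq, Expr.holds_get, Expr.eval, hu, hv, hw, h1, h2, h3,
    Fin.val_inj]
  by_cases c1 : w ∈ A ∧ ¬ w = u ∧ ¬ w = v
  · by_cases c2 : G.Adj u w <;> by_cases c3 : G.Adj v w <;> simp [c1, c2, c3, h1, h2, h2']
  · simp only [c1, if_false]
    tauto

theorem run_flagsCmd (hB : Base G D σ) (hA : ∀ v : Fin n, σ.arr 4 v ≠ 0 ↔ v ∈ A)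
    {u v : Fin n} (hu : σ.reg 6 = u) (hv : σ.reg 7 = v) :
    ((flagsCmd.run σ).reg 18 ≠ 0 ↔ G.TwinsIn A u v) ∧
    ((flagsCmd.run σ).reg 19 ≠ 0 ↔ ∀ w ∈ A, w ≠ u → w ≠ v → ¬ G.Adj v w) := by
  have hok : NestOK [(0, 8)] flagsBody := by decide
  simp only [flagsCmd, run_seq, run_assign, Expr.eval]
  set σ₁ := (σ.setReg 18 1).setReg 19 1 with hσ₁
  have hB₁ : Base G D σ₁ := hB.congr (by simp [hσ₁]) rfl rfl rfl
  have hu₁ : σ₁.reg 6 = u := by simp [hσ₁, hu]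
  have hv₁ : σ₁.reg 7 = v := by simp [hσ₁, hv]
  have body : ∀ τ, Frame (nest [(0, 8)] flagsBody) σ₁ τ → ∀ w : Fin n, τ.reg 8 = w →
      (((flagsBody.run τ).reg 18 = 0 ↔
        τ.reg 18 = 0 ∨ w ∈ A ∧ w ≠ u ∧ w ≠ v ∧ ¬ (G.Adj u w ↔ G.Adj v w))) ∧
      (((flagsBody.run τ).reg 19 = 0 ↔
        τ.reg 19 = 0 ∨ w ∈ A ∧ w ≠ u ∧ w ≠ v ∧ G.Adj v w)) := by
    intro τ hF w hw
    refine run_flagsBody (hB₁.frame hF (by decide)) ?_ ((hF.1 6 (by decide)).trans hu₁)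
      ((hF.1 7 (by decide)).trans hv₁) hw
    rw [hF.2 4 (by decide)]
    exact hA
  have lift : ∀ τ : State, (∀ q ∈ [((0 : ℕ), (8 : ℕ))], τ.reg q.2 < σ₁.reg 0 + q.1) →
      ∃ w : Fin n, τ.reg 8 = w := by
    intro τ h
    rw [hB₁.order] at h
    exact ⟨⟨τ.reg 8, by simpa using h⟩, rfl⟩
  have inv : ∀ w : Fin n, _ := fun w : Fin n =>
    run_nest_visit (Q := fun τ => ((w ∈ A ∧ w ≠ u ∧ w ≠ v ∧ ¬ (G.Adj u w ↔ G.Adj v w)) →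
        τ.reg 18 = 0) ∧ ((w ∈ A ∧ w ≠ u ∧ w ≠ v ∧ G.Adj v w) → τ.reg 19 = 0))
      (I := fun _ => True) (vals := fun _ => w) (σ := σ₁) hok
      (fun _ _ _ _ _ => trivial) (fun _ _ _ _ => trivial)
      (fun τ h q hq k => by simpa [List.mem_singleton.1 hq] using h)
      (fun τ hF hlt _ h => by
        obtain ⟨w', hw'⟩ := lift τ hlt
        obtain ⟨h1, h2⟩ := body τ hF w' hw'
        exact ⟨fun hc => h1.2 (.inl (h.1 hc)), fun hc => h2.2 (.inl (h.2 hc))⟩)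
      (by simp [hB₁.order])
      (fun τ hF hval _ => by
        obtain ⟨h1, h2⟩ := body τ hF w (hval (0, 8) (by simp))
        exact ⟨fun hc => h1.2 (.inr hc), fun hc => h2.2 (.inr hc)⟩) trivial
  have conv := run_nest_inv (I := fun τ => (G.TwinsIn A u v → τ.reg 18 ≠ 0) ∧
      ((∀ w ∈ A, w ≠ u → w ≠ v → ¬ G.Adj v w) → τ.reg 19 ≠ 0)) (σ := σ₁) hok
    (fun τ h q hq k => by simpa [List.mem_singleton.1 hq] using h)
    (fun τ hF hlt h => by
      obtain ⟨w', hw'⟩ := lift τ hlt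
      obtain ⟨h1, h2⟩ := body τ hF w' hw'
      refine ⟨fun hT => ?_, fun hP => ?_⟩
      · rw [Ne, h1]
        rintro (h0 | ⟨hA, hu, hv, hn⟩)
        exacts [h.1 hT h0, hn (hT w' hA hu hv)]
      · rw [Ne, h2]
        rintro (h0 | ⟨hA, hu, hv, hn⟩)
        exacts [h.2 hP h0, hP w' hA hu hv hn])
    (by simp [hσ₁])
  refine ⟨⟨fun h w hw hwu hwv => ?_, conv.1⟩, ⟨fun h w hw hwu hwv hvw => ?_, conv.2⟩⟩
  · by_contra hn
    exact h ((inv w).1 ⟨hw, hwu, hwv, hn⟩)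
  · exact h ((inv w).2 ⟨hw, hwu, hwv, hvw⟩)

end TrianglePacking

/-! ### Merging two rows of the table -/

namespace TrianglePacking

open RAM RAM.Cmd

variable {n : ℕ} {G : SimpleGraph (Fin n)} {D A : Finset (Fin n)} {σ τ : State}

/-- The number of single vertices after a merge. -/
def singlesE : Expr :=
  .add (.sub (.var 9) (.add (.var 15) (.var 17))) (.sub (.var 12) (.add (.var 15) (.var 16)))

/-- The number of edges after a merge. -/
def edgesE : Expr :=
  .add (.add (.sub (.var 10) (.var 16)) (.sub (.var 13) (.var 17))) (.var 15)

/-- The number of triangles after a merge. -/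
def trianglesE : Expr :=
  .add (.add (.add (.var 11) (.var 14)) (.var 16)) (.var 17)

/-- `MergeRule` for the counts in registers `9, …, 17`, together with the bound `n` for the
resulting counts, which keeps these within the table. -/
def ruleE : Expr :=
  .and (.le (.add (.var 15) (.var 16)) (.var 12)) (.and (.le (.var 16) (.var 10))
  (.and (.le (.add (.var 15) (.var 17)) (.var 9)) (.and (.le (.var 17) (.var 13))
  (.and (.or (adjE 6 7) (.eq (.add (.add (.var 15) (.var 16)) (.var 17)) (.const 0)))
  (.and (.or (.var 18) (.and (.eq (.var 15) (.const 0)) (.and (.eq (.var 16) (.var 12))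
    (.eq (.var 17) (.var 13)))))
  (.and (.le singlesE (.var 0)) (.and (.le edgesE (.var 0)) (.le trianglesE (.var 0)))))))))

/-- Reads the entries of the table selected by the counts in registers `9, …, 17`, and applies
`ruleE`. -/
def mergeE : Expr :=
  .and (.get 5 (cell₄ (.var 6) (.var 9) (.var 10) (.var 11)))
    (.and (.get 5 (cell₄ (.var 7) (.var 12) (.var 13) (.var 14))) ruleE)

/-- Enters a result of the merge in array `6`. -/
def fillBody : Cmd :=
  .branch mergeE (.store 6 (cell₃ singlesE edgesE trianglesE) (.const 1)) .skip

/-- The loops over the counts of a partial packing. -/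
abbrev loops₃ : List (ℕ × ℕ) := [(1, 9), (1, 10), (1, 11)]

/-- The loops over the counts of two partial packings and over the ways to combine them. -/
abbrev loops₉ : List (ℕ × ℕ) :=
  [(1, 9), (1, 10), (1, 11), (1, 12), (1, 13), (1, 14), (1, 15), (1, 16), (1, 17)]

/-- Clears an entry of array `6`. -/
abbrev clearBody : Cmd := .store 6 (cell₃ (.var 9) (.var 10) (.var 11)) (.const 0)

/-- Copies an entry of array `6` to the row of the vertex in register `6`. -/
abbrev copyBody : Cmd :=
  .store 5 (cell₄ (.var 6) (.var 9) (.var 10) (.var 11))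
    (.get 6 (cell₃ (.var 9) (.var 10) (.var 11)))

/-- Merges the vertex in register `7` into the vertex in register `6`: the new row of the table
is computed in array `6` and copied back. -/
def mergeCmd : Cmd :=
  nest loops₃ clearBody ;;
  nest loops₉ fillBody ;;
  nest loops₃ copyBody ;;
  .store 4 (.var 7) (.const 0)

theorem holds_ruleE (hB : Base G D τ) {u v : Fin n} (hu : τ.reg 6 = u) (hv : τ.reg 7 = v) :
    ruleE.Holds τ ↔ MergeRule (G.Adj u v) (τ.reg 18 ≠ 0) (τ.reg 9) (τ.reg 10) (τ.reg 11)
      (τ.reg 12) (τ.reg 13) (τ.reg 14) (τ.reg 15) (τ.reg 16) (τ.reg 17)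
      (singlesE.eval τ) (edgesE.eval τ) (trianglesE.eval τ) ∧
      singlesE.eval τ ≤ n ∧ edgesE.eval τ ≤ n ∧ trianglesE.eval τ ≤ n := by
  have h0 := hB.order
  simp only [ruleE, MergeRule, Expr.holds_and, Expr.holds_or, Expr.holds_le, Expr.holds_eq,
    Expr.holds_var, hB.holds_adjE hu hv, Expr.eval, h0, singlesE, edgesE, trianglesE]
  tauto

/-- `W` is the set of counts that row `u` of the table represents. -/
def Row (n : ℕ) (σ : State) (u : ℕ) (W : ℕ → ℕ → ℕ → Prop) : Prop :=
  ∀ a ≤ n, ∀ b ≤ n, ∀ c ≤ n, (σ.arr 5 (idx₄ n u a b c) ≠ 0 ↔ W a b c)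

theorem holds_mergeE (hB : Base G D τ) {u v : Fin n} (hu : τ.reg 6 = u) (hv : τ.reg 7 = v)
    {W₁ W₂ : ℕ → ℕ → ℕ → Prop} (hW₁ : Row n τ u W₁) (hW₂ : Row n τ v W₂)
    (hr : ∀ q ∈ loops₉, τ.reg q.2 ≤ n) :
    mergeE.Holds τ ↔ W₁ (τ.reg 9) (τ.reg 10) (τ.reg 11) ∧ W₂ (τ.reg 12) (τ.reg 13) (τ.reg 14) ∧
      MergeRule (G.Adj u v) (τ.reg 18 ≠ 0) (τ.reg 9) (τ.reg 10) (τ.reg 11)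
        (τ.reg 12) (τ.reg 13) (τ.reg 14) (τ.reg 15) (τ.reg 16) (τ.reg 17)
        (singlesE.eval τ) (edgesE.eval τ) (trianglesE.eval τ) ∧
        singlesE.eval τ ≤ n ∧ edgesE.eval τ ≤ n ∧ trianglesE.eval τ ≤ n := by
  simp only [List.mem_cons, List.not_mem_nil, or_false, forall_eq_or_imp, forall_eq] at hr
  obtain ⟨h9, h10, h11, h12, h13, h14, -, -, -⟩ := hr
  rw [mergeE, Expr.holds_and, Expr.holds_and, holds_ruleE hB hu hv, Expr.holds_get, Expr.holds_get,
    hB.eval_cell₄ (by simp [Expr.eval, hu]) (by simpa [Expr.eval] using h9)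
      (by simpa [Expr.eval] using h10),
    hB.eval_cell₄ (by simp [Expr.eval, hv]) (by simpa [Expr.eval] using h12)
      (by simpa [Expr.eval] using h13)]
  simp only [Expr.eval, hu, hv]
  rw [hW₁ _ h9 _ h10 _ h11, hW₂ _ h12 _ h13 _ h14]

theorem run_fill (hB : Base G D σ) {u v : Fin n} (hu : σ.reg 6 = u) (hv : σ.reg 7 = v)
    {W₁ W₂ : ℕ → ℕ → ℕ → Prop} (hW₁ : Row n σ u W₁) (hW₂ : Row n σ v W₂)
    (hle₁ : ∀ a b c, W₁ a b c → a ≤ n ∧ b ≤ n ∧ c ≤ n)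
    (hle₂ : ∀ a b c, W₂ a b c → a ≤ n ∧ b ≤ n ∧ c ≤ n)
    (hz : ∀ a ≤ n, ∀ b ≤ n, ∀ c ≤ n, σ.arr 6 (idx₃ n a b c) = 0) :
    ∀ a ≤ n, ∀ b ≤ n, ∀ c ≤ n, (((nest loops₉ fillBody).run σ).arr 6 (idx₃ n a b c) ≠ 0 ↔
      ∃ a₁ b₁ c₁ a₂ b₂ c₂ x y z, W₁ a₁ b₁ c₁ ∧ W₂ a₂ b₂ c₂ ∧
        MergeRule (G.Adj u v) (σ.reg 18 ≠ 0) a₁ b₁ c₁ a₂ b₂ c₂ x y z a b c) := by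
  have hok : NestOK loops₉ fillBody := by decide
  -- the effect of one iteration
  have body : ∀ τ, Frame (nest loops₉ fillBody) σ τ → (∀ q ∈ loops₉, τ.reg q.2 ≤ n) →
      ∀ a ≤ n, ∀ b ≤ n, ∀ c ≤ n, ((fillBody.run τ).arr 6 (idx₃ n a b c) ≠ 0 ↔
        τ.arr 6 (idx₃ n a b c) ≠ 0 ∨ W₁ (τ.reg 9) (τ.reg 10) (τ.reg 11) ∧
          W₂ (τ.reg 12) (τ.reg 13) (τ.reg 14) ∧
          MergeRule (G.Adj u v) (σ.reg 18 ≠ 0) (τ.reg 9) (τ.reg 10) (τ.reg 11)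
            (τ.reg 12) (τ.reg 13) (τ.reg 14) (τ.reg 15) (τ.reg 16) (τ.reg 17) a b c) := by
    intro τ hF hr a ha b hb c hc
    have hB' : Base G D τ := hB.frame hF (by decide)
    have h5 : τ.arr 5 = σ.arr 5 := hF.2 5 (by decide)
    have hE := holds_mergeE hB' ((hF.1 6 (by decide)).trans hu) ((hF.1 7 (by decide)).trans hv)
      (W₁ := W₁) (W₂ := W₂) (by rw [Row, h5]; exact hW₁) (by rw [Row, h5]; exact hW₂) hr
    rw [hF.1 18 (by decide)] at hE
    rw [fillBody, run_branch]
    split_ifs with hif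
    · obtain ⟨e1, e2, e3, l1, l2, l3⟩ := hE.1 hif
      rw [run_store, State.setArr_arr, hB'.eval_cell₃ l1 l2]
      by_cases heq : idx₃ n a b c = idx₃ n (singlesE.eval τ) (edgesE.eval τ) (trianglesE.eval τ)
      · obtain ⟨rfl, rfl, rfl⟩ := idx₃_inj hb hc l2 l3 heq
        rw [if_pos ⟨rfl, rfl⟩]
        exact iff_of_true (by simp [Expr.eval]) (.inr ⟨e1, e2, e3⟩)
      · rw [if_neg (by simp [heq])]
        refine ⟨.inl, fun h => h.resolve_right ?_⟩
        -- the rule determines the resulting counts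
        rintro ⟨-, -, r1, r2, r3, r4, r5, r6, rfl, rfl, rfl⟩
        exact heq rfl
    · rw [run_skip]
      refine ⟨.inl, fun h => h.resolve_right ?_⟩
      rintro ⟨e1, e2, r1, r2, r3, r4, r5, r6, rfl, rfl, rfl⟩
      exact hif (hE.2 ⟨e1, e2, ⟨r1, r2, r3, r4, r5, r6, rfl, rfl, rfl⟩, ha, hb, hc⟩)
  have hlt : ∀ τ : State, (∀ q ∈ loops₉, τ.reg q.2 < σ.reg 0 + q.1) →
      ∀ q ∈ loops₉, τ.reg q.2 ≤ n := by
    intro τ h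
    simp only [hB.order, List.mem_cons, List.not_mem_nil, or_false, forall_eq_or_imp,
      forall_eq] at h ⊢
    omega
  intro a ha b hb c hc
  constructor
  · refine run_nest_inv (I := fun τ => τ.arr 6 (idx₃ n a b c) ≠ 0 → _) hok
      (fun τ h q _ v => h) ?_ (fun h => absurd (hz a ha b hb c hc) h)
    intro τ hF hr ih h
    rcases (body τ hF (hlt τ hr) a ha b hb c hc).1 h with h | h
    · exact ih h
    · exact ⟨_, _, _, _, _, _, _, _, _, h⟩
  · rintro ⟨a₁, b₁, c₁, a₂, b₂, c₂, x, y, z, h₁, h₂, hR⟩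
    obtain ⟨l1, l2, l3⟩ := hle₁ _ _ _ h₁
    obtain ⟨l4, l5, l6⟩ := hle₂ _ _ _ h₂
    have hx : x ≤ n := by have := hR.1; omega
    have hy : y ≤ n := hR.2.1.trans l2
    have hz : z ≤ n := hR.2.2.2.1.trans l5
    let vals : ℕ → ℕ := fun r => if r = 9 then a₁ else if r = 10 then b₁ else if r = 11 then c₁
      else if r = 12 then a₂ else if r = 13 then b₂ else if r = 14 then c₂ else if r = 15 then x
      else if r = 16 then y else z
    have hvals : ∀ q ∈ loops₉, vals q.2 < σ.reg 0 + q.1 := by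
      simp only [hB.order, List.mem_cons, List.not_mem_nil, or_false, forall_eq_or_imp, forall_eq]
      simp [vals]
      omega
    refine run_nest_visit (I := fun _ => True) (vals := vals)
      (Q := fun τ => τ.arr 6 (idx₃ n a b c) ≠ 0) hok
      (fun _ _ _ _ _ => trivial) (fun _ _ _ _ => trivial) (fun τ h q _ v => h) ?_ hvals ?_ trivial
    · exact fun τ hF hr _ h => (body τ hF (hlt τ hr) a ha b hb c hc).2 (.inl h)
    · intro τ hF hv _
      refine (body τ hF (hlt τ fun q hq => hv q hq ▸ hvals q hq) a ha b hb c hc).2 (.inr ?_)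
      simp only [List.mem_cons, List.not_mem_nil, or_false, forall_eq_or_imp, forall_eq] at hv
      simp [vals] at hv
      obtain ⟨v1, v2, v3, v4, v5, v6, v7, v8, v9⟩ := hv
      rw [v1, v2, v3, v4, v5, v6, v7, v8, v9]
      exact ⟨h₁, h₂, hR⟩

theorem regs_le {σ τ : State} (h0 : σ.reg 0 = n)
    (h : ∀ q ∈ loops₃, τ.reg q.2 < σ.reg 0 + q.1) :
    τ.reg 9 ≤ n ∧ τ.reg 10 ≤ n ∧ τ.reg 11 ≤ n := by
  simp only [h0, List.mem_cons, List.not_mem_nil, or_false, forall_eq_or_imp, forall_eq] at h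
  omega

/-- The values `a`, `b`, `c` for the registers `9`, `10`, `11`. -/
def vals₃ (a b c r : ℕ) : ℕ := if r = 9 then a else if r = 10 then b else c

theorem vals₃_lt (h0 : σ.reg 0 = n) {a b c : ℕ} (ha : a ≤ n) (hb : b ≤ n) (hc : c ≤ n) :
    ∀ q ∈ loops₃, vals₃ a b c q.2 < σ.reg 0 + q.1 := by
  simp only [h0, List.mem_cons, List.not_mem_nil, or_false, forall_eq_or_imp, forall_eq]
  simp [vals₃]
  omega

theorem regs_eq {a b c : ℕ} (h : ∀ q ∈ loops₃, τ.reg q.2 = vals₃ a b c q.2) :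
    τ.reg 9 = a ∧ τ.reg 10 = b ∧ τ.reg 11 = c := by
  simpa [vals₃] using h

theorem run_clear (hB : Base G D σ) {a b c : ℕ} (ha : a ≤ n) (hb : b ≤ n) (hc : c ≤ n) :
    ((nest loops₃ clearBody).run σ).arr 6
      (idx₃ n a b c) = 0 := by
  refine run_nest_store (p := fun k => k = 0) (vals := vals₃ a b c) (by decide)
    (vals₃_lt hB.order ha hb hc) (fun _ _ _ _ => rfl) ?_
  intro τ hF hv
  obtain ⟨h1, h2, h3⟩ := regs_eq hv
  rw [(hB.frame hF (by decide)).eval_cell₃ (by simpa [Expr.eval, h1]) (by simpa [Expr.eval, h2])]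
  simp [Expr.eval, h1, h2, h3]

theorem run_copy (hB : Base G D σ) {u : Fin n} (hu : σ.reg 6 = u) {a b c : ℕ} (ha : a ≤ n)
    (hb : b ≤ n) (hc : c ≤ n) (w : ℕ) :
    ((nest loops₃ copyBody).run σ).arr 5 (idx₄ n w a b c) =
      if w = u then σ.arr 6 (idx₃ n a b c) else σ.arr 5 (idx₄ n w a b c) := by
  have cell : ∀ τ, Frame (nest loops₃ copyBody) σ τ → τ.reg 9 ≤ n → τ.reg 10 ≤ n →
      (cell₄ (.var 6) (.var 9) (.var 10) (.var 11)).eval τ =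
        idx₄ n u (τ.reg 9) (τ.reg 10) (τ.reg 11) ∧
      (Expr.get 6 (cell₃ (.var 9) (.var 10) (.var 11))).eval τ =
        σ.arr 6 (idx₃ n (τ.reg 9) (τ.reg 10) (τ.reg 11)) := by
    intro τ hF h9 h10
    have hB' : Base G D τ := hB.frame hF (by decide)
    have h6 : τ.reg 6 = u := (hF.1 6 (by decide)).trans hu
    refine ⟨?_, ?_⟩
    · rw [hB'.eval_cell₄ (by simp [Expr.eval, h6]) (by simpa [Expr.eval])
        (by simpa [Expr.eval])]
      simp [Expr.eval, h6]
    · rw [Expr.eval, hB'.eval_cell₃ (by simpa [Expr.eval]) (by simpa [Expr.eval]),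
        hF.2 6 (by decide)]
      simp [Expr.eval]
  split_ifs with hw
  · subst hw
    refine run_nest_store (p := fun k => k = _) (vals := vals₃ a b c) (by decide)
      (vals₃_lt hB.order ha hb hc) ?_ ?_
    · intro τ hF hr h
      obtain ⟨h1, h2, h3⟩ := regs_le hB.order hr
      rw [(cell τ hF h1 h2).1] at h
      obtain ⟨-, e1, e2, e3⟩ := idx₄_inj h1 h2 h3 ha hb hc h
      rw [(cell τ hF h1 h2).2, e1, e2, e3]
    · intro τ hF hv
      obtain ⟨h1, h2, h3⟩ := regs_eq hv
      rw [(cell τ hF (h1.trans_le ha) (h2.trans_le hb)).1, h1, h2, h3]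
  · refine run_nest_store_of_ne (by decide) fun τ hF hr h => hw ?_
    obtain ⟨h1, h2, h3⟩ := regs_le hB.order hr
    rw [(cell τ hF h1 h2).1] at h
    exact (idx₄_inj h1 h2 h3 ha hb hc h).1.symm

theorem run_mergeCmd (hB : Base G D σ) {u v : Fin n} (hu : σ.reg 6 = u) (hv : σ.reg 7 = v)
    {W₁ W₂ : ℕ → ℕ → ℕ → Prop} (hW₁ : Row n σ u W₁) (hW₂ : Row n σ v W₂)
    (hle₁ : ∀ a b c, W₁ a b c → a ≤ n ∧ b ≤ n ∧ c ≤ n)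
    (hle₂ : ∀ a b c, W₂ a b c → a ≤ n ∧ b ≤ n ∧ c ≤ n) :
    (∀ w, (mergeCmd.run σ).arr 4 w = if w = v then 0 else σ.arr 4 w) ∧
    Row n (mergeCmd.run σ) u (fun a b c => ∃ a₁ b₁ c₁ a₂ b₂ c₂ x y z, W₁ a₁ b₁ c₁ ∧ W₂ a₂ b₂ c₂ ∧
        MergeRule (G.Adj u v) (σ.reg 18 ≠ 0) a₁ b₁ c₁ a₂ b₂ c₂ x y z a b c) ∧
    ∀ w ≠ (u : ℕ), ∀ W, Row n σ w W → Row n (mergeCmd.run σ) w W := by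
  simp only [mergeCmd, run_seq, run_store]
  set σ₁ := (nest loops₃ clearBody).run σ
    with hσ₁
  set σ₂ := (nest loops₉ fillBody).run σ₁ with hσ₂
  have hB₁ : Base G D σ₁ := hB.run (by decide)
  have hB₂ : Base G D σ₂ := hB₁.run (by decide)
  have a1 : σ₁.arr 5 = σ.arr 5 := run_arr (by decide) _
  have a2 : σ₂.arr 5 = σ.arr 5 := (run_arr (by decide) _).trans a1
  have hfill := run_fill hB₁ ((run_reg (by decide) _).trans hu) ((run_reg (by decide) _).trans hv)
    (by rw [Row, a1]; exact hW₁) (by rw [Row, a1]; exact hW₂) hle₁ hle₂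
    (fun a ha b hb c hc => run_clear hB ha hb hc)
  rw [← hσ₂, (run_reg (by decide) _ : σ₁.reg 18 = σ.reg 18)] at hfill
  have hu₂ : σ₂.reg 6 = u := (run_reg (by decide) _).trans ((run_reg (by decide) _).trans hu)
  have hv₃ : ((nest loops₃ copyBody).run σ₂).reg 7 = v :=
    (run_reg (by decide) _).trans
      ((run_reg (by decide) _).trans ((run_reg (by decide) _).trans hv))
  refine ⟨fun w => ?_, ?_, ?_⟩
  · simp only [State.setArr_arr, Expr.eval, hv₃, true_and]
    rw [run_arr (by decide), hσ₂, run_arr (by decide), hσ₁, run_arr (by decide)]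
  · intro a ha b hb c hc
    rw [State.setArr_arr_of_ne _ _ _ (by decide), run_copy hB₂ hu₂ ha hb hc, if_pos rfl]
    exact hfill a ha b hb c hc
  · intro w hw W hW a ha b hb c hc
    rw [State.setArr_arr_of_ne _ _ _ (by decide), run_copy hB₂ hu₂ ha hb hc, if_neg hw, a2]
    exact hW a ha b hb c hc

end TrianglePacking

/-! ### Computing the packing number -/

namespace TrianglePacking

open RAM RAM.Cmd

variable {n : ℕ} {G : SimpleGraph (Fin n)} {D A : Finset (Fin n)} {σ τ : State}

/-- Array `4` is the indicator of the set `A` of representatives of a decomposition, and array `5`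
holds the counts achieved by the represented sets. -/
def Contracted (G : SimpleGraph (Fin n)) (D A : Finset (Fin n)) (σ : State) : Prop :=
  ∃ U S, IsDecomposition G D A U S ∧ (∀ v : Fin n, σ.arr 4 v ≠ 0 ↔ v ∈ A) ∧
    ∀ v ∈ A, Row n σ v (Achieves G (U v) (S v))

theorem Contracted.congr (h : Contracted G D A σ) (h4 : τ.arr 4 = σ.arr 4)
    (h5 : τ.arr 5 = σ.arr 5) : Contracted G D A τ := by
  obtain ⟨U, S, hd, hA, hR⟩ := h
  exact ⟨U, S, hd, by rwa [h4], fun v hv => by rw [Row, h5]; exact hR v hv⟩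

/-- Merges the vertices in registers `6` and `7`, if both are representatives and the second can
be pruned. -/
def stepCmd : Cmd :=
  .branch (.and (.get 4 (.var 6)) (.and (.get 4 (.var 7)) (.neg (.eq (.var 6) (.var 7)))))
    (flagsCmd ;; .branch (.or (.var 18) (.var 19)) mergeCmd .skip)
    .skip

theorem run_stepCmd (hB : Base G D σ) (hC : Contracted G D A σ) {u v : Fin n}
    (hu : σ.reg 6 = u) (hv : σ.reg 7 = v) :
    ∃ A', Contracted G D A' (stepCmd.run σ) ∧ (A' = A ∨ A'.card < A.card) ∧
      (u ∈ A → v ∈ A → u ≠ v → (G.TwinsIn A u v ∨ ∀ w ∈ A, w ≠ u → w ≠ v → ¬ G.Adj v w) →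
        A'.card < A.card) := by
  obtain ⟨U, S, hd, hA, hR⟩ := hC
  have hcond : (Expr.and (.get 4 (.var 6)) (.and (.get 4 (.var 7))
      (.neg (.eq (.var 6) (.var 7))))).Holds σ ↔ u ∈ A ∧ v ∈ A ∧ u ≠ v := by
    simp only [Expr.holds_and, Expr.holds_get, Expr.holds_neg, Expr.holds_eq, Expr.eval, hu, hv,
      hA, Fin.val_inj, ne_eq]
  rw [stepCmd, run_branch]
  split_ifs with hif
  · obtain ⟨huA, hvA, huv⟩ := hcond.1 hif
    obtain ⟨hf1, hf2⟩ := run_flagsCmd hB hA hu hv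
    rw [run_seq]
    set σ₁ := flagsCmd.run σ with hσ₁
    have hB₁ : Base G D σ₁ := hB.run (by decide)
    have a4 : σ₁.arr 4 = σ.arr 4 := run_arr (by decide) _
    have a5 : σ₁.arr 5 = σ.arr 5 := run_arr (by decide) _
    rw [run_branch]
    split_ifs with hif₁
    · simp only [Expr.holds_or, Expr.holds_var] at hif₁
      have hT' : ¬ σ₁.reg 18 ≠ 0 → ∀ w ∈ A, w ≠ u → w ≠ v → ¬ G.Adj v w := fun h =>
        hf2.1 (hif₁.resolve_left h)
      have hle : ∀ w : Fin n, ∀ a b c, Achieves G (U w) (S w) a b c → a ≤ n ∧ b ≤ n ∧ c ≤ n :=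
        fun w a b c h => by simpa using h.le_card
      obtain ⟨m1, m2, m3⟩ := run_mergeCmd hB₁ ((run_reg (by decide) _).trans hu)
        ((run_reg (by decide) _).trans hv) (by rw [Row, a5]; exact hR u huA)
        (by rw [Row, a5]; exact hR v hvA) (hle u) (hle v)
      have hcard : (A.erase v).card < A.card := Finset.card_erase_lt_of_mem hvA
      refine ⟨A.erase v, ?_, .inr hcard, fun _ _ _ _ => hcard⟩
      classical
      let R : Finset (Fin n) := if σ₁.reg 18 ≠ 0 then S u ∪ S v else S u
      have hR₁ : σ₁.reg 18 ≠ 0 → R = S u ∪ S v := fun h => if_pos h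
      have hR₂ : ¬ σ₁.reg 18 ≠ 0 → R = S u := fun h => if_neg h
      refine ⟨_, _, hd.merge huA hvA huv hf1.1 hT' hR₁ hR₂, fun w => ?_, fun w hw => ?_⟩
      · rw [m1 w, a4, Finset.mem_erase, ← hA w]
        by_cases hwv : w = v
        · simp [hwv]
        · simp [hwv, Fin.val_inj]
      · obtain ⟨hwv, hwA⟩ := Finset.mem_erase.1 hw
        by_cases hwu : w = u
        · subst hwu
          intro a ha b hb c hc
          rw [m2 a ha b hb c hc, Function.update_self, Function.update_self,
            (hd.mergeable hwA hvA huv).achieves_union_iff hR₁ hR₂]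
        · rw [Function.update_of_ne hwu, Function.update_of_ne hwu]
          refine m3 w (by simpa [Fin.val_inj] using hwu) _ ?_
          rw [Row, a5]
          exact hR w hwA
    · rw [run_skip]
      refine ⟨A, ⟨U, S, hd, by rwa [a4], fun w hw => by rw [Row, a5]; exact hR w hw⟩, .inl rfl,
        fun _ _ _ h => absurd ?_ hif₁⟩
      simp only [Expr.holds_or, Expr.holds_var]
      exact h.imp hf1.2 hf2.2
  · exact ⟨A, ⟨U, S, hd, hA, hR⟩, .inl rfl, fun h1 h2 h3 _ => absurd (hcond.2 ⟨h1, h2, h3⟩) hif⟩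

/-- Tries all pairs of vertices. -/
def phaseCmd : Cmd := nest [(0, 6), (0, 7)] stepCmd

/-- A phase merges at least one pair, as long as there are two representatives. -/
theorem run_phaseCmd (hG : IsDistanceHereditary G) (hB : Base G D σ) (hC : Contracted G D A σ) :
    ∃ A', Contracted G D A' (phaseCmd.run σ) ∧ (A'.card ≤ 1 ∨ A'.card < A.card) := by
  have hok : NestOK [(0, 6), (0, 7)] stepCmd := by decide
  let I : State → Prop := fun τ => ∃ A', Contracted G D A' τ ∧ (A' = A ∨ A'.card < A.card)
  let Q : State → Prop := fun τ => ∃ A', Contracted G D A' τ ∧ A'.card < A.card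
  have hset : ∀ τ, I τ → ∀ q ∈ [((0 : ℕ), (6 : ℕ)), (0, 7)], ∀ k, I (τ.setReg q.2 k) :=
    fun τ ⟨A', h, h'⟩ q _ k => ⟨A', h.congr rfl rfl, h'⟩
  have hlift : ∀ τ : State, (∀ q ∈ [((0 : ℕ), (6 : ℕ)), (0, 7)], τ.reg q.2 < σ.reg 0 + q.1) →
      ∃ u v : Fin n, τ.reg 6 = u ∧ τ.reg 7 = v := by
    intro τ h
    simp only [hB.order, List.mem_cons, List.not_mem_nil, or_false, forall_eq_or_imp, forall_eq,
      add_zero] at h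
    exact ⟨⟨_, h.1⟩, ⟨_, h.2⟩, rfl, rfl⟩
  have hc : ∀ τ, Frame (nest [(0, 6), (0, 7)] stepCmd) σ τ →
      (∀ q ∈ [((0 : ℕ), (6 : ℕ)), (0, 7)], τ.reg q.2 < σ.reg 0 + q.1) → I τ →
      I (stepCmd.run τ) := by
    rintro τ hF hlt ⟨A', h, h'⟩
    obtain ⟨u, v, hu, hv⟩ := hlift τ hlt
    obtain ⟨A'', h1, h2, -⟩ := run_stepCmd (hB.frame hF (by decide)) h hu hv
    refine ⟨A'', h1, ?_⟩
    rcases h2 with rfl | h2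
    · exact h'
    · rcases h' with rfl | h'
      · exact .inr h2
      · exact .inr (h2.trans h')
  by_cases hA : 1 < A.card
  · obtain ⟨u, hu, v, hv, huv, hp⟩ := hG.exists_prunable_mem hA
    obtain ⟨A', h, h'⟩ := run_nest_visit (I := I) (Q := Q) (σ := σ)
      (vals := fun r => if r = 6 then u else v) hok hset hc
      (fun τ ⟨A', h, h'⟩ q _ k => ⟨A', h.congr rfl rfl, h'⟩)
      (by
        rintro τ hF hlt - ⟨A', h, h'⟩
        obtain ⟨u', v', hu', hv'⟩ := hlift τ hlt
        obtain ⟨A'', h1, h2, -⟩ := run_stepCmd (hB.frame hF (by decide)) h hu' hv'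
        refine ⟨A'', h1, ?_⟩
        rcases h2 with rfl | h2
        exacts [h', h2.trans h'])
      (by simp [hB.order])
      (by
        rintro τ hF hval ⟨A', h, h'⟩
        have hu' : τ.reg 6 = u := by simpa using hval (0, 6) (by simp)
        have hv' : τ.reg 7 = v := by simpa using hval (0, 7) (by simp)
        obtain ⟨A'', h1, h2, h3⟩ := run_stepCmd (hB.frame hF (by decide)) h hu' hv'
        refine ⟨A'', h1, ?_⟩
        rcases h' with rfl | h'
        · exact h3 hu hv huv hp
        · rcases h2 with rfl | h2
          exacts [h', h2.trans h'])
      ⟨A, hC, .inl rfl⟩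
    exact ⟨A', h, .inr h'⟩
  · obtain ⟨A', h, h'⟩ := run_nest_inv (I := I) (σ := σ) hok hset hc ⟨A, hC, .inl rfl⟩
    refine ⟨A', h, .inl ?_⟩
    rcases h' with rfl | h' <;> omega

/-- Enters in the table the counts for the partial packings of a single vertex. -/
abbrev initBody : Cmd :=
  .store 5 (cell₄ (.var 6) (.var 9) (.var 10) (.var 11))
    (.and (.eq (.var 10) (.const 0)) (.and (.eq (.var 11) (.const 0))
      (.or (.eq (.var 9) (.const 0)) (.and (.eq (.var 9) (.const 1)) (.neg (.get 3 (.var 6)))))))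

/-- The loops over the rows of the table and the counts of a partial packing. -/
abbrev loops₄ : List (ℕ × ℕ) := [(0, 6), (1, 9), (1, 10), (1, 11)]

/-- Starts with every vertex as a representative. -/
def initCmd : Cmd :=
  nest [(0, 6)] (.store 4 (.var 6) (.const 1)) ;; nest loops₄ initBody

theorem run_initCmd (hB : Base G D σ) : Contracted G D Finset.univ (initCmd.run σ) := by
  refine ⟨_, _, isDecomposition_univ D, fun v => ?_, fun v _ => ?_⟩
  · refine iff_of_true ?_ (Finset.mem_univ v)
    rw [initCmd, run_seq, run_arr (by decide)]
    refine run_nest_store (p := fun k => k ≠ 0) (vals := fun _ => v) (by decide) ?_ ?_ ?_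
    · simp [hB.order]
    · intro τ _ _ _
      simp [Expr.eval]
    · intro τ _ h
      simpa [Expr.eval] using h
  · rw [initCmd, run_seq]
    set σ₁ := (nest [(0, 6)] (.store 4 (.var 6) (.const 1))).run σ
    have hB₁ : Base G D σ₁ := hB.run (by decide)
    intro a ha b hb c hc
    rw [achieves_singleton_iff]
    have hlt : ∀ τ : State, (∀ q ∈ loops₄, τ.reg q.2 < σ₁.reg 0 + q.1) →
        τ.reg 6 < n ∧ τ.reg 9 ≤ n ∧ τ.reg 10 ≤ n ∧ τ.reg 11 ≤ n := by
      intro τ h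
      simp only [hB₁.order, List.mem_cons, List.not_mem_nil, or_false, forall_eq_or_imp,
        forall_eq] at h
      omega
    have hcell : ∀ τ, Frame (nest loops₄ initBody) σ₁ τ →
        τ.reg 6 < n ∧ τ.reg 9 ≤ n ∧ τ.reg 10 ≤ n ∧ τ.reg 11 ≤ n →
        (cell₄ (.var 6) (.var 9) (.var 10) (.var 11)).eval τ =
          idx₄ n (τ.reg 6) (τ.reg 9) (τ.reg 10) (τ.reg 11) := by
      intro τ hF h
      rw [(hB₁.frame hF (by decide)).eval_cell₄ (by simpa [Expr.eval] using h.1.le)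
        (by simpa [Expr.eval] using h.2.1) (by simpa [Expr.eval] using h.2.2.1)]
      simp [Expr.eval]
    have hvals : ∀ q ∈ loops₄, (fun r => if r = 6 then (v : ℕ) else vals₃ a b c r) q.2 <
        σ₁.reg 0 + q.1 := by
      simp only [hB₁.order, List.mem_cons, List.not_mem_nil, or_false, forall_eq_or_imp, forall_eq]
      simp [vals₃]
      omega
    refine run_nest_store (p := fun k => k ≠ 0 ↔ b = 0 ∧ c = 0 ∧ (a = 0 ∨ a = 1 ∧ v ∉ D))
      (vals := fun r => if r = 6 then v else vals₃ a b c r) (by decide) hvals ?_ ?_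
    · intro τ hF hr h
      obtain ⟨h0, h1, h2, h3⟩ := hlt τ hr
      rw [hcell τ hF ⟨h0, h1, h2, h3⟩] at h
      obtain ⟨e0, e1, e2, e3⟩ := idx₄_inj h1 h2 h3 ha hb hc h
      change Expr.Holds _ τ ↔ _
      simp only [Expr.holds_and, Expr.holds_or, Expr.holds_neg, Expr.holds_eq, Expr.holds_get,
        Expr.eval, e0, e1, e2, e3, (hB₁.frame hF (by decide)).del v]
    · intro τ hF hv
      have h0 : τ.reg 6 = v := by simpa using hv (0, 6) (by simp)
      have h1 : τ.reg 9 = a := by simpa [vals₃] using hv (1, 9) (by simp)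
      have h2 : τ.reg 10 = b := by simpa [vals₃] using hv (1, 10) (by simp)
      have h3 : τ.reg 11 = c := by simpa [vals₃] using hv (1, 11) (by simp)
      rw [hcell τ hF (by rw [h0, h1, h2, h3]; exact ⟨v.2, ha, hb, hc⟩), h0, h1, h2, h3]

/-- Raises register `20` to the number of triangles in register `11`, if the last representative
achieves it without unfinished pieces. -/
def extractBody : Cmd :=
  .branch (.and (.get 4 (.var 6)) (.and
      (.get 5 (cell₄ (.var 6) (.const 0) (.const 0) (.var 11))) (.neg (.le (.var 11) (.var 20)))))
    (.assign 20 (.var 11)) .skip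

/-- Computes in register `20` the largest number of triangles in a packing that avoids the
vertices marked in array `3`. -/
def solveCmd : Cmd :=
  initCmd ;; nest [(0, 5)] phaseCmd ;; .assign 20 (.const 0) ;;
    nest [(0, 6), (1, 11)] extractBody

theorem run_phases (hG : IsDistanceHereditary G) (hB : Base G D σ)
    (hC : Contracted G D Finset.univ σ) :
    ∃ A, Contracted G D A ((nest [(0, 5)] phaseCmd).run σ) ∧ A.card ≤ 1 := by
  -- the measure counts the phases and bounds the number of representatives
  have h := run_loop_count (c := phaseCmd) (k := 0) (x := 5) (d := 1) (n := n) (by decide)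
    (by decide)
    (I := fun m τ => Base G D τ ∧ ∃ A, Contracted G D A τ ∧ (A.card ≤ 1 ∨ A.card + m ≤ n))
    (fun m τ v ⟨hB, A, h, h'⟩ =>
      ⟨hB.congr (by simp) rfl rfl rfl, A, h.congr rfl rfl, h'⟩)
    (fun m τ _ ⟨hB, A, h, h'⟩ => by
      obtain ⟨A', h1, h2⟩ := run_phaseCmd hG hB h
      exact ⟨hB.run (by decide), A', h1, by omega⟩)
    (m := 0) hB.order ⟨hB, _, hC, .inr (by simp)⟩
  obtain ⟨-, A, h, h'⟩ := h
  exact ⟨A, h, by omega⟩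

theorem run_extract (hB : Base G D σ) (hC : Contracted G D A σ) (hA : A.card ≤ 1)
    (h20 : σ.reg 20 = 0) :
    ((nest [(0, 6), (1, 11)] extractBody).run σ).reg 20 = packingNumber G D := by
  obtain ⟨U, S, hd, hA', hR⟩ := hC
  have hok : NestOK [(0, 6), (1, 11)] extractBody := by decide
  -- the effect of one iteration
  have body : ∀ τ, Frame (nest [(0, 6), (1, 11)] extractBody) σ τ → ∀ u : Fin n, τ.reg 6 = u →
      τ.reg 11 ≤ n → (extractBody.run τ).reg 20 =
        open Classical in if u ∈ A ∧ HasPacking G D (τ.reg 11) ∧ τ.reg 20 < τ.reg 11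
          then τ.reg 11 else τ.reg 20 := by
    intro τ hF u hu hc
    have hB' : Base G D τ := hB.frame hF (by decide)
    have hcond : (Expr.and (.get 4 (.var 6)) (.and
        (.get 5 (cell₄ (.var 6) (.const 0) (.const 0) (.var 11)))
        (.neg (.le (.var 11) (.var 20))))).Holds τ ↔
        u ∈ A ∧ HasPacking G D (τ.reg 11) ∧ τ.reg 20 < τ.reg 11 := by
      rw [Expr.holds_and, Expr.holds_and, Expr.holds_get, Expr.holds_get,
        hB'.eval_cell₄ (by simp [Expr.eval, hu]) (by simp [Expr.eval]) (by simp [Expr.eval]),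
        hF.2 4 (by decide), hF.2 5 (by decide)]
      simp only [Expr.eval, Expr.holds_neg, Expr.holds_le, hu, hA', not_le]
      refine and_congr_right fun huA => and_congr_left fun _ => ?_
      have hAu : A = {u} := Finset.eq_singleton_iff_unique_mem.2
        ⟨huA, fun w hw => Finset.card_le_one.1 hA w hw u huA⟩
      rw [hR u huA 0 (by simp) 0 (by simp) _ hc]
      exact (hAu ▸ hd).achieves_iff_hasPacking _
    rw [extractBody, run_branch]
    by_cases h : u ∈ A ∧ HasPacking G D (τ.reg 11) ∧ τ.reg 20 < τ.reg 11
    · rw [if_pos (hcond.2 h), if_pos h]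
      simp [Expr.eval]
    · rw [if_neg (fun h' => h (hcond.1 h')), if_neg h, run_skip]
  have hlift : ∀ τ : State, (∀ q ∈ [((0 : ℕ), (6 : ℕ)), (1, 11)], τ.reg q.2 < σ.reg 0 + q.1) →
      ∃ u : Fin n, τ.reg 6 = u ∧ τ.reg 11 ≤ n := by
    intro τ h
    simp only [hB.order, List.mem_cons, List.not_mem_nil, or_false, forall_eq_or_imp,
      forall_eq, add_zero] at h
    exact ⟨⟨_, h.1⟩, rfl, by omega⟩
  have hset : ∀ p : ℕ → Prop, ∀ τ : State, p (τ.reg 20) →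
      ∀ q ∈ [((0 : ℕ), (6 : ℕ)), (1, 11)], ∀ k, p ((τ.setReg q.2 k).reg 20) := by
    intro p τ h q hq k
    simp only [List.mem_cons, List.not_mem_nil, or_false] at hq
    rcases hq with rfl | rfl <;> simpa using h
  refine le_antisymm ?_ ?_
  · refine HasPacking.le_packingNumber (run_nest_inv (I := fun τ => HasPacking G D (τ.reg 20)) hok
      (hset (HasPacking G D)) ?_ (h20 ▸ hasPacking_zero D))
    intro τ hF hlt h
    obtain ⟨u, hu, hc⟩ := hlift τ hlt
    rw [body τ hF u hu hc]
    split_ifs with hif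
    exacts [hif.2.1, h]
  · rcases Nat.eq_zero_or_pos (packingNumber G D) with h0 | h0
    · rw [h0]; exact Nat.zero_le _
    -- a packed vertex is represented, by the last representative
    obtain ⟨P, ⟨hP, -⟩, hPD, hPc⟩ := hasPacking_packingNumber (G := G) D
    obtain ⟨T, hT⟩ : P.Nonempty := Finset.card_pos.1 (hPc ▸ h0)
    obtain ⟨x, hx⟩ : T.Nonempty := Finset.card_pos.1 (by rw [(hP T hT).card_eq]; simp)
    obtain ⟨u, huA, -⟩ := hd.cover x (Finset.disjoint_left.1 (hPD T hT) hx)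
    have hle : packingNumber G D ≤ n := by
      simpa using (hasPacking_packingNumber (G := G) D).le_card
    refine run_nest_visit (I := fun _ => True) (Q := fun τ => packingNumber G D ≤ τ.reg 20)
      (vals := fun r => if r = 6 then u else packingNumber G D) hok
      (fun _ _ _ _ _ => trivial) (fun _ _ _ _ => trivial)
      (hset (packingNumber G D ≤ ·)) ?_ ?_ ?_ trivial
    · intro τ hF hlt _ h
      obtain ⟨u', hu', hc⟩ := hlift τ hlt
      rw [body τ hF u' hu' hc]
      split_ifs with hif
      · exact h.trans hif.2.2.le
      · exact h
    · simp [hB.order]; omega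
    · intro τ hF hval _
      have h6 : τ.reg 6 = u := by simpa using hval (0, 6) (by simp)
      have h11 : τ.reg 11 = packingNumber G D := by simpa using hval (1, 11) (by simp)
      rw [body τ hF u h6 (h11.trans_le hle), h11]
      have := hasPacking_packingNumber (G := G) D
      split_ifs with hif
      · exact le_rfl
      · by_contra hlt
        exact hif ⟨huA, this, not_le.1 hlt⟩

theorem run_solveCmd (hG : IsDistanceHereditary G) (hB : Base G D σ) :
    (solveCmd.run σ).reg 20 = packingNumber G D := by
  have hB₁ : Base G D (initCmd.run σ) := hB.run (by decide)
  obtain ⟨A, hC, hA⟩ := run_phases hG hB₁ (run_initCmd hB)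
  have hB₂ : Base G D ((nest [(0, 5)] phaseCmd).run (initCmd.run σ)) := hB₁.run (by decide)
  simp only [solveCmd, run_seq, run_assign]
  exact run_extract (hB₂.congr (by simp) rfl rfl rfl) (hC.congr rfl rfl) hA
    (by simp [Expr.eval])

end TrianglePacking

/-! ### The greedy algorithm as a program -/

namespace TrianglePacking

open RAM RAM.Cmd

variable {n : ℕ} {G : SimpleGraph (Fin n)} {D : Finset (Fin n)} {σ τ : State}

/-- Appends the next multiple of `n + 1` to array `2`. -/
def mulBody : Cmd :=
  .store 2 (.var 22) (.var 23) ;; .assign 22 (.add (.var 22) (.const 1)) ;;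
    .assign 23 (.add (.var 23) (.add (.var 0) (.const 1)))

/-- Tabulates the first `(n + 1) ^ 3` multiples of `n + 1` in array `2`, as the machine cannot
multiply. -/
def mulCmd : Cmd := .loop 1 9 (.loop 1 10 (.loop 1 11 mulBody))

theorem run_mulCmd (h0 : σ.reg 0 = n) (h22 : σ.reg 22 = 0) (h23 : σ.reg 23 = 0) :
    ∀ i < (n + 1) * ((n + 1) * (n + 1)), (mulCmd.run σ).arr 2 i = i * (n + 1) := by
  let I : ℕ → State → Prop := fun m τ => τ.reg 0 = n ∧ τ.reg 22 = m ∧ τ.reg 23 = m * (n + 1) ∧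
    ∀ i < m, τ.arr 2 i = i * (n + 1)
  have hset : ∀ x ∈ [9, 10, 11], ∀ m τ v, I m τ → I m (τ.setReg x v) := by
    intro x hx m τ v h
    simp only [List.mem_cons, List.not_mem_nil, or_false] at hx
    rcases hx with rfl | rfl | rfl <;> simpa [I] using h
  have hbody : ∀ m τ, τ.reg 0 = n → I m τ → I (m + 1) (mulBody.run τ) := by
    rintro m τ - ⟨h1, h2, h3, h4⟩
    refine ⟨by simpa [mulBody, Expr.eval] using h1, by simp [mulBody, Expr.eval, h2],
      by simp [mulBody, Expr.eval, h3, h1, Nat.succ_mul], fun i hi => ?_⟩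
    simp only [mulBody, run_seq, run_store, run_assign, State.setReg_arr, State.setArr_arr,
      Expr.eval, h2, h3, true_and]
    split_ifs with h
    · rw [h]
    · exact h4 i (by omega)
  have h := run_loop_count (k := 1) (x := 9) (by decide) (by decide) (hset 9 (by simp))
    (fun m τ hn hI => run_loop_count (k := 1) (x := 10) (by decide) (by decide)
      (hset 10 (by simp))
      (fun m τ hn hI => run_loop_count (k := 1) (x := 11) (by decide) (by decide)
        (hset 11 (by simp)) hbody hn hI) hn hI) (m := 0) h0
    ⟨h0, h22, by simp [h23], by simp⟩
  simpa [mulCmd] using h.2.2.2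

theorem base_mulCmd (G : SimpleGraph (Fin n)) : Base G ∅ (mulCmd.run (graphInput G)) where
  order := by rw [run_reg (by decide)]; simp [graphInput]
  adj u v := by
    rw [run_arr (by decide)]
    simp only [graphInput, true_and, ne_eq, ite_eq_right_iff, one_ne_zero, imp_false, not_not]
    constructor
    · rintro ⟨u', v', h, he⟩
      rw [mul_comm, mul_comm n] at he
      obtain ⟨h1, h2⟩ := mul_add_inj v.2 v'.2 he
      rwa [Fin.ext h1, Fin.ext h2]
    · exact fun h => ⟨u, v, h, rfl⟩
  mul := run_mulCmd (by simp [graphInput]) (by simp [graphInput]) (by simp [graphInput])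
  del v := by
    rw [run_arr (by decide)]
    simp [graphInput]

/-- Stores `k` in array `3` for the vertices in registers `2`, `3`, `4`. -/
def markCmd (k : ℕ) : Cmd :=
  .store 3 (.var 2) (.const k) ;; .store 3 (.var 3) (.const k) ;; .store 3 (.var 4) (.const k)

/-- Three times the content of register `1`. -/
def tripleE : Expr := .add (.add (.var 1) (.var 1)) (.var 1)

/-- Appends the triangle in registers `2`, `3`, `4` to the output. -/
def acceptCmd : Cmd :=
  .store 1 tripleE (.var 2) ;; .store 1 (.add tripleE (.const 1)) (.var 3) ;;
    .store 1 (.add tripleE (.const 2)) (.var 4) ;; .assign 1 (.add (.var 1) (.const 1)) ;;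
    .assign 21 (.var 20)

/-- The vertices in registers `2`, `3`, `4` form a triangle that is disjoint from the vertices
marked in array `3`. -/
def triangleE : Expr :=
  .and (.and (adjE 2 3) (.and (adjE 2 4) (adjE 3 4)))
    (.and (.neg (.get 3 (.var 2))) (.and (.neg (.get 3 (.var 3))) (.neg (.get 3 (.var 4)))))

/-- Adds the triangle in registers `2`, `3`, `4` to the packing if the packing number, which
register `21` holds, drops by one only. -/
def tryCmd : Cmd :=
  .branch triangleE
    (markCmd 1 ;; solveCmd ;;
      .branch (.le (.var 21) (.add (.var 20) (.const 1))) acceptCmd (markCmd 0))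
    .skip

/-- The greedy algorithm for triangle packings. -/
def mainCmd : Cmd :=
  mulCmd ;; solveCmd ;; .assign 21 (.var 20) ;; nest [(0, 2), (0, 3), (0, 4)] tryCmd

theorem run_markCmd (k w : ℕ) : ((markCmd k).run σ).arr 3 w =
    if w = σ.reg 2 ∨ w = σ.reg 3 ∨ w = σ.reg 4 then k else σ.arr 3 w := by
  simp only [markCmd, run_seq, run_store, State.setArr_arr, State.setArr_reg, Expr.eval, true_and]
  split_ifs <;> tauto

theorem frame_markCmd (k : ℕ) :
    ((markCmd k).run σ).reg = σ.reg ∧ ∀ a ≠ 3, ((markCmd k).run σ).arr a = σ.arr a :=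
  ⟨rfl, fun a ha => by simp [markCmd, State.setArr_arr_of_ne _ _ _ ha]⟩

section Try

variable {i j k : Fin n}

theorem Base.mark (hB : Base G D σ) (hi : σ.reg 2 = i) (hj : σ.reg 3 = j) (hk : σ.reg 4 = k) :
    Base G (D ∪ {i, j, k}) ((markCmd 1).run σ) where
  order := hB.order
  adj := by rw [(frame_markCmd 1).2 0 (by decide)]; exact hB.adj
  mul := by rw [(frame_markCmd 1).2 2 (by decide)]; exact hB.mul
  del v := by
    rw [run_markCmd, hi, hj, hk]
    simp only [Fin.val_inj, Finset.mem_union, Finset.mem_insert, Finset.mem_singleton, ← hB.del]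
    split_ifs with h <;> simp [h]

theorem Base.unmark (hB : Base G (D ∪ {i, j, k}) σ) (hi : σ.reg 2 = i) (hj : σ.reg 3 = j)
    (hk : σ.reg 4 = k) (hD : Disjoint {i, j, k} D) : Base G D ((markCmd 0).run σ) where
  order := hB.order
  adj := by rw [(frame_markCmd 0).2 0 (by decide)]; exact hB.adj
  mul := by rw [(frame_markCmd 0).2 2 (by decide)]; exact hB.mul
  del v := by
    have h1 := hB.del v
    simp only [Finset.mem_union, Finset.mem_insert, Finset.mem_singleton] at h1
    rw [run_markCmd, hi, hj, hk]
    simp only [Fin.val_inj]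
    split_ifs with h
    · refine iff_of_false (by simp) (Finset.disjoint_left.1 hD ?_)
      simpa using h
    · rw [h1]; simp [h]

theorem Base.holds_triangleE (hB : Base G D σ) (hi : σ.reg 2 = i) (hj : σ.reg 3 = j)
    (hk : σ.reg 4 = k) :
    triangleE.Holds σ ↔ G.IsNClique 3 {i, j, k} ∧ Disjoint {i, j, k} D := by
  simp only [triangleE, Expr.holds_and, Expr.holds_neg, Expr.holds_get, Expr.eval,
    hB.holds_adjE hi hj, hB.holds_adjE hi hk, hB.holds_adjE hj hk, hi, hj, hk, hB.del,
    is3Clique_triple_iff, Finset.disjoint_insert_left, Finset.disjoint_singleton_left]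

/-- The state of the greedy algorithm with the packing `P`: it is in the output area, its vertices
are marked, and it extends to a maximum packing. -/
structure IsGreedy (G : SimpleGraph (Fin n)) (P : Finset (Finset (Fin n))) (σ : State) : Prop where
  packing : IsTrianglePacking G P
  output : OutputsPacking σ P
  base : Base G (P.biUnion id) σ
  number : σ.reg 21 = packingNumber G (P.biUnion id)
  extends_max : packingNumber G (P.biUnion id) + P.card = packingNumber G ∅

theorem IsGreedy.congr {P : Finset (Finset (Fin n))} (h : IsGreedy G P σ)
    (h0 : τ.reg 0 = σ.reg 0) (h1 : τ.reg 1 = σ.reg 1) (h21 : τ.reg 21 = σ.reg 21)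
    (ha : ∀ a ≤ 3, τ.arr a = σ.arr a) : IsGreedy G P τ where
  packing := h.packing
  output := by rw [OutputsPacking, h1, ha 1 (by simp)]; exact h.output
  base := h.base.congr h0 (ha 0 (by simp)) (ha 2 (by simp)) (ha 3 (by simp))
  number := h21.trans h.number
  extends_max := h.extends_max

theorem IsGreedy.unique {P Q : Finset (Finset (Fin n))} (h : IsGreedy G P σ)
    (h' : IsGreedy G Q σ) : P = Q :=
  Finset.ext fun T => (h.output.2 T).trans (h'.output.2 T).symm

theorem outputsPacking_acceptCmd {P : Finset (Finset (Fin n))} (h : OutputsPacking σ P)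
    (hi : σ.reg 2 = i) (hj : σ.reg 3 = j) (hk : σ.reg 4 = k) (hP : {i, j, k} ∉ P) :
    OutputsPacking (acceptCmd.run σ) (insert {i, j, k} P) := by
  have hr : (acceptCmd.run σ).reg 1 = P.card + 1 := by
    simp [acceptCmd, Expr.eval, h.1]
  have ha : ∀ m, (acceptCmd.run σ).arr 1 m = if m = 3 * P.card + 2 then (k : ℕ) else
      if m = 3 * P.card + 1 then (j : ℕ) else if m = 3 * P.card then (i : ℕ) else σ.arr 1 m := by
    intro m
    have e : P.card + P.card + P.card = 3 * P.card := by omega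
    simp [acceptCmd, Expr.eval, tripleE, h.1, hi, hj, hk, e]
  refine ⟨by rw [hr, Finset.card_insert_of_notMem hP], fun T => ?_⟩
  have hold : ∀ m < P.card, ∀ r < 3, (acceptCmd.run σ).arr 1 (3 * m + r) =
      σ.arr 1 (3 * m + r) := by
    intro m hm r hr
    rw [ha, if_neg (by omega), if_neg (by omega), if_neg (by omega)]
  have hnew : ({(acceptCmd.run σ).arr 1 (3 * P.card), (acceptCmd.run σ).arr 1 (3 * P.card + 1),
      (acceptCmd.run σ).arr 1 (3 * P.card + 2)} : Finset ℕ) =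
      ({i, j, k} : Finset (Fin n)).image (fun v : Fin n => (v : ℕ)) := by
    simp [ha]
  rw [Finset.mem_insert, h.2 T, hr, h.1]
  constructor
  · rintro (rfl | ⟨m, hm, hT⟩)
    · exact ⟨P.card, by omega, hnew.symm⟩
    · refine ⟨m, by omega, ?_⟩
      rw [hold m hm 1 (by simp), hold m hm 2 (by simp), hT]
      simpa using congrArg (fun t => ({t, _, _} : Finset ℕ)) (hold m hm 0 (by simp)).symm
  · rintro ⟨m, hm, hT⟩
    by_cases hmP : m = P.card
    · subst hmP
      rw [hnew] at hT
      exact .inl (Finset.image_injective Fin.val_injective hT)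
    · have hm' : m < P.card := by omega
      refine .inr ⟨m, hm', ?_⟩
      have h0 := hold m hm' 0 (by simp)
      rw [add_zero] at h0
      rw [hT, hold m hm' 1 (by simp), hold m hm' 2 (by simp), h0]

/-- After a triangle was tried, it is rejected: either it is now part of the packing, or it could
not be added without loss. -/
theorem run_tryCmd (hG : IsDistanceHereditary G) {P : Finset (Finset (Fin n))}
    (h : IsGreedy G P σ) (hi : σ.reg 2 = i) (hj : σ.reg 3 = j) (hk : σ.reg 4 = k) :
    ∃ Q, IsGreedy G Q (tryCmd.run σ) ∧
      (∀ T, IsRejected G (P.biUnion id) T → IsRejected G (Q.biUnion id) T) ∧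
      (G.IsNClique 3 {i, j, k} → IsRejected G (Q.biUnion id) {i, j, k}) := by
  have hcond := h.base.holds_triangleE hi hj hk
  rw [tryCmd, run_branch]
  split_ifs with hif
  · obtain ⟨hT, hTD⟩ := hcond.1 hif
    set σ₁ := (markCmd 1).run σ with hσ₁
    have hB₁ := h.base.mark hi hj hk
    set σ₂ := solveCmd.run σ₁ with hσ₂
    have hB₂ : Base G _ σ₂ := hB₁.run (c := solveCmd) (by decide)
    have hi₂ : σ₂.reg 2 = i := (run_reg (by decide) _).trans hi
    have hj₂ : σ₂.reg 3 = j := (run_reg (by decide) _).trans hj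
    have hk₂ : σ₂.reg 4 = k := (run_reg (by decide) _).trans hk
    have h1 : σ₂.reg 1 = σ.reg 1 := run_reg (by decide) σ₁
    have h21 : σ₂.reg 21 = σ.reg 21 := run_reg (by decide) σ₁
    have h20 : σ₂.reg 20 = packingNumber G (P.biUnion id ∪ {i, j, k}) := run_solveCmd hG hB₁
    have ha1 : σ₂.arr 1 = σ.arr 1 :=
      (run_arr (by decide) _).trans ((frame_markCmd 1).2 1 (by decide))
    have hout : OutputsPacking σ₂ P := by rw [OutputsPacking, h1, ha1]; exact h.output
    rw [run_seq, run_seq, ← hσ₁, ← hσ₂, run_branch]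
    have hlt := packingNumber_union_lt hT hTD
    have hmem : ∀ S ∈ P, S ⊆ P.biUnion id := fun S hS => Finset.subset_biUnion_of_mem id hS
    split_ifs with hacc
    · rw [Expr.holds_le] at hacc
      simp only [Expr.eval, h21, h20, h.number] at hacc
      have hTP : {i, j, k} ∉ P := by
        intro hmemT
        have h3 := hT.card_eq
        rw [disjoint_self.1 (hTD.mono_right (hmem _ hmemT))] at h3
        simp at h3
      have hU : (insert {i, j, k} P).biUnion id = P.biUnion id ∪ {i, j, k} := by
        rw [Finset.biUnion_insert, id, Finset.union_comm]
      refine ⟨insert {i, j, k} P, ⟨⟨?_, ?_⟩, outputsPacking_acceptCmd hout hi₂ hj₂ hk₂ hTP, ?_, ?_,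
        ?_⟩, ?_, ?_⟩
      · intro S hS
        rcases Finset.mem_insert.1 hS with rfl | hS
        exacts [hT, h.packing.1 S hS]
      · intro S hS S' hS' hne
        rcases Finset.mem_insert.1 hS with rfl | g <;> rcases Finset.mem_insert.1 hS' with rfl | g'
        · exact absurd rfl hne
        · exact hTD.mono_right (hmem _ g')
        · exact (hTD.mono_right (hmem _ g)).symm
        · exact h.packing.2 S g S' g' hne
      · rw [hU]
        exact hB₂.run (c := acceptCmd) (by decide)
      · rw [hU, ← h20]
        simp [acceptCmd, Expr.eval]
      · rw [hU, Finset.card_insert_of_notMem hTP]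
        have := h.extends_max
        omega
      · intro T hTr
        rw [hU]
        exact hTr.union hT hTD hacc
      · intro _
        rw [hU]
        exact isRejected_of_mem hT
    · rw [Expr.holds_le] at hacc
      simp only [Expr.eval, h21, h20, h.number] at hacc
      refine ⟨P, ⟨h.packing, ?_, hB₂.unmark hi₂ hj₂ hk₂ hTD, ?_, h.extends_max⟩, fun _ => id,
        fun _ => .inr (by omega)⟩
      · rw [OutputsPacking, (frame_markCmd 0).1, (frame_markCmd 0).2 1 (by decide)]
        exact hout
      · rw [(frame_markCmd 0).1, h21, h.number]
  · exact ⟨P, h, fun _ => id, fun hT => .inl fun hd => hif (hcond.2 ⟨hT, hd⟩)⟩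

end Try

theorem isGreedy_empty (hG : IsDistanceHereditary G) :
    IsGreedy G ∅ ((Cmd.assign 21 (.var 20)).run
      (solveCmd.run (mulCmd.run (graphInput G)))) where
  packing := ⟨by simp, by simp⟩
  output := by
    have h1 : (solveCmd.run (mulCmd.run (graphInput G))).reg 1 = 0 :=
      (run_reg (by decide) _).trans ((run_reg (by decide) _).trans (by simp [graphInput]))
    simp [OutputsPacking, h1]
  base := (((base_mulCmd G).run (c := solveCmd) (by decide))).congr (by simp) rfl rfl rfl
  number := by
    rw [run_assign, State.setReg_reg, if_pos rfl]
    exact run_solveCmd hG (base_mulCmd G)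
  extends_max := by simp

theorem run_mainCmd (hG : IsDistanceHereditary G) :
    ∃ P, OutputsPacking (mainCmd.run (graphInput G)) P ∧ IsMaximumTrianglePacking G P := by
  have hok : NestOK [(0, 2), (0, 3), (0, 4)] tryCmd := by decide
  simp only [mainCmd, run_seq]
  set σ := (Cmd.assign 21 (.var 20)).run (solveCmd.run (mulCmd.run (graphInput G))) with hσ
  have h0 : IsGreedy G ∅ σ := isGreedy_empty hG
  have hlift : ∀ τ : State,
      (∀ q ∈ [((0 : ℕ), (2 : ℕ)), (0, 3), (0, 4)], τ.reg q.2 < σ.reg 0 + q.1) →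
      ∃ i j k : Fin n, τ.reg 2 = i ∧ τ.reg 3 = j ∧ τ.reg 4 = k := by
    intro τ h
    simp only [h0.base.order, List.mem_cons, List.not_mem_nil, or_false, forall_eq_or_imp,
      forall_eq, add_zero] at h
    exact ⟨⟨_, h.1⟩, ⟨_, h.2.1⟩, ⟨_, h.2.2⟩, rfl, rfl, rfl⟩
  have hcongr : ∀ P, ∀ τ, IsGreedy G P τ →
      ∀ q ∈ [((0 : ℕ), (2 : ℕ)), (0, 3), (0, 4)], ∀ v, IsGreedy G P (τ.setReg q.2 v) := by
    intro P τ h q hq v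
    simp only [List.mem_cons, List.not_mem_nil, or_false] at hq
    refine h.congr ?_ ?_ ?_ fun _ _ => rfl <;> rcases hq with rfl | rfl | rfl <;> simp
  obtain ⟨P, hP⟩ := run_nest_inv (I := fun τ => ∃ P, IsGreedy G P τ) (σ := σ) hok
    (fun τ ⟨P, h⟩ q hq v => ⟨P, hcongr P τ h q hq v⟩)
    (fun τ _ hlt ⟨P, h⟩ => by
      obtain ⟨i, j, k, hi, hj, hk⟩ := hlift τ hlt
      obtain ⟨Q, hQ, -⟩ := run_tryCmd hG h hi hj hk
      exact ⟨Q, hQ⟩) ⟨∅, h0⟩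
  refine ⟨P, hP.output, hP.packing, fun Q hQ => ?_⟩
  have hrej : ∀ T, G.IsNClique 3 T → IsRejected G (P.biUnion id) T := by
    intro T hT
    obtain ⟨i, j, k, -, -, -, rfl⟩ := is3Clique_iff.1 hT
    obtain ⟨P', hP', hr⟩ := run_nest_visit (I := fun τ => ∃ P, IsGreedy G P τ)
      (Q := fun τ => ∃ P, IsGreedy G P τ ∧ IsRejected G (P.biUnion id) {i, j, k}) (σ := σ)
      (vals := fun r => if r = 2 then i else if r = 3 then j else k) hok
      (fun τ ⟨P, h⟩ q hq v => ⟨P, hcongr P τ h q hq v⟩)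
      (fun τ _ hlt ⟨P, h⟩ => by
        obtain ⟨i, j, k, hi, hj, hk⟩ := hlift τ hlt
        obtain ⟨Q, hQ, -⟩ := run_tryCmd hG h hi hj hk
        exact ⟨Q, hQ⟩)
      (fun τ ⟨P, h, h'⟩ q hq v => ⟨P, hcongr P τ h q hq v, h'⟩)
      (fun τ _ hlt _ ⟨P, h, h'⟩ => by
        obtain ⟨i', j', k', hi, hj, hk⟩ := hlift τ hlt
        obtain ⟨Q, hQ, hQ', -⟩ := run_tryCmd hG h hi hj hk
        exact ⟨Q, hQ, hQ' _ h'⟩)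
      (by simp [h0.base.order])
      (fun τ _ hv ⟨P, h⟩ => by
        have hi : τ.reg 2 = i := by simpa using hv (0, 2) (by simp)
        have hj : τ.reg 3 = j := by simpa using hv (0, 3) (by simp)
        have hk : τ.reg 4 = k := by simpa using hv (0, 4) (by simp)
        obtain ⟨Q, hQ, -, hQ'⟩ := run_tryCmd hG h hi hj hk
        exact ⟨Q, hQ, hQ' hT⟩)
      ⟨∅, h0⟩
    rwa [hP.unique hP']
  have hmax : Q.card ≤ packingNumber G ∅ :=
    HasPacking.le_packingNumber ⟨Q, hQ, fun T _ => Finset.disjoint_empty_right T, rfl⟩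
  rw [← hP.extends_max, packingNumber_eq_zero hrej, zero_add] at hmax
  exact hmax

end TrianglePacking

theorem mainTheorem4 :
    ∃ (A : RAM.Prog) (p : Polynomial ℕ),
      ∀ (n : ℕ) (G : SimpleGraph (Fin n)), IsDistanceHereditary G →
        ∃ (t : ℕ) (σ : RAM.State) (P : Finset (Finset (Fin n))),
          RAM.Exec A (graphInput G) t σ ∧ t ≤ p.eval n ∧
            OutputsPacking σ P ∧ IsMaximumTrianglePacking G P := by
  refine ⟨TrianglePacking.mainCmd.compile, TrianglePacking.mainCmd.cost, fun n G hG => ?_⟩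
  obtain ⟨t, ht, hE⟩ := TrianglePacking.mainCmd.exec_compile (by decide) (by decide) (graphInput G)
  obtain ⟨P, hP, hP'⟩ := TrianglePacking.run_mainCmd hG
  exact ⟨t, _, P, hE, by simpa [graphInput] using ht, hP, hP'⟩
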